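/- Let $\alpha,\beta,\gamma,\delta,q,t\in\mathbb C$ with $t\ne 0,1$ and $\gamma+\delta-2=\alpha+\beta+1$, and consider Heun's equation with $\epsilon=-2$, $$y''+\Big(\frac{\gamma}{z}+\frac{\delta}{z-1}-\frac{2}{z-t}\Big)y'+\frac{\alpha\beta z-q}{z(z-1)(z-t)}\,y=0.\qquad(\mathrm H)$$ The singularity $z=t$ (exponents $0$ and $3$) is called apparent if no logarithm occurs in the local solutions at $t$, i.e. if (H) has near $t$ a basis of solutions $\varphi(z)$, $(z-t)^3\psi(z)$ with $\varphi,\psi$ holomorphic at $t$ and $\varphi(t)\psi(t)\neq0$. (1) The singularity $z=t$ is apparent if and only if $$\begin{aligned}&q^3+\{(-3\alpha\beta-3\alpha-3\beta-1)t+(3\gamma-4)\}q^2\\&+\big[\{3\alpha^2\beta^2+6\alpha\beta(\alpha+\beta)+10\alpha\beta+2(\alpha^2+\beta^2)+2\alpha+2\beta\}t^2\\&\quad+\{(-6\alpha\beta-4\alpha-4\beta)\gamma+4\alpha\beta+4\alpha+4\beta\}t+2(\gamma-1)(\gamma-2)\big]q\\&-\alpha\beta t\{(\alpha+1)(\alpha+2)(\beta+1)(\beta+2)t^2-\gamma(3\alpha\beta+4\alpha+4\beta+4)t+2\gamma(\gamma-1)\}=0.\end{aligned}$$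 Assume from now on that $z=t$ is apparent, and put $$\begin{aligned}h(w)={}&2\alpha(\alpha+1)w^2+2(\alpha+1)\{q-\alpha(\beta+2)t\}w\\&+q^2-\{(2\alpha\beta+3\alpha+\beta+1)t-\gamma+2\}q+\alpha t\{t(\alpha+1)(\beta+1)(\beta+2)-\beta\gamma\}.\end{aligned}$$ (2) Every local branch of $v(w)=w^{\beta-\gamma}(w-1)^{\beta-\delta}h(w)$ on an open subset of $\mathbb C\setminus\{0,1,t\}$ is a solution of $$v''+\Big(\frac{\gamma-\beta+1}{w}+\frac{\delta-\beta+1}{w-1}-\frac{1+\beta}{w-t}\Big)v'+\frac{(2-\beta)(\alpha-\beta+1)w-q'}{w(w-1)(w-t)}\,v=0,$$ where $q'=q+(1-\beta)(-2+\delta t+(\gamma-\beta)(t+1))$. The polynomial $h$ is identically zero if and only if either $\alpha=0$ and $q=0$, or $\alpha=-1$ and $q^2+\{(\beta+2)t+\gamma-2\}q+\beta\gamma t=0$. In all cases this equation has a non-zero solution $w^{\beta-\gamma}(w-1)^{\beta-\delta}h_0(w)$ with a polynomial $h_0\neq0$ of degree at most $2$. (3) For $p\in\{0,1\}$ the functions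 $$y_p(z)=\int_{[\gamma_z,\gamma_p]}w^{\beta-\gamma}(w-1)^{\beta-\delta}h(w)(z-w)^{-\beta}\,dw$$ are solutions of (H). Here $[\gamma_z,\gamma_p]=\gamma_z\gamma_p\gamma_z^{-1}\gamma_p^{-1}$, where $\gamma_c$ ($c=z,p$) starts at a base point $o$, runs along a $C^1$ path to a circle that separates $c$ from the other points of $\{0,1,z\}$, runs once counter-clockwise around this circle, and returns along the same path; the paths avoid $0,1,z$, and the integrand is continued along the contour from any choice of branches. For a fixed $z_0$ the contour (with a circle of centre $z_0$, and with the closed discs bounded by the two circles disjoint) is kept fixed for $z$ in the open disc bounded by the circle around $z_0$, which the two paths do not enter, with branches depending continuously on $z$; the assertion is that $y_p$ is a solution on this disc minus $\{t\}$. (4) Suppose $\alpha,\beta,\beta-\gamma,\beta-\delta\notin\mathbb Z$. Then $y_0$ and $y_1$ are non-zero functions; precisely, $y_p$ is not identically zero near $z_0$ whenever the contour for $z_0$ is taken along the straight segment from $p$ to $z_0$ (base point on the segment, straight paths along the segment). (5) Suppose $\alpha,\beta,\beta-\gamma,\beta-\delta\notin\mathbb Z$, and that $2-\gamma$ and $\gamma-\alpha-\beta-1$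 are not in $\{0,-1,-2,\dots\}$, so that the following Gauss hypergeometric functions are defined. For $k=0,1,2$, the six functions $$z^{1-\gamma+k}F(\alpha-\gamma+3,\ \beta-\gamma+k+1;\ 2-\gamma+k;\ z),$$ $$(1-z)^{\gamma-\alpha-\beta-2+k}F(\gamma-\alpha-2+k,\ \gamma-\beta;\ \gamma-\alpha-\beta-1+k;\ 1-z),$$ given by principal powers and the hypergeometric series for $|z|<1$ and $|1-z|<1$ respectively, continue analytically to $\Omega=\mathbb C\setminus\big((-\infty,0]\cup[1,\infty)\big)$, and every solution of (H) on a connected open subset of $\Omega\setminus\{t\}$ is there a linear combination of these six functions with constant coefficients. -/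

import Mathlib

namespace HeunApp

noncomputable section

/-- `y` is a holomorphic solution on the open set `U` of Heun's equation
`y'' + (γ/z + δ/(z-1) + ε/(z-t)) y' + (αβ z - q)/(z(z-1)(z-t)) y = 0`. -/
def IsHeunSolution (α β γ δ ε q t : ℂ) (U : Set ℂ) (y : ℂ → ℂ) : Prop :=
  DifferentiableOn ℂ y U ∧ ∀ z ∈ U,
    deriv (deriv y) z + (γ / z + δ / (z - 1) + ε / (z - t)) * deriv y z
      + (α * β * z - q) / (z * (z - 1) * (z - t)) * y z = 0

/-- For `ε = -m`, near `z = t` there is a basis of local solutions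
`f(z) = φ(z) + A g(z) log (z-t)`, `g(z) = (z-t)^(m+1) ψ(z)`, where `φ`, `ψ` are power series in
`z - t` with non-zero constant terms.  (The principal branch of the logarithm is used, on a slit
disc around `t`.) -/
def HasLocalBasis (α β γ δ : ℂ) (m : ℕ) (q t A : ℂ) : Prop :=
  ∃ r > 0, ∃ φ ψ : ℂ → ℂ,
    DifferentiableOn ℂ φ (Metric.ball t r) ∧ DifferentiableOn ℂ ψ (Metric.ball t r) ∧
    φ t ≠ 0 ∧ ψ t ≠ 0 ∧
    IsHeunSolution α β γ δ (-(m : ℂ)) q t (Metric.ball t r ∩ {z | z - t ∈ Complex.slitPlane})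
      (fun z => φ z + A * ((z - t) ^ (m + 1) * ψ z) * Complex.log (z - t)) ∧
    IsHeunSolution α β γ δ (-(m : ℂ)) q t (Metric.ball t r ∩ {z | z - t ∈ Complex.slitPlane})
      (fun z => (z - t) ^ (m + 1) * ψ z)

/-- For `ε = -m`, the singularity `z = t` is apparent: no logarithmic term occurs. -/
def IsApparent (α β γ δ : ℂ) (m : ℕ) (q t : ℂ) : Prop :=
  HasLocalBasis α β γ δ m q t 0

/-- The cubic polynomial in `q`, for `ε = -2`. -/
def apparentCubic (α β γ q t : ℂ) : ℂ :=
  q ^ 3 + ((-3 * α * β - 3 * α - 3 * β - 1) * t + (3 * γ - 4)) * q ^ 2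
    + ((3 * α ^ 2 * β ^ 2 + 6 * α * β * (α + β) + 10 * α * β + 2 * (α ^ 2 + β ^ 2)
          + 2 * α + 2 * β) * t ^ 2
        + ((-6 * α * β - 4 * α - 4 * β) * γ + 4 * α * β + 4 * α + 4 * β) * t
        + 2 * (γ - 1) * (γ - 2)) * q
    - α * β * t * ((α + 1) * (α + 2) * (β + 1) * (β + 2) * t ^ 2
        - γ * (3 * α * β + 4 * α + 4 * β + 4) * t + 2 * γ * (γ - 1))

/-- The explicit quadratic polynomial `h(w)`. -/
def hPoly (α β γ q t : ℂ) : Polynomial ℂ :=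
  Polynomial.C (2 * α * (α + 1)) * Polynomial.X ^ 2
    + Polynomial.C (2 * (α + 1) * (q - α * (β + 2) * t)) * Polynomial.X
    + Polynomial.C (q ^ 2 - ((2 * α * β + 3 * α + β + 1) * t - γ + 2) * q
        + α * t * (t * (α + 1) * (β + 1) * (β + 2) - β * γ))

/-- `l` is a continuous branch of `log f` on `S`. -/
def IsLogBranch {X : Type*} [TopologicalSpace X] (S : Set X) (f l : X → ℂ) : Prop :=
  ContinuousOn l S ∧ ∀ x ∈ S, Complex.exp (l x) = f x

/-- Every local branch of `v(w) = w^(β-γ) (w-1)^(β-δ) h(w)` solves the Heun equation obtained from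
the one with parameters `α, β, γ, δ, ε = -2, q` by the integral transformation with `η = β`, i.e.
the one with parameters `α' = 2-η`, `β' = α+β-2η+1`, `γ' = γ-η+1`, `δ' = δ-η+1`, `ε' = ε-η+1`,
`q' = q + (1-η)(ε + δ t + (γ-η)(t+1))`. -/
def SolvesTransformed (α β γ δ q t : ℂ) (h : Polynomial ℂ) : Prop :=
  ∀ (U : Set ℂ) (l₀ l₁ : ℂ → ℂ), IsOpen U → 0 ∉ U → 1 ∉ U → t ∉ U →
    IsLogBranch U (fun w => w) l₀ → IsLogBranch U (fun w => w - 1) l₁ →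
    IsHeunSolution (2 - β) (α + β - 2 * β + 1) (γ - β + 1) (δ - β + 1) (-2 - β + 1)
      (q + (1 - β) * (-2 + δ * t + (γ - β) * (t + 1))) t U
      (fun w => Complex.exp ((β - γ) * l₀ w + (β - δ) * l₁ w) * h.eval w)

/-- The counter-clockwise circle with centre `c`, starting and ending at `c + u`. -/
def circlePath (c u : ℂ) : Path (c + u) (c + u) where
  toFun s := c + u * Complex.exp (2 * Real.pi * Complex.I * ((s : ℝ) : ℂ))
  continuous_toFun := by fun_prop
  source' := by simp
  target' := by simp

/-- The cycle `γ_c` based at `o`: follow `τ` to `c + u`, go once around `c` counter-clockwise,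
and come back along `τ`. -/
def loopAround {o : ℂ} (c u : ℂ) (τ : Path o (c + u)) : Path o o :=
  (τ.trans (circlePath c u)).trans τ.symm

/-- The commutator `A B A⁻¹ B⁻¹` of two loops. -/
def commutatorLoop {o : ℂ} (A B : Path o o) : Path o o :=
  ((A.trans B).trans A.symm).trans B.symm

/-- Admissible data for the Pochhammer contour `[γ_z, γ_p]`, `p ∈ {0, 1}`, simultaneously for all
`z` in the disc with centre `z₀` and radius `‖u‖`: the circle with centre `z₀` through `z₀ + u`
surrounds `z` but neither `0` nor `1`, the circle with centre `p` through `p + u'` surrounds `p` but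
neither `z` nor the other point `1 - p`, and the tails joining the base point `o` to these circles
are continuously differentiable and avoid `0`, `1` and all these `z`. -/
structure IsAdmissible {o : ℂ} (p z₀ u u' : ℂ) (τ : Path o (z₀ + u)) (τ' : Path o (p + u')) :
    Prop where
  u_ne : u ≠ 0
  u'_ne : u' ≠ 0
  zero_notMem : (0 : ℂ) ∉ Metric.closedBall z₀ ‖u‖
  one_notMem : (1 : ℂ) ∉ Metric.closedBall z₀ ‖u‖
  other_notMem : 1 - p ∉ Metric.closedBall p ‖u'‖
  disj : Disjoint (Metric.closedBall z₀ ‖u‖) (Metric.closedBall p ‖u'‖)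
  smooth : ContDiffOn ℝ 1 τ.extend (Set.Icc 0 1)
  smooth' : ContDiffOn ℝ 1 τ'.extend (Set.Icc 0 1)
  avoid : ∀ s, τ s ≠ 0 ∧ τ s ≠ 1 ∧ τ s ∉ Metric.ball z₀ ‖u‖
  avoid' : ∀ s, τ' s ≠ 0 ∧ τ' s ≠ 1 ∧ τ' s ∉ Metric.ball z₀ ‖u‖

/-- `L₀`, `L₁`, `L` are continuous branches, along the path `c`, of `log w`, `log (w - 1)` and,
for `z` in the disc `D` (continuously in `z` as well), of `log (z - w)`. -/
structure IsBranchData {o : ℂ} (c : Path o o) (D : Set ℂ) (L₀ L₁ : ℝ → ℂ) (L : ℂ × ℝ → ℂ) :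
    Prop where
  log_w : IsLogBranch (Set.Icc 0 1) (fun s => c.extend s) L₀
  log_w_sub_one : IsLogBranch (Set.Icc 0 1) (fun s => c.extend s - 1) L₁
  log_z_sub_w : IsLogBranch (D ×ˢ Set.Icc 0 1) (fun x => x.1 - c.extend x.2) L

/-- `∫_c w^(β-γ) (w-1)^(β-δ) h(w) (z-w)^(-β) dw`, the powers being those given by the branches
`L₀`, `L₁`, `L` of the logarithms along `c`. -/
def contourIntegral (β γ δ : ℂ) (h : Polynomial ℂ) {o : ℂ} (c : Path o o)
    (L₀ L₁ : ℝ → ℂ) (L : ℂ × ℝ → ℂ) (z : ℂ) : ℂ :=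
  ∫ s in (0 : ℝ)..1, Complex.exp ((β - γ) * L₀ s) * Complex.exp ((β - δ) * L₁ s)
    * h.eval (c.extend s) * Complex.exp (-β * L (z, s)) * deriv c.extend s

/-- The plane cut along `(-∞, 0]` and `[1, ∞)`. -/
def cutPlane : Set ℂ := {z | z ∈ Complex.slitPlane ∧ 1 - z ∈ Complex.slitPlane}

def NotInt (a : ℂ) : Prop := ∀ n : ℤ, a ≠ n

/-- `a ∉ {0, -1, -2, …}`, so that `F(·, ·; a; z)` is defined. -/
def NotNonposInt (a : ℂ) : Prop := ∀ n : ℕ, a ≠ -(n : ℂ)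

end

end HeunApp

/-! Apparency. Written as a power series at `t`, Heun's equation is a three-term recurrence whose
row `n` multiplies the next coefficient by `(n+1)(n-2)t(t-1)`. This factor vanishes at `n = 2`, so
the first three rows constrain the coefficients `a 0, a 1, a 2` alone, and eliminating `a 1`, `a 2`
leaves `apparentCubic * a 0 = 0`. Conversely, the cubic makes these rows solvable with `a 0 = 1`,
the coefficient of order three is free, and the later rows determine a geometrically bounded
sequence.

Polynomial factor and integrals. After division by `w^(β-γ)(w-1)^(β-δ)` the transformed equation
acts on polynomials of degree at most 2 by a 3×3 matrix with determinant `-apparentCubic`; `hPoly`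
is its kernel vector found by back substitution. Heun's operator in `z`, applied to `(z-w)^(-β)`
times the weight, is exact in `w` modulo the equation of the polynomial
(`IsKernelPoly.isHeunSolution_weightInt`), and a commutator loop closes all branches, so the
integral of the exact form is zero.

Non-vanishing. If a Pochhammer integral vanished identically, differentiation in `z` and integration
by parts would move the exponents at both ends of the segment to positive real part, at the price of
applying Euler operators to the integrand (`Vanishes`). Then `∫₀¹ x^b (1-x)^e f(xy) dx` vanishes,
and since its Taylor coefficients are those of `f` times non-zero Beta values, `f = 0`. An Euler
operator multiplies the `n`-th coefficient by `n + κ`, so undoing it loses finitely many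
coefficients: a non-integral power of a linear function times a polynomial would be a polynomial,
which is absurd (`not_taylorFinite_of_polynomial`).

Six functions. On power series at 0 the Euler transformation multiplies the `n`-th coefficient by
`(β-γ+1)ₙ/(2-γ)ₙ`. Applied to `(1-w)^(β-δ) h(w)` with `h` quadratic it yields three hypergeometric
functions (`exists_local_solution`); the symmetry `z ↦ 1-z` yields three more. Were the two
resulting solutions proportional, stripping the powers would leave an entire solution of a Heun
equation with non-integral exponents at infinity, hence zero (`not_proportional`). Two independent
solutions span all of them. -/

namespace HeunApp

open Filter Topology Set MeasureTheory

/-! ### Taylor coefficients at the origin and second order recurrences -/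

/-- `f` is analytic at `0` with Taylor coefficients `a`. -/
def HasTaylor (f : ℂ → ℂ) (a : ℕ → ℂ) : Prop :=
  AnalyticAt ℂ f 0 ∧ ∀ n, iteratedDeriv n f 0 = n.factorial * a n

namespace HasTaylor

variable {f g : ℂ → ℂ} {a b : ℕ → ℂ}

theorem of_analyticAt (hf : AnalyticAt ℂ f 0) :
    HasTaylor f (fun n => iteratedDeriv n f 0 / n.factorial) :=
  ⟨hf, fun n => (mul_div_cancel₀ _ (by exact_mod_cast n.factorial_ne_zero)).symm⟩

theorem hasFPowerSeriesAt (h : HasTaylor f a) :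
    HasFPowerSeriesAt f (FormalMultilinearSeries.ofScalars ℂ a) 0 := by
  have h1 := h.1.hasFPowerSeriesAt
  have h2 : (fun n => iteratedDeriv n f 0 / (n.factorial : ℂ)) = a := by
    ext n
    rw [h.2 n, mul_div_cancel_left₀ _ (by exact_mod_cast n.factorial_ne_zero)]
  rwa [h2] at h1

theorem of_hasFPowerSeriesAt
    (h : HasFPowerSeriesAt f (FormalMultilinearSeries.ofScalars ℂ a) 0) : HasTaylor f a := by
  refine ⟨h.analyticAt, fun n => ?_⟩
  have h2 := FormalMultilinearSeries.ofScalars_series_injective ℂ ℂ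
    (h.eq_formalMultilinearSeries h.analyticAt.hasFPowerSeriesAt)
  rw [h2]
  exact (mul_div_cancel₀ _ (by exact_mod_cast n.factorial_ne_zero)).symm

theorem unique (h : HasTaylor f a) (h' : HasTaylor f b) : a = b := by
  ext n
  have := (h.2 n).symm.trans (h'.2 n)
  exact mul_left_cancel₀ (by exact_mod_cast n.factorial_ne_zero) this

theorem congr (h : HasTaylor f a) (hfg : f =ᶠ[𝓝 0] g) : HasTaylor g a :=
  ⟨h.1.congr hfg, fun n => by rw [← h.2 n, hfg.iteratedDeriv_eq]⟩

theorem eventuallyEq (h : HasTaylor f a) (h' : HasTaylor g a) : f =ᶠ[𝓝 0] g := by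
  have h2 := h.hasFPowerSeriesAt.sub h'.hasFPowerSeriesAt
  rw [sub_self] at h2
  filter_upwards [h2.eventually_eq_zero] with z hz using sub_eq_zero.1 hz

theorem add (h : HasTaylor f a) (h' : HasTaylor g b) :
    HasTaylor (fun z => f z + g z) (fun n => a n + b n) :=
  ⟨h.1.add h'.1, fun n => by
    have := iteratedDeriv_add (n := n) h.1.contDiffAt h'.1.contDiffAt
    simp only [Pi.add_def] at this
    rw [this, h.2, h'.2]; ring⟩

theorem const_mul (h : HasTaylor f a) (c : ℂ) :
    HasTaylor (fun z => c * f z) (fun n => c * a n) :=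
  ⟨analyticAt_const.mul h.1, fun n => by
    rw [iteratedDeriv_const_mul c h.1.contDiffAt, h.2]; ring⟩

theorem deriv (h : HasTaylor f a) : HasTaylor (deriv f) (fun n => (n + 1) * a (n + 1)) :=
  ⟨h.1.deriv, fun n => by
    rw [← iteratedDeriv_succ', h.2, Nat.factorial_succ]; push_cast; ring⟩

end HasTaylor

/-- The sequence shifted to the right. -/
def shiftSeq (a : ℕ → ℂ) : ℕ → ℂ
  | 0 => 0
  | n + 1 => a n

@[simp] theorem shiftSeq_zero (a : ℕ → ℂ) : shiftSeq a 0 = 0 := rfl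

@[simp] theorem shiftSeq_succ (a : ℕ → ℂ) (n : ℕ) : shiftSeq a (n + 1) = a n := rfl

theorem iteratedDeriv_id_mul (n : ℕ) : ∀ {f : ℂ → ℂ}, AnalyticAt ℂ f 0 →
    iteratedDeriv (n + 1) (fun z => z * f z) 0 = (n + 1) * iteratedDeriv n f 0 := by
  induction n with
  | zero =>
    intro f hf
    rw [zero_add, iteratedDeriv_one, iteratedDeriv_zero]
    have := (hasDerivAt_id' (0 : ℂ)).fun_mul hf.differentiableAt.hasDerivAt
    simpa using this.deriv
  | succ n ih =>
    intro f hf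
    have h1 : deriv (fun z => z * f z) =ᶠ[𝓝 0] fun z => f z + z * deriv f z := by
      filter_upwards [hf.eventually_analyticAt] with z hz
      have := (hasDerivAt_id' z).fun_mul hz.differentiableAt.hasDerivAt
      simpa using this.deriv
    rw [iteratedDeriv_succ', h1.iteratedDeriv_eq]
    have h2 := iteratedDeriv_add (n := n + 1) (f := f) (g := fun z => z * deriv f z) (x := 0)
      hf.contDiffAt (analyticAt_id.mul hf.deriv).contDiffAt
    simp only [Pi.add_def] at h2
    rw [h2, ih hf.deriv, ← iteratedDeriv_succ']
    push_cast
    ring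

theorem HasTaylor.id_mul {f : ℂ → ℂ} {a : ℕ → ℂ} (h : HasTaylor f a) :
    HasTaylor (fun z => z * f z) (shiftSeq a) := by
  refine ⟨analyticAt_id.mul h.1, fun n => ?_⟩
  cases n with
  | zero => simp
  | succ n =>
    rw [iteratedDeriv_id_mul n h.1, h.2, shiftSeq_succ, Nat.factorial_succ]
    push_cast
    ring

theorem exists_hasTaylor_of_le {a : ℕ → ℂ} {C R : ℝ} (hR : 0 < R)
    (h : ∀ n, ‖a n‖ ≤ C * R ^ n) : ∃ f, HasTaylor f a := by
  let p := FormalMultilinearSeries.ofScalars ℂ a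
  have hr : 0 < p.radius := by
    let r : NNReal := ⟨R⁻¹, by positivity⟩
    have h1 : (r : ENNReal) ≤ p.radius := by
      refine p.le_radius_of_bound C fun n => ?_
      rw [FormalMultilinearSeries.ofScalars_norm]
      calc ‖a n‖ * (R⁻¹) ^ n ≤ C * R ^ n * (R⁻¹) ^ n := by gcongr; exact h n
        _ = C := by rw [mul_assoc, ← mul_pow, mul_inv_cancel₀ hR.ne', one_pow, mul_one]
    refine lt_of_lt_of_le ?_ h1
    have : 0 < r := by rw [← NNReal.coe_pos]; exact inv_pos.2 hR
    exact_mod_cast this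
  exact ⟨p.sum, .of_hasFPowerSeriesAt ⟨_, p.hasFPowerSeriesOnBall hr⟩⟩

/-- A second order operator with a simple zero of the leading coefficient at the origin. -/
noncomputable def odeOp (s p k₂ k₁ k₀ m₁ m₀ : ℂ) (y : ℂ → ℂ) (x : ℂ) : ℂ :=
  (x ^ 3 + s * x ^ 2 + p * x) * deriv (deriv y) x + (k₂ * x ^ 2 + k₁ * x + k₀) * deriv y x
    + (m₁ * x + m₀) * y x

/-- The coefficients of `odeOp` applied to a power series. -/
def odeCoeff (s p k₂ k₁ k₀ m₁ m₀ : ℂ) (a : ℕ → ℂ) (n : ℕ) : ℂ :=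
  (n + 1) * (p * n + k₀) * a (n + 1) + (s * n * (n - 1) + k₁ * n + m₀) * a n
    + ((n - 1) * (n - 2) + k₂ * (n - 1) + m₁) * shiftSeq a n

theorem HasTaylor.odeOp {y : ℂ → ℂ} {a : ℕ → ℂ} (h : HasTaylor y a) (s p k₂ k₁ k₀ m₁ m₀ : ℂ) :
    HasTaylor (odeOp s p k₂ k₁ k₀ m₁ m₀ y) (odeCoeff s p k₂ k₁ k₀ m₁ m₀ a) := by
  have d1 := h.deriv
  have d2 := h.deriv.deriv
  have key := ((((d2.id_mul.id_mul.id_mul).add (d2.id_mul.id_mul.const_mul s)).add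
    (d2.id_mul.const_mul p)).add ((d1.id_mul.id_mul.const_mul k₂).add
    ((d1.id_mul.const_mul k₁).add (d1.const_mul k₀)))).add
    ((h.id_mul.const_mul m₁).add (h.const_mul m₀))
  convert key using 1
  · ext x; simp only [HeunApp.odeOp]; ring
  · ext n
    rcases n with _ | _ | _ | n <;> simp [odeCoeff] <;> ring

/-- Uniqueness of power series. This is the passage between differential equations and recurrences,
used in both directions at `t` and at `0`. -/
theorem HasTaylor.odeOp_eventually_eq_zero_iff {y : ℂ → ℂ} {a : ℕ → ℂ} (h : HasTaylor y a)
    (s p k₂ k₁ k₀ m₁ m₀ : ℂ) :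
    (∀ᶠ x in 𝓝 0, HeunApp.odeOp s p k₂ k₁ k₀ m₁ m₀ y x = 0) ↔
      ∀ n, odeCoeff s p k₂ k₁ k₀ m₁ m₀ a n = 0 := by
  have h0 : HasTaylor (fun _ => (0 : ℂ)) (fun _ => 0) :=
    ⟨analyticAt_const, fun n => by simp [iteratedDeriv_fun_const_zero]⟩
  have h1 := h.odeOp s p k₂ k₁ k₀ m₁ m₀
  constructor
  · intro hz n
    have := (h1.congr (g := fun _ => 0) hz).unique h0
    exact congrFun this n
  · intro hz
    have h2 : odeCoeff s p k₂ k₁ k₀ m₁ m₀ a = fun _ => 0 := funext hz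
    rw [h2] at h1
    exact h1.eventuallyEq h0


/-! ### Heun's operator without denominators, expanded at `0` and at `t` -/

/-- Heun's operator with denominators cleared. -/
noncomputable def heunOp (α β γ δ ε q t : ℂ) (y : ℂ → ℂ) (z : ℂ) : ℂ :=
  z * (z - 1) * (z - t) * deriv (deriv y) z
    + (γ * (z - 1) * (z - t) + δ * z * (z - t) + ε * z * (z - 1)) * deriv y z
    + (α * β * z - q) * y z

theorem heun_eq_zero_iff {γ δ ε κ t z d₂ d₁ d₀ : ℂ} (h0 : z ≠ 0) (h1 : z ≠ 1) (ht : z ≠ t) :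
    d₂ + (γ / z + δ / (z - 1) + ε / (z - t)) * d₁ + κ / (z * (z - 1) * (z - t)) * d₀ = 0 ↔
      z * (z - 1) * (z - t) * d₂
        + (γ * (z - 1) * (z - t) + δ * z * (z - t) + ε * z * (z - 1)) * d₁ + κ * d₀ = 0 := by
  have h1' : z - 1 ≠ 0 := sub_ne_zero.2 h1
  have ht' : z - t ≠ 0 := sub_ne_zero.2 ht
  have key : z * (z - 1) * (z - t) *
      (d₂ + (γ / z + δ / (z - 1) + ε / (z - t)) * d₁ + κ / (z * (z - 1) * (z - t)) * d₀) =
      z * (z - 1) * (z - t) * d₂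
        + (γ * (z - 1) * (z - t) + δ * z * (z - t) + ε * z * (z - 1)) * d₁ + κ * d₀ := by
    field_simp
  rw [← key, mul_eq_zero, or_iff_right (by positivity)]

theorem isHeunSolution_iff {α β γ δ ε q t : ℂ} {U : Set ℂ} {y : ℂ → ℂ} (h0 : 0 ∉ U) (h1 : 1 ∉ U)
    (ht : t ∉ U) : IsHeunSolution α β γ δ ε q t U y ↔
      DifferentiableOn ℂ y U ∧ ∀ z ∈ U, heunOp α β γ δ ε q t y z = 0 := by
  refine and_congr_right fun _ => forall₂_congr fun z hz => ?_
  exact heun_eq_zero_iff (fun h => h0 (h ▸ hz)) (fun h => h1 (h ▸ hz)) (fun h => ht (h ▸ hz))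

theorem heunOp_eq_odeOp (α β γ δ ε q t : ℂ) (y : ℂ → ℂ) (z : ℂ) :
    heunOp α β γ δ ε q t y z = odeOp (-(1 + t)) t (γ + δ + ε) (-(γ * (1 + t) + δ * t + ε)) (γ * t)
      (α * β) (-q) y z := by
  simp only [heunOp, odeOp]; ring

theorem heunOp_const_add (α β γ δ ε q t : ℂ) (y : ℂ → ℂ) (x : ℂ) :
    heunOp α β γ δ ε q t y (t + x) = odeOp (2 * t - 1) (t * (t - 1)) (γ + δ + ε)
      (γ * (t - 1) + δ * t + ε * (2 * t - 1)) (ε * t * (t - 1)) (α * β) (α * β * t - q)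
      (fun x => y (t + x)) x := by
  have h1 : deriv (fun x => y (t + x)) = fun x => deriv y (t + x) :=
    funext fun x => deriv_comp_const_add _ _ _
  simp only [heunOp, odeOp, h1, deriv_comp_const_add]
  ring

theorem heunOp_congr {α β γ δ ε q t : ℂ} {y₁ y₂ : ℂ → ℂ} {z : ℂ} (h : y₁ =ᶠ[𝓝 z] y₂) :
    heunOp α β γ δ ε q t y₁ z = heunOp α β γ δ ε q t y₂ z := by
  simp only [heunOp, h.deriv.deriv_eq, h.deriv_eq, h.eq_of_nhds]

theorem differentiableOn_heunOp {α β γ δ ε q t : ℂ} {y : ℂ → ℂ} {U : Set ℂ} (hU : IsOpen U)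
    (hy : DifferentiableOn ℂ y U) : DifferentiableOn ℂ (heunOp α β γ δ ε q t y) U := by
  have h1 := hy.deriv hU
  have h2 := h1.deriv hU
  unfold heunOp
  fun_prop

theorem analyticAt_odeOp {s p k₂ k₁ k₀ m₁ m₀ : ℂ} {y : ℂ → ℂ} {x : ℂ} (hy : AnalyticAt ℂ y x) :
    AnalyticAt ℂ (odeOp s p k₂ k₁ k₀ m₁ m₀ y) x := by
  have h1 := hy.deriv
  have h2 := h1.deriv
  unfold odeOp
  fun_prop

/-! ### The apparent singularity and the cubic condition -/

section Apparent

variable {α β γ δ q t : ℂ}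

/-- Row `n = 2` does not contain `a 3`, because `ε = -2` makes `n + ε` vanish there. The multipliers
of the three rows are those of Gaussian elimination of `a 2` and then `a 1`. -/
theorem apparentCubic_mul_eq_zero {a : ℕ → ℂ} (hδ : γ + δ + (-2) = α + β + 1)
    (h : ∀ n, odeCoeff (2 * t - 1) (t * (t - 1)) (γ + δ + (-2))
      (γ * (t - 1) + δ * t + (-2) * (2 * t - 1)) ((-2) * t * (t - 1)) (α * β) (α * β * t - q)
      a n = 0) : apparentCubic α β γ q t * a 0 = 0 := by
  have e0 := h 0
  have e1 := h 1
  have e2 := h 2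
  obtain rfl : δ = α + β + 3 - γ := by linear_combination hδ
  simp [odeCoeff] at e0 e1 e2
  unfold apparentCubic
  linear_combination (-4 * (t * (t - 1)) ^ 2) * e2
    + (-2 * (t * (t - 1)) * (2 * (2 * t - 1) + 2 * (γ * (t - 1) + (α + β + 3 - γ) * t
      - 2 * (2 * t - 1)) + (α * β * t - q))) * e1
    + (-2 * (t * (t - 1)) * ((α + 1) * (β + 1)) - (2 * (2 * t - 1) + 2 * (γ * (t - 1) +
      (α + β + 3 - γ) * t - 2 * (2 * t - 1)) + (α * β * t - q)) * ((γ * (t - 1)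
      + (α + β + 3 - γ) * t - 2 * (2 * t - 1)) + (α * β * t - q))) * e0

/-- The equation is only known on a slit disc, but the operator applied to a function holomorphic at
`t` is analytic there, and its zeros on the positive direction accumulate at `t`. -/
theorem eventually_odeOp_eq_zero_of_slit (ht0 : t ≠ 0) (ht1 : t ≠ 1) {ε : ℂ} {φ : ℂ → ℂ} {r : ℝ}
    (hr : 0 < r) (hφ : DifferentiableOn ℂ φ (Metric.ball t r))
    (h : IsHeunSolution α β γ δ ε q t (Metric.ball t r ∩ {z | z - t ∈ Complex.slitPlane}) φ) :
    ∀ᶠ x in 𝓝 0, odeOp (2 * t - 1) (t * (t - 1)) (γ + δ + ε)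
      (γ * (t - 1) + δ * t + ε * (2 * t - 1)) (ε * t * (t - 1)) (α * β) (α * β * t - q)
      (fun x => φ (t + x)) x = 0 := by
  have hφ' : AnalyticAt ℂ φ (t + 0) := by
    rw [add_zero]
    exact hφ.analyticAt (Metric.ball_mem_nhds t hr)
  have han : AnalyticAt ℂ (fun x => φ (t + x)) 0 :=
    hφ'.comp (f := fun x => t + x) (analyticAt_const.add analyticAt_id)
  rw [← (analyticAt_odeOp han).frequently_zero_iff_eventually_zero]
  have htend : Tendsto (fun s : ℝ => (s : ℂ)) (𝓝[>] 0) (𝓝[≠] 0) := by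
    refine tendsto_nhdsWithin_iff.2 ⟨?_, ?_⟩
    · exact (Complex.continuous_ofReal.tendsto' 0 0 (by simp)).mono_left nhdsWithin_le_nhds
    · filter_upwards [self_mem_nhdsWithin] with s hs
      simpa using (ne_of_gt hs : s ≠ 0)
  refine htend.frequently (Eventually.frequently ?_)
  have hc : Tendsto (fun s : ℝ => t + (s : ℂ)) (𝓝[>] 0) (𝓝 t) := by
    have : Continuous fun s : ℝ => t + (s : ℂ) := by fun_prop
    exact (this.tendsto' 0 t (by simp)).mono_left nhdsWithin_le_nhds
  filter_upwards [self_mem_nhdsWithin, hc.eventually (Metric.ball_mem_nhds t hr),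
    hc.eventually_ne ht0, hc.eventually_ne ht1] with s hs hb h0 h1
  have hs' : (s : ℂ) ≠ 0 := by simpa using (ne_of_gt hs : s ≠ 0)
  rw [← heunOp_const_add]
  refine (heun_eq_zero_iff h0 h1 (by simpa using hs')).1 (h.2 _ ⟨hb, ?_⟩)
  simpa using hs

theorem apparentCubic_eq_zero_of_isApparent (ht0 : t ≠ 0) (ht1 : t ≠ 1)
    (hδ : γ + δ + (-2) = α + β + 1) (h : IsApparent α β γ δ 2 q t) :
    apparentCubic α β γ q t = 0 := by
  obtain ⟨r, hr, φ, ψ, hφ, -, hφt, -, hsol, -⟩ := h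
  have hsol' : IsHeunSolution α β γ δ (-2) q t
      (Metric.ball t r ∩ {z | z - t ∈ Complex.slitPlane}) φ := by simpa using hsol
  have hev := eventually_odeOp_eq_zero_of_slit ht0 ht1 hr hφ hsol'
  have hφ' : AnalyticAt ℂ φ (t + 0) := by
    rw [add_zero]
    exact hφ.analyticAt (Metric.ball_mem_nhds t hr)
  have hT := HasTaylor.of_analyticAt (f := fun x => φ (t + x)) (hφ'.comp
    (f := fun x => t + x) (analyticAt_const.add analyticAt_id))
  have := apparentCubic_mul_eq_zero hδ ((hT.odeOp_eventually_eq_zero_iff _ _ _ _ _ _ _).1 hev)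
  simpa [hφt] using this

theorem exists_seq_of_recurrence (c₀ c₁ c₂ c₃ : ℂ) (B C : ℕ → ℂ) :
    ∃ a : ℕ → ℂ, a 0 = c₀ ∧ a 1 = c₁ ∧ a 2 = c₂ ∧ a 3 = c₃ ∧
      ∀ n, a (n + 4) = B n * a (n + 3) + C n * a (n + 2) := by
  let F : ℕ → ℂ × ℂ := fun n => Nat.rec (c₂, c₃) (fun n x => (x.2, B n * x.2 + C n * x.1)) n
  refine ⟨fun n => match n with
    | 0 => c₀
    | 1 => c₁
    | n + 2 => (F n).1, rfl, rfl, rfl, rfl, fun n => rfl⟩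

/-- Bounded coefficients force at most geometric growth, with ratio `2M + 1`; the first four terms
are absorbed in the constant. -/
theorem exists_bound_of_recurrence {a B C : ℕ → ℂ} {M : ℝ}
    (h : ∀ n, a (n + 4) = B n * a (n + 3) + C n * a (n + 2))
    (hB : ∀ n, ‖B n‖ ≤ M) (hC : ∀ n, ‖C n‖ ≤ M) :
    ∃ K R : ℝ, 0 < R ∧ ∀ n, ‖a n‖ ≤ K * R ^ n := by
  have hM : 0 ≤ M := (norm_nonneg _).trans (hB 0)
  set K := ‖a 0‖ + ‖a 1‖ + ‖a 2‖ + ‖a 3‖ with hK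
  have hK0 : 0 ≤ K := by positivity
  set R := 2 * M + 1 with hR
  have hR1 : 1 ≤ R := by linarith
  have hKR : ∀ n, K ≤ K * R ^ n := fun n => le_mul_of_one_le_right hK0 (one_le_pow₀ hR1)
  refine ⟨K, R, by linarith, fun n => ?_⟩
  induction n using Nat.strong_induction_on with
  | _ n ih =>
    rcases n with _ | _ | _ | _ | n
    · refine le_trans ?_ (hKR _)
      linarith [norm_nonneg (a 1), norm_nonneg (a 2), norm_nonneg (a 3)]
    · refine le_trans ?_ (hKR _)
      simp only [zero_add]
      linarith [norm_nonneg (a 0), norm_nonneg (a 2), norm_nonneg (a 3)]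
    · refine le_trans ?_ (hKR _)
      simp only [zero_add, Nat.reduceAdd]
      linarith [norm_nonneg (a 0), norm_nonneg (a 1), norm_nonneg (a 3)]
    · refine le_trans ?_ (hKR _)
      simp only [zero_add, Nat.reduceAdd]
      linarith [norm_nonneg (a 0), norm_nonneg (a 1), norm_nonneg (a 2)]
    · have h3 := ih (n + 3) (by omega)
      have h2 := ih (n + 2) (by omega)
      have h2' : K * R ^ (n + 2) ≤ K * R ^ (n + 3) := by
        gcongr
        omega
      have e : n + 1 + 1 + 1 + 1 = n + 4 := rfl
      rw [e, h]
      calc ‖B n * a (n + 3) + C n * a (n + 2)‖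
          ≤ ‖B n‖ * ‖a (n + 3)‖ + ‖C n‖ * ‖a (n + 2)‖ := by
            refine (norm_add_le _ _).trans ?_
            rw [norm_mul, norm_mul]
        _ ≤ M * (K * R ^ (n + 3)) + M * (K * R ^ (n + 3)) := by
            gcongr
            · exact hB n
            · exact hC n
            · exact h2.trans h2'
        _ ≤ K * R ^ (n + 4) := by
            have : 0 ≤ K * R ^ (n + 3) := by positivity
            rw [pow_succ R (n + 3), ← mul_assoc, hR]
            nlinarith

theorem norm_quadratic_le (A B C : ℂ) (n : ℕ) :
    ‖A * (n * (n + 1)) + B * n + C‖ ≤ (‖A‖ + ‖B‖ + ‖C‖) * (n + 1) ^ 2 := by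
  have hn : (0 : ℝ) ≤ n := n.cast_nonneg
  calc ‖A * (n * (n + 1)) + B * n + C‖ ≤ ‖A‖ * (n * (n + 1)) + ‖B‖ * n + ‖C‖ := by
        refine (norm_add_le _ _).trans (add_le_add ((norm_add_le _ _).trans (add_le_add ?_ ?_))
          le_rfl)
        · have : ((n : ℂ) + 1) = ((n + 1 : ℕ) : ℂ) := by push_cast; ring
          rw [norm_mul, norm_mul, this, Complex.norm_natCast, Complex.norm_natCast]
          push_cast
          rfl
        · rw [norm_mul, Complex.norm_natCast]
    _ ≤ _ := by
        nlinarith [mul_nonneg (norm_nonneg A) hn, mul_nonneg (norm_nonneg B) hn,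
          mul_nonneg (norm_nonneg C) hn, mul_nonneg (mul_nonneg (norm_nonneg B) hn) hn,
          mul_nonneg (mul_nonneg (norm_nonneg C) hn) hn, norm_nonneg A, norm_nonneg B, norm_nonneg C]

theorem exists_bounded_coeff (A B C : ℂ) {T : ℂ} (hT : T ≠ 0) :
    ∃ M : ℝ, ∀ n : ℕ, ‖(A * (n * (n + 1)) + B * n + C) / (T * (n + 4) * (n + 1))‖ ≤ M := by
  refine ⟨(‖A‖ + ‖B‖ + ‖C‖) / ‖T‖, fun n => ?_⟩
  have hn : (0 : ℝ) ≤ n := n.cast_nonneg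
  have e4 : ((n : ℂ) + 4) = ((n + 4 : ℕ) : ℂ) := by push_cast; ring
  have e1 : ((n : ℂ) + 1) = ((n + 1 : ℕ) : ℂ) := by push_cast; ring
  have hden : ‖T * (n + 4) * (n + 1)‖ = ‖T‖ * (n + 4) * (n + 1) := by
    rw [norm_mul, norm_mul, e4, e1, Complex.norm_natCast, Complex.norm_natCast]
    push_cast
    rfl
  have hT' : 0 < ‖T‖ := norm_pos_iff.2 hT
  rw [norm_div, hden, div_le_div_iff₀ (by positivity) hT']
  have h1 := norm_quadratic_le A B C n
  have h2 : (0 : ℝ) ≤ (‖A‖ + ‖B‖ + ‖C‖) := by positivity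
  calc _ ≤ (‖A‖ + ‖B‖ + ‖C‖) * (n + 1) ^ 2 * ‖T‖ := by gcongr
    _ ≤ _ := by
      rw [mul_assoc]
      refine mul_le_mul_of_nonneg_left ?_ h2
      nlinarith [mul_nonneg hT'.le hn, mul_nonneg (mul_nonneg hT'.le hn) hn]

/-- The recurrence at an apparent singularity is solvable with prescribed free coefficients. -/
theorem exists_bounded_solution (s k₂ k₁ m₁ m₀ : ℂ) {T : ℂ} (hT : T ≠ 0) (c₀ c₁ c₂ c₃ : ℂ)
    (h0 : -2 * T * c₁ + m₀ * c₀ = 0) (h1 : -2 * T * c₂ + (k₁ + m₀) * c₁ + m₁ * c₀ = 0)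
    (h2 : (2 * s + 2 * k₁ + m₀) * c₂ + (k₂ + m₁) * c₁ = 0) :
    ∃ a : ℕ → ℂ, a 0 = c₀ ∧ a 1 = c₁ ∧ a 2 = c₂ ∧ a 3 = c₃ ∧
      (∃ K R : ℝ, 0 < R ∧ ∀ n, ‖a n‖ ≤ K * R ^ n) ∧
      ∀ n, odeCoeff s T k₂ k₁ (-2 * T) m₁ m₀ a n = 0 := by
  -- From row `n + 3` on, the leading factor is `(n+4)(T(n+3) - 2T) = T(n+4)(n+1)`, which never
  -- vanishes; dividing by it gives quotients of quadratics in `n`, hence bounded ones.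
  obtain ⟨M₁, hM₁⟩ := exists_bounded_coeff (-s) (-(4 * s + k₁)) (-(6 * s + 3 * k₁ + m₀)) hT
  obtain ⟨M₂, hM₂⟩ := exists_bounded_coeff (-1) (-(2 + k₂)) (-(2 + 2 * k₂ + m₁)) hT
  obtain ⟨a, ha0, ha1, ha2, ha3, ha⟩ := exists_seq_of_recurrence c₀ c₁ c₂ c₃
    (fun n => ((-s) * (n * (n + 1)) + (-(4 * s + k₁)) * n + (-(6 * s + 3 * k₁ + m₀))) /
      (T * (n + 4) * (n + 1)))
    (fun n => ((-1) * (n * (n + 1)) + (-(2 + k₂)) * n + (-(2 + 2 * k₂ + m₁))) /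
      (T * (n + 4) * (n + 1)))
  refine ⟨a, ha0, ha1, ha2, ha3, exists_bound_of_recurrence (M := max M₁ M₂) ha
    (fun n => (hM₁ n).trans (le_max_left _ _)) (fun n => (hM₂ n).trans (le_max_right _ _)), ?_⟩
  intro n
  rcases n with _ | _ | _ | n
  · simp [odeCoeff, ha0, ha1]; linear_combination h0
  · simp [odeCoeff, ha0, ha1, ha2]; linear_combination h1
  · simp [odeCoeff, ha1, ha2]; linear_combination h2
  · have e4 : ((n : ℂ) + 4) ≠ 0 := by exact_mod_cast (by omega : n + 4 ≠ 0)
    have e1 : ((n : ℂ) + 1) ≠ 0 := by exact_mod_cast (by omega : n + 1 ≠ 0)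
    have := ha n
    simp only [odeCoeff, shiftSeq_succ]
    rw [show n + 1 + 1 + 1 + 1 = n + 4 from rfl, show n + 1 + 1 + 1 = n + 3 from rfl,
      show n + 1 + 1 = n + 2 from rfl, this]
    push_cast
    field_simp
    ring

theorem isHeunSolution_comp_sub {ε : ℂ} {f : ℂ → ℂ} {r : ℝ}
    (h0 : (0 : ℂ) ∉ Metric.ball t r) (h1 : (1 : ℂ) ∉ Metric.ball t r)
    (hf : DifferentiableOn ℂ f (Metric.ball 0 r))
    (h : ∀ x ∈ Metric.ball (0 : ℂ) r, odeOp (2 * t - 1) (t * (t - 1)) (γ + δ + ε)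
      (γ * (t - 1) + δ * t + ε * (2 * t - 1)) (ε * t * (t - 1)) (α * β) (α * β * t - q) f x = 0) :
    IsHeunSolution α β γ δ ε q t (Metric.ball t r ∩ {z | z - t ∈ Complex.slitPlane})
      (fun z => f (z - t)) := by
  rw [isHeunSolution_iff (fun h => h0 h.1) (fun h => h1 h.1) (by simp)]
  have hmaps : MapsTo (fun z => z - t) (Metric.ball t r) (Metric.ball 0 r) := fun z hz => by
    simpa [dist_eq_norm] using hz
  refine ⟨(hf.comp (by fun_prop) hmaps).mono inter_subset_left, fun z hz => ?_⟩
  have := heunOp_const_add α β γ δ ε q t (fun z => f (z - t)) (z - t)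
  simp only [add_sub_cancel, add_sub_cancel_left] at this
  rw [this]
  exact h _ (hmaps hz.1)

theorem isApparent_of_apparentCubic_eq_zero (ht0 : t ≠ 0) (ht1 : t ≠ 1)
    (hδ : γ + δ + (-2) = α + β + 1) (h : apparentCubic α β γ q t = 0) :
    IsApparent α β γ δ 2 q t := by
  have hT : t * (t - 1) ≠ 0 := mul_ne_zero ht0 (sub_ne_zero.2 ht1)
  -- Rows 0 and 1 dictate `a 1` and `a 2` once `a 0 = 1`; row 2 is then the cubic condition. The
  -- free coefficient `a 3` is set to 0.
  obtain ⟨a, ha0, -, -, -, ⟨K, R, hR, hKR⟩, ha⟩ := exists_bounded_solution (2 * t - 1)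
    (γ + δ + (-2)) (γ * (t - 1) + δ * t + (-2) * (2 * t - 1)) (α * β) (α * β * t - q) hT 1
    ((α * β * t - q) / (2 * (t * (t - 1))))
    ((((γ * (t - 1) + δ * t + (-2) * (2 * t - 1)) + (α * β * t - q)) *
      ((α * β * t - q) / (2 * (t * (t - 1)))) + α * β) / (2 * (t * (t - 1)))) 0
    (by field_simp; ring) (by field_simp; ring) (by
      obtain rfl : δ = α + β + 3 - γ := by linear_combination hδ
      unfold apparentCubic at h
      field_simp
      linear_combination -h)
  -- The solution of exponent 3: the first three coefficients vanish, so the first three rows hold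
  -- trivially.
  obtain ⟨d, hd0, hd1, hd2, hd3, ⟨K', R', hR', hKR'⟩, hd⟩ := exists_bounded_solution (2 * t - 1)
    (γ + δ + (-2)) (γ * (t - 1) + δ * t + (-2) * (2 * t - 1)) (α * β) (α * β * t - q) hT 0 0 0 1
    (by ring) (by ring) (by ring)
  obtain ⟨f, hf⟩ := exists_hasTaylor_of_le hR hKR
  obtain ⟨g, hg⟩ := exists_hasTaylor_of_le (a := fun n => d (n + 3)) (C := K' * R' ^ 3) hR'
    (fun n => (hKR' (n + 3)).trans_eq (by ring))
  have hg3 : HasTaylor (fun x => x ^ 3 * g x) d := by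
    have := hg.id_mul.id_mul.id_mul
    convert this using 1
    · ext x; ring
    · ext n
      rcases n with _ | _ | _ | n <;> simp [*]
  have e : (-2 : ℂ) * t * (t - 1) = -2 * (t * (t - 1)) := by ring
  have hfo := (hf.odeOp_eventually_eq_zero_iff _ _ _ _ _ _ _).2 ha
  have hgo := (hg3.odeOp_eventually_eq_zero_iff _ _ _ _ _ _ _).2 hd
  have hev : ∀ᶠ x in 𝓝 (0 : ℂ), t + x ≠ 0 ∧ t + x ≠ 1 := by
    have hc : Tendsto (fun x : ℂ => t + x) (𝓝 0) (𝓝 t) := by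
      have : Continuous fun x : ℂ => t + x := by fun_prop
      exact this.tendsto' 0 t (by simp)
    exact (hc.eventually_ne ht0).and (hc.eventually_ne ht1)
  obtain ⟨r, hr, hball⟩ := Metric.eventually_nhds_iff_ball.1
    (((hf.1.eventually_analyticAt.and hg.1.eventually_analyticAt).and (hfo.and hgo)).and hev)
  have hnot : ∀ w : ℂ, (∀ x ∈ Metric.ball (0 : ℂ) r, t + x ≠ w) → w ∉ Metric.ball t r :=
    fun w hw h => hw (w - t) (by simpa [dist_eq_norm] using h) (by ring)
  have hz0 : (0 : ℂ) ∉ Metric.ball t r := hnot 0 fun x hx => (hball x hx).2.1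
  have hz1 : (1 : ℂ) ∉ Metric.ball t r := hnot 1 fun x hx => (hball x hx).2.2
  have hfd : DifferentiableOn ℂ f (Metric.ball 0 r) := fun x hx =>
    (hball x hx).1.1.1.differentiableAt.differentiableWithinAt
  have hgd : DifferentiableOn ℂ g (Metric.ball 0 r) := fun x hx =>
    (hball x hx).1.1.2.differentiableAt.differentiableWithinAt
  have hmaps : MapsTo (fun z => z - t) (Metric.ball t r) (Metric.ball 0 r) := fun z hz => by
    simpa [dist_eq_norm] using hz
  refine ⟨r, hr, fun z => f (z - t), fun z => g (z - t), hfd.comp (by fun_prop) hmaps,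
    hgd.comp (by fun_prop) hmaps, ?_, ?_, ?_, ?_⟩
  · have := hf.2 0
    simp [ha0] at this
    simp [this]
  · have := hg.2 0
    simp [hd3] at this
    simp [this]
  · have := isHeunSolution_comp_sub (α := α) (β := β) (γ := γ) (δ := δ) (q := q) (ε := -2)
      hz0 hz1 hfd (fun x hx => by rw [e]; exact (hball x hx).1.2.1)
    simpa using this
  · have := isHeunSolution_comp_sub (α := α) (β := β) (γ := γ) (δ := δ) (q := q) (ε := -2)
      (f := fun x => x ^ 3 * g x) hz0 hz1 ((by fun_prop : DifferentiableOn ℂ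
      (fun x : ℂ => x ^ 3) _).mul hgd) (fun x hx => by rw [e]; exact (hball x hx).1.2.2)
    simpa using this

end Apparent


/-! ### Differentiating a continuous logarithm -/

section LogBranch

/-- Near `x` the difference `l y - l x` has imaginary part in `(-π, π)`, so it is the principal
logarithm of its exponential. Continuity of a branch thus already gives differentiability, over `ℝ`
along curves and over `ℂ` in the plane. -/
theorem eventuallyEq_log_of_exp_eq {X : Type*} {f l : X → ℂ} {x : X}
    {F : Filter X} (hl : Tendsto l F (𝓝 (l x))) (hx : Complex.exp (l x) = f x)
    (h : ∀ᶠ y in F, Complex.exp (l y) = f y) :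
    l =ᶠ[F] fun y => l x + Complex.log (f y / f x) := by
  have hd : Tendsto (fun y => l y - l x) F (𝓝 0) := by
    simpa using hl.sub_const (l x)
  have him : ∀ᶠ y in F, (l y - l x).im ∈ Ioo (-Real.pi) Real.pi := by
    have : Tendsto (fun y => (l y - l x).im) F (𝓝 0) := by
      simpa [Function.comp_def] using (Complex.continuous_im.tendsto 0).comp hd
    exact this.eventually (Ioo_mem_nhds (by simp [Real.pi_pos]) Real.pi_pos)
  filter_upwards [h, him] with y hy hi
  rw [← hy, ← hx, ← Complex.exp_sub, Complex.log_exp hi.1 hi.2.le]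
  ring

theorem hasDerivAt_log_div {𝕜 : Type*} [NontriviallyNormedField 𝕜] [NormedAlgebra 𝕜 ℂ]
    {f : 𝕜 → ℂ} {x : 𝕜} {f' : ℂ} (hx : f x ≠ 0) (hf : HasDerivAt f f' x) :
    HasDerivAt (fun y => Complex.log (f y / f x)) (f' / f x) x := by
  have h1 : HasDerivAt (fun y => f y / f x) (f' / f x) x := hf.div_const _
  have h2 : HasFDerivAt Complex.log _ (f x / f x) :=
    (Complex.hasDerivAt_log (by simp [hx] : f x / f x ∈ Complex.slitPlane)).hasFDerivAt.restrictScalars 𝕜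
  have h3 := h2.comp_hasDerivAt x h1
  simpa [div_self hx, Function.comp_def] using h3

theorem hasDerivAt_of_exp_eq {𝕜 : Type*} [NontriviallyNormedField 𝕜] [NormedAlgebra 𝕜 ℂ]
    {f l : 𝕜 → ℂ} {x : 𝕜} {f' : ℂ} (hl : ContinuousAt l x)
    (h : ∀ᶠ y in 𝓝 x, Complex.exp (l y) = f y) (hf : HasDerivAt f f' x) :
    HasDerivAt l (f' / f x) x := by
  have hx := h.self_of_nhds
  have h0 : f x ≠ 0 := hx ▸ Complex.exp_ne_zero _
  exact ((hasDerivAt_log_div h0 hf).const_add (l x)).congr_of_eventuallyEq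
    (eventuallyEq_log_of_exp_eq hl hx h)

theorem IsLogBranch.hasDerivAt {U : Set ℂ} {f l : ℂ → ℂ} (h : IsLogBranch U f l) {x f' : ℂ}
    (hU : U ∈ 𝓝 x) (hf : HasDerivAt f f' x) : HasDerivAt l (f' / f x) x :=
  hasDerivAt_of_exp_eq (h.1.continuousAt hU) (by filter_upwards [hU] with y hy using h.2 y hy) hf

end LogBranch

/-! ### The polynomial factor of the transformed equation -/

/-- The differential equation for the polynomial factor of the solutions of the transformed
equation. -/
def IsKernelPoly (α β γ δ q t : ℂ) (h : Polynomial ℂ) : Prop :=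
  ∀ w : ℂ, w * (w - 1) * (w - t) * h.derivative.derivative.eval w
    + ((β - γ + 1) * (w - 1) * (w - t) + (β - δ + 1) * w * (w - t) - (β + 1) * w * (w - 1))
      * h.derivative.eval w
    + (β * (β + 1) * (3 * w - (1 + t)) - β * (2 * (γ + δ - 2) * w - (γ * (1 + t) + δ * t - 2))
      + α * β * w - q - (β + 2) * ((β - γ + 1) * (w - 1) + (β - δ + 1) * w)) * h.eval w = 0

theorem eval_quadratic (a b c w : ℂ) :
    (Polynomial.C a * Polynomial.X ^ 2 + Polynomial.C b * Polynomial.X + Polynomial.C c).eval w =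
      a * w ^ 2 + b * w + c ∧
    (Polynomial.C a * Polynomial.X ^ 2 + Polynomial.C b * Polynomial.X
      + Polynomial.C c).derivative.eval w = 2 * a * w + b ∧
    (Polynomial.C a * Polynomial.X ^ 2 + Polynomial.C b * Polynomial.X
      + Polynomial.C c).derivative.derivative.eval w = 2 * a := by
  refine ⟨by simp, ?_, ?_⟩
  · simp; ring
  · simp; ring

variable {α β γ δ q t : ℂ}

/-- The coefficients of `hPoly` come from back substitution starting with the leading one, so all
powers of `w` cancel identically and the operator leaves only the constant `-apparentCubic`. -/
theorem isKernelPoly_hPoly (hδ : γ + δ + (-2) = α + β + 1) (h : apparentCubic α β γ q t = 0) :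
    IsKernelPoly α β γ δ q t (hPoly α β γ q t) := by
  intro w
  obtain rfl : δ = α + β + 3 - γ := by linear_combination hδ
  unfold apparentCubic at h
  obtain ⟨e0, e1, e2⟩ := eval_quadratic (2 * α * (α + 1)) (2 * (α + 1) * (q - α * (β + 2) * t))
    (q ^ 2 - ((2 * α * β + 3 * α + β + 1) * t - γ + 2) * q
      + α * t * (t * (α + 1) * (β + 1) * (β + 2) - β * γ)) w
  rw [hPoly, e0, e1, e2]
  linear_combination -h

/-- The operator sends `w^n` into degree at most `n + 1` with top coefficient `(2-n)(α+1-n)`, which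
vanishes at `n = 2`; it therefore preserves degree at most 2. The determinant of its matrix is
`-apparentCubic`, so a kernel vector exists even where `hPoly` degenerates to zero. -/
theorem exists_isKernelPoly (hδ : γ + δ + (-2) = α + β + 1) (h : apparentCubic α β γ q t = 0) :
    ∃ h₀ : Polynomial ℂ, h₀ ≠ 0 ∧ h₀.natDegree ≤ 2 ∧ IsKernelPoly α β γ δ q t h₀ := by
  obtain rfl : δ = α + β + 3 - γ := by linear_combination hδ
  let e₀ := -(β * (β + 1) * (1 + t)) + β * (γ * (1 + t) + (α + β + 3 - γ) * t - 2) - q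
    + (β + 2) * (β - γ + 1)
  let k₀ := (β - γ + 1) * t
  let k₁ := -(β - γ + 1) * (1 + t) - (β - (α + β + 3 - γ) + 1) * t + (β + 1)
  let M : Matrix (Fin 3) (Fin 3) ℂ := !![e₀, k₀, 0; 2 * (α + 1), k₁ + e₀, 2 * t + 2 * k₀;
    0, α, -2 * (1 + t) + 2 * k₁ + e₀]
  have hdet : M.det = 0 := by
    unfold apparentCubic at h
    simp only [M, e₀, k₀, k₁, Matrix.det_fin_three, Matrix.of_apply, Matrix.cons_val', Matrix.cons_val_zero,
      Matrix.cons_val_one, Matrix.cons_val, Matrix.cons_val_fin_one]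
    linear_combination -h
  obtain ⟨v, hv0, hv⟩ := Matrix.exists_mulVec_eq_zero_iff.2 hdet
  have r0 := congrFun hv 0
  have r1 := congrFun hv 1
  have r2 := congrFun hv 2
  simp [M, Matrix.mulVec, dotProduct, Fin.sum_univ_three] at r0 r1 r2
  refine ⟨Polynomial.C (v 2) * Polynomial.X ^ 2 + Polynomial.C (v 1) * Polynomial.X
    + Polynomial.C (v 0), ?_, Polynomial.natDegree_quadratic_le, ?_⟩
  · intro hp
    apply hv0
    have c0 := congrArg (Polynomial.coeff · 0) hp
    have c1 := congrArg (Polynomial.coeff · 1) hp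
    have c2 := congrArg (Polynomial.coeff · 2) hp
    simp [Polynomial.coeff_X, Polynomial.coeff_C] at c0 c1 c2
    ext i
    fin_cases i <;> simp [c0, c1, c2]
  · intro w
    obtain ⟨e0, e1, e2⟩ := eval_quadratic (v 2) (v 1) (v 0) w
    rw [e0, e1, e2]
    simp only [e₀, k₀, k₁] at r0 r1 r2
    linear_combination r0 + w * r1 + w ^ 2 * r2

theorem hPoly_eq_zero_iff : hPoly α β γ q t = 0 ↔ (α = 0 ∧ q = 0) ∨
    (α = -1 ∧ q ^ 2 + ((β + 2) * t + γ - 2) * q + β * γ * t = 0) := by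
  constructor
  · intro hp
    have c0 := congrArg (Polynomial.coeff · 0) hp
    have c1 := congrArg (Polynomial.coeff · 1) hp
    have c2 := congrArg (Polynomial.coeff · 2) hp
    simp only [hPoly, Polynomial.coeff_add, Polynomial.coeff_C_mul, Polynomial.coeff_X_pow, Polynomial.coeff_X,
      Polynomial.coeff_C, Polynomial.coeff_zero] at c0 c1 c2
    norm_num at c0 c1 c2
    rcases c2 with h | h
    · subst h
      simp at c1
      exact Or.inl ⟨rfl, c1⟩
    · obtain rfl : α = -1 := by linear_combination h
      exact Or.inr ⟨rfl, by linear_combination c0⟩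
  · rintro (⟨rfl, rfl⟩ | ⟨rfl, h⟩)
    · simp [hPoly]
    · have : q ^ 2 - ((2 * (-1) * β + 3 * (-1) + β + 1) * t - γ + 2) * q
        + (-1) * t * (t * (-1 + 1) * (β + 1) * (β + 2) - β * γ) = 0 := by linear_combination h
      simp only [hPoly, this]
      simp

theorem IsKernelPoly.solvesTransformed (hδ : γ + δ + (-2) = α + β + 1) {h : Polynomial ℂ}
    (hh : IsKernelPoly α β γ δ q t h) : SolvesTransformed α β γ δ q t h := by
  intro U l₀ l₁ hU h0 h1 ht hl₀ hl₁
  rw [isHeunSolution_iff h0 h1 ht]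
  set E : ℂ → ℂ := fun w => Complex.exp ((β - γ) * l₀ w + (β - δ) * l₁ w) with hE
  have hE' : ∀ w ∈ U, HasDerivAt E (E w * ((β - γ) / w + (β - δ) / (w - 1))) w := fun w hw => by
    have e0 := hl₀.hasDerivAt (hU.mem_nhds hw) (hasDerivAt_id' w)
    have e1 := hl₁.hasDerivAt (hU.mem_nhds hw) ((hasDerivAt_id' w).sub_const 1)
    have := ((e0.const_mul (β - γ)).add (e1.const_mul (β - δ))).cexp
    refine this.congr_deriv ?_
    simp only [hE, Pi.add_apply]
    ring
  have hv : ∀ w ∈ U, HasDerivAt (fun w => E w * h.eval w)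
      (E w * (((β - γ) / w + (β - δ) / (w - 1)) * h.eval w + h.derivative.eval w)) w := fun w hw => by
    refine ((hE' w hw).fun_mul (h.hasDerivAt w)).congr_deriv ?_
    ring
  have hv2 : ∀ w ∈ U, HasDerivAt (deriv fun w => E w * h.eval w)
      (E w * ((((β - γ) / w + (β - δ) / (w - 1)) ^ 2 - (β - γ) / w ^ 2 - (β - δ) / (w - 1) ^ 2)
        * h.eval w + 2 * ((β - γ) / w + (β - δ) / (w - 1)) * h.derivative.eval w
        + h.derivative.derivative.eval w)) w := fun w hw => by
    have hw0 : w ≠ 0 := fun e => h0 (e ▸ hw)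
    have hw1 : w - 1 ≠ 0 := sub_ne_zero.2 fun e => h1 (e ▸ hw)
    have d0 := (hasDerivAt_const w (β - γ)).fun_div (hasDerivAt_id' w) hw0
    have d1 := (hasDerivAt_const w (β - δ)).fun_div ((hasDerivAt_id' w).sub_const 1) hw1
    have := (hE' w hw).fun_mul (((d0.fun_add d1).fun_mul (h.hasDerivAt w)).fun_add
      (h.derivative.hasDerivAt w))
    refine (this.congr_of_eventuallyEq ?_).congr_deriv ?_
    · filter_upwards [hU.mem_nhds hw] with x hx using (hv x hx).deriv
    · field_simp
      ring
  refine ⟨fun w hw => (hv w hw).differentiableAt.differentiableWithinAt, fun w hw => ?_⟩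
  have hw0 : w ≠ 0 := fun e => h0 (e ▸ hw)
  have hw1 : w - 1 ≠ 0 := sub_ne_zero.2 fun e => h1 (e ▸ hw)
  rw [heunOp, (hv2 w hw).deriv, (hv w hw).deriv]
  -- After the weight and its derivatives are factored out, Heun's operator is the kernel equation
  -- times the weight.
  have key := hh w
  obtain rfl : δ = α + β + 3 - γ := by linear_combination hδ
  field_simp
  linear_combination (E w * w * (w - 1)) * key


/-! ### Increments of logarithms along paths -/

section Increments

/-- Every continuous logarithm of `f` on the unit interval has increment `d`. -/
def HasLogIncr (f : ℝ → ℂ) (d : ℂ) : Prop :=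
  ∀ l, IsLogBranch (Icc (0 : ℝ) 1) f l → l 1 - l 0 = d

/-- Two logarithms of the same function differ by a continuous function with values in the discrete
set `2πiℤ`, hence by a constant. -/
theorem sub_eq_sub_of_exp_eq {l l' : ℝ → ℂ} (hl : ContinuousOn l (Icc 0 1))
    (hl' : ContinuousOn l' (Icc 0 1))
    (h : ∀ s ∈ Icc (0 : ℝ) 1, Complex.exp (l s) = Complex.exp (l' s)) :
    l 1 - l 0 = l' 1 - l' 0 := by
  have hT : IsDiscrete (range ((↑) : ℤ → ℝ)) :=
    Int.isClosedEmbedding_coe_real.isEmbedding.isDiscrete_range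
  have hint : ∀ s ∈ Icc (0 : ℝ) 1, ∃ n : ℤ, l s - l' s = n * (2 * Real.pi * Complex.I) := by
    intro s hs
    obtain ⟨n, hn⟩ := Complex.exp_eq_exp_iff_exists_int.1 (h s hs)
    exact ⟨n, by rw [hn]; ring⟩
  have hc : ContinuousOn (fun s => (l s - l' s).im / (2 * Real.pi)) (Icc 0 1) :=
    (Complex.continuous_im.comp_continuousOn (hl.sub hl')).div_const _
  have key := isPreconnected_Icc.constant_of_mapsTo hT hc (fun s hs => by
    obtain ⟨n, hn⟩ := hint s hs
    refine ⟨n, ?_⟩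
    beta_reduce
    rw [hn]
    have := Real.pi_pos
    simp) (right_mem_Icc.2 zero_le_one) (left_mem_Icc.2 zero_le_one)
  obtain ⟨n, hn⟩ := hint 1 (right_mem_Icc.2 zero_le_one)
  obtain ⟨m, hm⟩ := hint 0 (left_mem_Icc.2 zero_le_one)
  have hpi := Real.pi_pos.ne'
  have hnm : (n : ℝ) = m := by
    simp only [hn, hm] at key
    simpa [hpi] using key
  have : (n : ℂ) = m := by exact_mod_cast hnm
  linear_combination hn - hm + (2 * Real.pi * Complex.I) * this

theorem IsLogBranch.hasLogIncr {f l : ℝ → ℂ} (h : IsLogBranch (Icc (0 : ℝ) 1) f l) :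
    HasLogIncr f (l 1 - l 0) := fun _ h' =>
  sub_eq_sub_of_exp_eq h'.1 h.1 fun s hs => (h'.2 s hs).trans (h.2 s hs).symm

variable {x y z : ℂ} {m : ℂ → ℂ}

theorem IsLogBranch.left {γ : Path x y} {γ' : Path y z} {l : ℝ → ℂ}
    (h : IsLogBranch (Icc (0 : ℝ) 1) (fun s => m ((γ.trans γ').extend s)) l) :
    IsLogBranch (Icc (0 : ℝ) 1) (fun s => m (γ.extend s)) (fun s => l (s / 2)) := by
  have hmaps : MapsTo (fun s : ℝ => s / 2) (Icc 0 1) (Icc 0 1) := fun s hs =>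
    ⟨by linarith [hs.1], by linarith [hs.2]⟩
  refine ⟨h.1.comp (by fun_prop) hmaps, fun s hs => ?_⟩
  rw [h.2 _ (hmaps hs)]
  beta_reduce
  rw [Path.extend_trans_of_le_half _ _ (by linarith [hs.2])]
  congr 2
  ring

theorem IsLogBranch.right {γ : Path x y} {γ' : Path y z} {l : ℝ → ℂ}
    (h : IsLogBranch (Icc (0 : ℝ) 1) (fun s => m ((γ.trans γ').extend s)) l) :
    IsLogBranch (Icc (0 : ℝ) 1) (fun s => m (γ'.extend s)) (fun s => l ((s + 1) / 2)) := by
  have hmaps : MapsTo (fun s : ℝ => (s + 1) / 2) (Icc 0 1) (Icc 0 1) := fun s hs =>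
    ⟨by linarith [hs.1], by linarith [hs.2]⟩
  refine ⟨h.1.comp (by fun_prop) hmaps, fun s hs => ?_⟩
  rw [h.2 _ (hmaps hs)]
  beta_reduce
  rw [Path.extend_trans_of_half_le _ _ (by linarith [hs.1])]
  congr 2
  ring

theorem HasLogIncr.half_sub_zero {γ : Path x y} {γ' : Path y z} {l : ℝ → ℂ} {d : ℂ}
    (hd : HasLogIncr (fun s => m (γ.extend s)) d)
    (h : IsLogBranch (Icc (0 : ℝ) 1) (fun s => m ((γ.trans γ').extend s)) l) :
    l (1 / 2) - l 0 = d := by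
  simpa using hd _ h.left

theorem HasLogIncr.one_sub_half {γ : Path x y} {γ' : Path y z} {l : ℝ → ℂ} {d : ℂ}
    (hd : HasLogIncr (fun s => m (γ'.extend s)) d)
    (h : IsLogBranch (Icc (0 : ℝ) 1) (fun s => m ((γ.trans γ').extend s)) l) :
    l 1 - l (1 / 2) = d := by
  have := hd _ h.right
  norm_num at this
  norm_num [this]

theorem HasLogIncr.trans {γ : Path x y} {γ' : Path y z} {d d' : ℂ}
    (hd : HasLogIncr (fun s => m (γ.extend s)) d) (hd' : HasLogIncr (fun s => m (γ'.extend s)) d') :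
    HasLogIncr (fun s => m ((γ.trans γ').extend s)) (d + d') := fun l h => by
  linear_combination hd.half_sub_zero h + hd'.one_sub_half h

theorem IsLogBranch.comp_symm {γ : Path x y} {l : ℝ → ℂ}
    (h : IsLogBranch (Icc (0 : ℝ) 1) (fun s => m (γ.symm.extend s)) l) :
    IsLogBranch (Icc (0 : ℝ) 1) (fun s => m (γ.extend s)) (fun s => l (1 - s)) := by
  have hmaps : MapsTo (fun s : ℝ => 1 - s) (Icc 0 1) (Icc 0 1) := fun s hs =>
    ⟨by linarith [hs.2], by linarith [hs.1]⟩
  refine ⟨h.1.comp (by fun_prop) hmaps, fun s hs => ?_⟩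
  rw [h.2 _ (hmaps hs)]
  beta_reduce
  rw [Path.extend_symm_apply]
  congr 2
  ring

theorem HasLogIncr.symm {γ : Path x y} {d : ℂ}
    (hd : HasLogIncr (fun s => m (γ.extend s)) d) :
    HasLogIncr (fun s => m (γ.symm.extend s)) (-d) := fun l h => by
  have := hd _ h.comp_symm
  simp only [sub_self, sub_zero] at this
  linear_combination -this

/-- The nested concatenation runs `A` on `[0, 1/8]`, `B` on `[1/8, 1/4]`, `A⁻¹` on `[1/4, 1/2]` and
`B⁻¹` on `[1/2, 1]`, whence the four parameter values. -/
theorem commutator_values {o : ℂ} {A B : Path o o} {l : ℝ → ℂ} {dA dB : ℂ}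
    (hA : HasLogIncr (fun s => m (A.extend s)) dA) (hB : HasLogIncr (fun s => m (B.extend s)) dB)
    (h : IsLogBranch (Icc (0 : ℝ) 1) (fun s => m ((commutatorLoop A B).extend s)) l) :
    l (1 / 8) = l 0 + dA ∧ l (1 / 4) = l 0 + dA + dB ∧ l (1 / 2) = l 0 + dB ∧ l 1 = l 0 := by
  unfold commutatorLoop at h
  have h1 := hB.symm.one_sub_half h
  have h2 := hA.symm.one_sub_half h.left
  have h3 := hB.one_sub_half h.left.left
  have h4 := hA.half_sub_zero h.left.left
  norm_num at h1 h2 h3 h4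
  refine ⟨by linear_combination h4, by linear_combination h3 + h4,
    by linear_combination h2 + h3 + h4, by linear_combination h1 + h2 + h3 + h4⟩

/-- The increments over `A` and `B` are read off from the given branch itself and cancel: every
branch returns to its initial value on a commutator. -/
theorem commutator_closed {o : ℂ} {A B : Path o o} {l : ℝ → ℂ}
    (h : IsLogBranch (Icc (0 : ℝ) 1) (fun s => m ((commutatorLoop A B).extend s)) l) : l 1 = l 0 :=
  (commutator_values (IsLogBranch.left (IsLogBranch.left (IsLogBranch.left h))).hasLogIncr
    (IsLogBranch.right (IsLogBranch.left (IsLogBranch.left h))).hasLogIncr h).2.2.2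

end Increments

/-! ### Piecewise smooth paths -/

section GoodPath

/-- The path is differentiable off a countable set, with bounded derivative. -/
def GoodPath {x y : ℂ} (γ : Path x y) : Prop :=
  ∃ S : Set ℝ, S.Countable ∧ (∀ s ∉ S, DifferentiableAt ℝ γ.extend s) ∧
    ∃ C, ∀ s, ‖deriv γ.extend s‖ ≤ C

variable {x y z : ℂ}

theorem GoodPath.symm {γ : Path x y} (h : GoodPath γ) : GoodPath γ.symm := by
  obtain ⟨S, hS, hd, C, hC⟩ := h
  refine ⟨(fun s => 1 - s) ⁻¹' S, hS.preimage (fun a b h => by simpa using h), fun s hs => ?_,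
    C, fun s => ?_⟩
  · rw [Path.extend_symm]
    exact (hd _ hs).comp s (by fun_prop)
  · rw [Path.extend_symm, deriv_comp_const_sub, norm_neg]
    exact hC _

theorem GoodPath.trans {γ : Path x y} {γ' : Path y z} (h : GoodPath γ) (h' : GoodPath γ') :
    GoodPath (γ.trans γ') := by
  obtain ⟨S, hS, hd, C, hC⟩ := h
  obtain ⟨S', hS', hd', C', hC'⟩ := h'
  have e1 : ∀ s < (1 / 2 : ℝ), (γ.trans γ').extend =ᶠ[𝓝 s] fun s => γ.extend (2 * s) := fun s hs => by
    filter_upwards [Iio_mem_nhds hs] with u hu using Path.extend_trans_of_le_half _ _ (le_of_lt hu)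
  have e2 : ∀ s > (1 / 2 : ℝ), (γ.trans γ').extend =ᶠ[𝓝 s] fun s => γ'.extend (2 * s - 1) :=
    fun s hs => by
    filter_upwards [Ioi_mem_nhds hs] with u hu using Path.extend_trans_of_half_le _ _ (le_of_lt hu)
  -- The concatenation may have a corner at `1/2`; whatever value `deriv` takes there is simply
  -- included in the bound.
  refine ⟨{1 / 2} ∪ ((fun s => 2 * s) ⁻¹' S ∪ (fun s => 2 * s - 1) ⁻¹' S'),
    (countable_singleton _).union ((hS.preimage (fun a b h => by simpa using h)).union
      (hS'.preimage (fun a b h => by simpa using h))), fun s hs => ?_,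
    max (2 * C) (2 * C') ⊔ ‖deriv (γ.trans γ').extend (1 / 2)‖, fun s => ?_⟩
  · simp only [mem_union, mem_singleton_iff, mem_preimage, not_or] at hs
    rcases lt_or_gt_of_ne hs.1 with h | h
    · exact ((hd _ hs.2.1).comp s (by fun_prop)).congr_of_eventuallyEq (e1 s h)
    · exact ((hd' _ hs.2.2).comp s (by fun_prop)).congr_of_eventuallyEq (e2 s h)
  · rcases lt_trichotomy s (1 / 2) with h | h | h
    · rw [(e1 s h).deriv_eq, deriv_comp_mul_left 2 γ.extend s]
      refine le_sup_of_le_left (le_sup_of_le_left ?_)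
      rw [norm_smul]
      simpa using hC _
    · rw [h]
      exact le_sup_right
    · have : deriv (fun s => γ'.extend (2 * s - 1)) s = (2 : ℝ) • deriv γ'.extend (2 * s - 1) := by
        rw [deriv_comp_mul_left 2 (fun u => γ'.extend (u - 1)) s, deriv_comp_sub_const]
      rw [(e2 s h).deriv_eq, this]
      refine le_sup_of_le_left (le_sup_of_le_right ?_)
      rw [norm_smul]
      simpa using hC' _

theorem goodPath_of_contDiffOn {γ : Path x y} (h : ContDiffOn ℝ 1 γ.extend (Icc 0 1)) :
    GoodPath γ := by
  have hcont := h.continuousOn_derivWithin (uniqueDiffOn_Icc zero_lt_one) le_rfl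
  obtain ⟨C, hC⟩ := isCompact_Icc.exists_bound_of_continuousOn hcont
  refine ⟨{0, 1}, (Set.toFinite _).countable, fun s hs => ?_,
    (C ⊔ 0) ⊔ (‖deriv γ.extend 0‖ ⊔ ‖deriv γ.extend 1‖), fun s => ?_⟩
  · simp only [mem_insert_iff, mem_singleton_iff, not_or] at hs
    rcases lt_or_gt_of_ne hs.1 with h0 | h0
    · refine (differentiableAt_const x).congr_of_eventuallyEq ?_
      filter_upwards [Iio_mem_nhds h0] with u hu using γ.extend_of_le_zero (le_of_lt hu)
    · rcases lt_or_gt_of_ne hs.2 with h1 | h1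
      · exact (h.differentiableOn one_ne_zero).differentiableAt (Icc_mem_nhds h0 h1)
      · refine (differentiableAt_const y).congr_of_eventuallyEq ?_
        filter_upwards [Ioi_mem_nhds h1] with u hu using γ.extend_of_one_le (le_of_lt hu)
  · rcases lt_trichotomy s 0 with h0 | h0 | h0
    · have : γ.extend =ᶠ[𝓝 s] fun _ => x := by
        filter_upwards [Iio_mem_nhds h0] with u hu using γ.extend_of_le_zero (le_of_lt hu)
      rw [this.deriv_eq]
      simp
    · rw [h0]; exact le_sup_of_le_right le_sup_left
    · rcases lt_trichotomy s 1 with h1 | h1 | h1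
      · rw [← derivWithin_of_mem_nhds (Icc_mem_nhds h0 h1)]
        exact le_sup_of_le_left (le_sup_of_le_left (hC s ⟨h0.le, h1.le⟩))
      · rw [h1]; exact le_sup_of_le_right le_sup_right
      · have : γ.extend =ᶠ[𝓝 s] fun _ => y := by
          filter_upwards [Ioi_mem_nhds h1] with u hu using γ.extend_of_one_le (le_of_lt hu)
        rw [this.deriv_eq]
        simp

theorem circlePath_extend (c u : ℂ) {s : ℝ} (hs : s ∈ Icc (0 : ℝ) 1) :
    (circlePath c u).extend s = c + u * Complex.exp (2 * Real.pi * Complex.I * s) := by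
  rw [Path.extend_apply _ hs]; rfl

theorem goodPath_circlePath (c u : ℂ) : GoodPath (circlePath c u) := by
  refine goodPath_of_contDiffOn (ContDiffOn.congr (f := fun s : ℝ =>
    c + u * Complex.exp (2 * Real.pi * Complex.I * s)) ?_ fun s hs => circlePath_extend c u hs)
  have : ContDiff ℝ 1 (fun s : ℝ => (s : ℂ)) := Complex.ofRealCLM.contDiff
  fun_prop

theorem goodPath_loopAround {o c u : ℂ} {τ : Path o (c + u)}
    (h : ContDiffOn ℝ 1 τ.extend (Icc 0 1)) : GoodPath (loopAround c u τ) :=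
  ((goodPath_of_contDiffOn h).trans (goodPath_circlePath c u)).trans (goodPath_of_contDiffOn h).symm

theorem goodPath_commutatorLoop {o : ℂ} {A B : Path o o} (hA : GoodPath A) (hB : GoodPath B) :
    GoodPath (commutatorLoop A B) :=
  ((hA.trans hB).trans hA.symm).trans hB.symm

end GoodPath


/-! ### Weighted integrals over closed contours -/

/-- A closed curve with closed continuous branches of the logarithms of `w - a₀`, `w - a₁` and `z - w`
along it, for `z` in the open set `D`. -/
structure IsClosedContour (a₀ a₁ : ℂ) (c : ℝ → ℂ) (D : Set ℂ) (L₀ L₁ : ℝ → ℂ) (L : ℂ × ℝ → ℂ) : Prop where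
  continuous : Continuous c
  exists_differentiableAt : ∃ S : Set ℝ, S.Countable ∧ ∀ s ∉ S, DifferentiableAt ℝ c s
  exists_norm_deriv_le : ∃ C, ∀ s, ‖deriv c s‖ ≤ C
  isOpen : IsOpen D
  branch₀ : IsLogBranch (Icc 0 1) (fun s => c s - a₀) L₀
  branch₁ : IsLogBranch (Icc 0 1) (fun s => c s - a₁) L₁
  branch : IsLogBranch (D ×ˢ Icc (0 : ℝ) 1) (fun x => x.1 - c x.2) L
  closed₀ : L₀ 1 = L₀ 0
  closed₁ : L₁ 1 = L₁ 0
  closed : ∀ z ∈ D, L (z, 1) = L (z, 0)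
  closed_curve : c 1 = c 0

/-- `∫ (w-a₀)^b₀ (w-a₁)^b₁ f(w) (z-w)^e dw` along the contour. -/
noncomputable def weightInt (c L₀ L₁ : ℝ → ℂ) (L : ℂ × ℝ → ℂ) (b₀ b₁ e : ℂ) (f : ℂ → ℂ) (z : ℂ) :
    ℂ :=
  ∫ s in (0 : ℝ)..1, Complex.exp (b₀ * L₀ s) * Complex.exp (b₁ * L₁ s) * f (c s)
    * Complex.exp (e * L (z, s)) * deriv c s

namespace IsClosedContour

variable {a₀ a₁ : ℂ} {c L₀ L₁ : ℝ → ℂ} {D : Set ℂ} {L : ℂ × ℝ → ℂ}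

theorem branch_left (H : IsClosedContour a₀ a₁ c D L₀ L₁ L) {z : ℂ} (hz : z ∈ D) :
    IsLogBranch (Icc 0 1) (fun s => z - c s) (fun s => L (z, s)) :=
  ⟨H.branch.1.comp (by fun_prop) fun _ hs => ⟨hz, hs⟩, fun s hs => H.branch.2 (z, s) ⟨hz, hs⟩⟩

theorem sub_ne_zero₀ (H : IsClosedContour a₀ a₁ c D L₀ L₁ L) {s : ℝ} (hs : s ∈ Icc (0 : ℝ) 1) : c s - a₀ ≠ 0 := by
  have := H.branch₀.2 s hs
  beta_reduce at this
  exact this ▸ Complex.exp_ne_zero _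

theorem sub_ne_zero₁ (H : IsClosedContour a₀ a₁ c D L₀ L₁ L) {s : ℝ} (hs : s ∈ Icc (0 : ℝ) 1) :
    c s - a₁ ≠ 0 := by
  have := H.branch₁.2 s hs
  beta_reduce at this
  exact this ▸ Complex.exp_ne_zero _

theorem sub_ne_zero (H : IsClosedContour a₀ a₁ c D L₀ L₁ L) {z : ℂ} (hz : z ∈ D) {s : ℝ}
    (hs : s ∈ Icc (0 : ℝ) 1) : z - c s ≠ 0 := by
  have := (H.branch_left hz).2 s hs
  beta_reduce at this
  exact this ▸ Complex.exp_ne_zero _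

theorem continuousOn_weight (H : IsClosedContour a₀ a₁ c D L₀ L₁ L) {z : ℂ} (hz : z ∈ D)
    (b₀ b₁ e : ℂ) {f : ℂ → ℂ} {a b : ℝ} (hab : Icc a b ⊆ Icc 0 1)
    (hf : ContinuousOn (fun s => f (c s)) (Icc a b)) :
    ContinuousOn (fun s => Complex.exp (b₀ * L₀ s) * Complex.exp (b₁ * L₁ s) * f (c s)
      * Complex.exp (e * L (z, s))) (Icc a b) := by
  have h0 := H.branch₀.1.mono hab
  have h1 := H.branch₁.1.mono hab
  have h2 := (H.branch_left hz).1.mono hab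
  exact (((continuousOn_const.mul h0).cexp.mul (continuousOn_const.mul h1).cexp).mul hf).mul
    (continuousOn_const.mul h2).cexp

theorem intervalIntegrable_mul_deriv (H : IsClosedContour a₀ a₁ c D L₀ L₁ L) {F : ℝ → ℂ} {a b : ℝ}
    (hab : a ≤ b) (hF : ContinuousOn F (Icc a b)) :
    IntervalIntegrable (fun s => F s * deriv c s) volume a b := by
  obtain ⟨C, hC⟩ := H.exists_norm_deriv_le
  rw [intervalIntegrable_iff_integrableOn_Icc_of_le hab]
  exact hF.integrableOn_Icc.mul_bdd (c := C) (aestronglyMeasurable_deriv _ _)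
    (Eventually.of_forall hC)

theorem intervalIntegrable (H : IsClosedContour a₀ a₁ c D L₀ L₁ L) {z : ℂ} (hz : z ∈ D)
    (b₀ b₁ e : ℂ) {f : ℂ → ℂ} (hf : ContinuousOn (fun s => f (c s)) (Icc 0 1)) :
    IntervalIntegrable (fun s => Complex.exp (b₀ * L₀ s) * Complex.exp (b₁ * L₁ s) * f (c s)
      * Complex.exp (e * L (z, s)) * deriv c s) volume 0 1 :=
  H.intervalIntegrable_mul_deriv zero_le_one (H.continuousOn_weight hz b₀ b₁ e Subset.rfl hf)

/-- The hypothesis on `f` says that weight times `f` is the derivative in `w` of weight times `g`,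
so this is the fundamental theorem of calculus along an arc; countably many corners do no harm. -/
theorem integral_deriv_eq_sub (H : IsClosedContour a₀ a₁ c D L₀ L₁ L) {z : ℂ} (hz : z ∈ D)
    {b₀ b₁ e : ℂ} {f g g' : ℂ → ℂ} {a b : ℝ} (ha : 0 ≤ a) (hab : a ≤ b) (hb : b ≤ 1)
    (hf : ContinuousOn (fun s => f (c s)) (Icc a b))
    (hg : ∀ s ∈ Icc a b, HasDerivAt g (g' (c s)) (c s))
    (hfg : ∀ s ∈ Icc a b,
      (b₀ / (c s - a₀) + b₁ / (c s - a₁) - e / (z - c s)) * g (c s) + g' (c s) = f (c s)) :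
    ∫ s in a..b, Complex.exp (b₀ * L₀ s) * Complex.exp (b₁ * L₁ s) * f (c s)
        * Complex.exp (e * L (z, s)) * deriv c s =
      Complex.exp (b₀ * L₀ b) * Complex.exp (b₁ * L₁ b) * g (c b) * Complex.exp (e * L (z, b)) -
      Complex.exp (b₀ * L₀ a) * Complex.exp (b₁ * L₁ a) * g (c a)
        * Complex.exp (e * L (z, a)) := by
  obtain ⟨S, hS, hd⟩ := H.exists_differentiableAt
  have hsub : Icc a b ⊆ Icc (0 : ℝ) 1 := Icc_subset_Icc ha hb
  have hgc : ContinuousOn (fun s => g (c s)) (Icc a b) := fun s hs =>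
    ((hg s hs).continuousAt.comp (f := c) H.continuous.continuousAt).continuousWithinAt
  refine integral_eq_of_hasDerivAt_off_countable_of_le (fun s => Complex.exp (b₀ * L₀ s)
    * Complex.exp (b₁ * L₁ s) * g (c s) * Complex.exp (e * L (z, s))) _ hab hS
    (H.continuousOn_weight hz b₀ b₁ e hsub hgc) ?_
    (H.intervalIntegrable_mul_deriv hab (H.continuousOn_weight hz b₀ b₁ e hsub hf))
  rintro s ⟨hs, hsS⟩
  have hs' := Ioo_subset_Icc_self hs
  have hs01 : Icc (0 : ℝ) 1 ∈ 𝓝 s :=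
    Icc_mem_nhds (ha.trans_lt hs.1) (hs.2.trans_le hb)
  have hc := (hd s hsS).hasDerivAt
  have d0 := hasDerivAt_of_exp_eq (H.branch₀.1.continuousAt hs01)
    (by filter_upwards [hs01] with u hu using H.branch₀.2 u hu) (hc.sub_const a₀)
  have d1 := hasDerivAt_of_exp_eq (H.branch₁.1.continuousAt hs01)
    (by filter_upwards [hs01] with u hu using H.branch₁.2 u hu) (hc.sub_const a₁)
  have d2 := hasDerivAt_of_exp_eq ((H.branch_left hz).1.continuousAt hs01)
    (by filter_upwards [hs01] with u hu using (H.branch_left hz).2 u hu) (hc.const_sub z)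
  have dg : HasDerivAt (fun u => g (c u)) (deriv c s * g' (c s)) s :=
    (hg s hs').scomp s hc
  refine ((((d0.const_mul b₀).cexp.fun_mul (d1.const_mul b₁).cexp).fun_mul dg).fun_mul
    (d2.const_mul e).cexp).congr_deriv ?_
  rw [← hfg s hs']
  ring

theorem weightInt_add (H : IsClosedContour a₀ a₁ c D L₀ L₁ L) {z : ℂ} (hz : z ∈ D)
    (b₀ b₁ e : ℂ) {f g : ℂ → ℂ} (hf : ContinuousOn (fun s => f (c s)) (Icc 0 1))
    (hg : ContinuousOn (fun s => g (c s)) (Icc 0 1)) :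
    weightInt c L₀ L₁ L b₀ b₁ e (fun w => f w + g w) z =
      weightInt c L₀ L₁ L b₀ b₁ e f z + weightInt c L₀ L₁ L b₀ b₁ e g z := by
  unfold weightInt
  rw [← intervalIntegral.integral_add (H.intervalIntegrable hz b₀ b₁ e hf)
    (H.intervalIntegrable hz b₀ b₁ e hg)]
  congr 1
  ext s
  ring

theorem weightInt_const_mul (b₀ b₁ e k : ℂ) (f : ℂ → ℂ) (z : ℂ) :
    weightInt c L₀ L₁ L b₀ b₁ e (fun w => k * f w) z = k * weightInt c L₀ L₁ L b₀ b₁ e f z := by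
  unfold weightInt
  rw [← intervalIntegral.integral_const_mul]
  congr 1
  ext s
  ring

theorem weightInt_congr (b₀ b₁ e : ℂ) {f g : ℂ → ℂ} {z : ℂ}
    (h : ∀ s ∈ Icc (0 : ℝ) 1, f (c s) = g (c s)) :
    weightInt c L₀ L₁ L b₀ b₁ e f z = weightInt c L₀ L₁ L b₀ b₁ e g z := by
  unfold weightInt
  refine intervalIntegral.integral_congr fun s hs => ?_
  rw [uIcc_of_le zero_le_one] at hs
  simp only [h s hs]

theorem weightInt_exp_succ (H : IsClosedContour a₀ a₁ c D L₀ L₁ L) {z : ℂ} (hz : z ∈ D)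
    (b₀ b₁ e : ℂ) (f : ℂ → ℂ) :
    weightInt c L₀ L₁ L b₀ b₁ e (fun w => (z - w) * f w) z =
      weightInt c L₀ L₁ L b₀ b₁ (e + 1) f z := by
  unfold weightInt
  refine intervalIntegral.integral_congr fun s hs => ?_
  rw [uIcc_of_le zero_le_one] at hs
  simp only [add_mul, one_mul, Complex.exp_add, (H.branch_left hz).2 s hs]
  ring

/-- The boundary terms agree because the curve and all three branches close up. This is the only
source of integration by parts on the contour. -/
theorem weightInt_exact (H : IsClosedContour a₀ a₁ c D L₀ L₁ L) {z : ℂ} (hz : z ∈ D)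
    {b₀ b₁ e : ℂ} {f g g' : ℂ → ℂ} (hf : ContinuousOn (fun s => f (c s)) (Icc 0 1))
    (hg : ∀ s ∈ Icc (0 : ℝ) 1, HasDerivAt g (g' (c s)) (c s))
    (hfg : ∀ s ∈ Icc (0 : ℝ) 1,
      (b₀ / (c s - a₀) + b₁ / (c s - a₁) - e / (z - c s)) * g (c s) + g' (c s) = f (c s)) :
    weightInt c L₀ L₁ L b₀ b₁ e f z = 0 := by
  rw [weightInt, H.integral_deriv_eq_sub hz le_rfl zero_le_one le_rfl hf hg hfg, H.closed₀,
    H.closed₁, H.closed z hz, H.closed_curve, sub_self]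

/-- Differentiation under the integral sign; domination comes from compactness of a closed disc
times the unit interval and from the bound on the speed of the curve. -/
theorem hasDerivAt_weightInt (H : IsClosedContour a₀ a₁ c D L₀ L₁ L) {z : ℂ} (hz : z ∈ D)
    (b₀ b₁ e : ℂ) {f : ℂ → ℂ} (hf : ContinuousOn (fun s => f (c s)) (Icc 0 1)) :
    HasDerivAt (weightInt c L₀ L₁ L b₀ b₁ e f) (e * weightInt c L₀ L₁ L b₀ b₁ (e - 1) f z) z := by
  obtain ⟨C, hC⟩ := H.exists_norm_deriv_le
  obtain ⟨r, hr, hball⟩ := Metric.nhds_basis_closedBall.mem_iff.1 (H.isOpen.mem_nhds hz)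
  have hcont : ContinuousOn (fun x : ℂ × ℝ => Complex.exp (b₀ * L₀ x.2) * Complex.exp (b₁ * L₁ x.2)
      * f (c x.2) * (e * Complex.exp ((e - 1) * L x))) (Metric.closedBall z r ×ˢ Icc (0 : ℝ) 1) := by
    have hm : MapsTo Prod.snd (Metric.closedBall z r ×ˢ Icc (0 : ℝ) 1) (Icc (0 : ℝ) 1) :=
      fun x hx => hx.2
    have h0 := H.branch₀.1.comp continuousOn_snd hm
    have h1 := H.branch₁.1.comp continuousOn_snd hm
    have h2 := hf.comp continuousOn_snd hm
    have h3 := H.branch.1.mono (prod_mono_left hball : _ ⊆ D ×ˢ Icc (0 : ℝ) 1)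
    exact (((continuousOn_const.mul h0).cexp.mul (continuousOn_const.mul h1).cexp).mul h2).mul
      (continuousOn_const.mul (continuousOn_const.mul h3).cexp)
  obtain ⟨M, hM⟩ := ((isCompact_closedBall z r).prod isCompact_Icc).exists_bound_of_continuousOn
    hcont
  have hI : uIoc (0 : ℝ) 1 ⊆ Icc 0 1 := by
    rw [uIoc_of_le zero_le_one]; exact Ioc_subset_Icc_self
  have hF : ∀ x ∈ D, ∀ e, AEStronglyMeasurable (fun s => Complex.exp (b₀ * L₀ s)
      * Complex.exp (b₁ * L₁ s) * f (c s) * Complex.exp (e * L (x, s)) * deriv c s)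
      (volume.restrict (uIoc (0 : ℝ) 1)) := fun x hx e =>
    (H.intervalIntegrable hx b₀ b₁ e hf).def'.aestronglyMeasurable
  have key := intervalIntegral.hasDerivAt_integral_of_dominated_loc_of_deriv_le
    (F := fun z s => Complex.exp (b₀ * L₀ s) * Complex.exp (b₁ * L₁ s) * f (c s)
      * Complex.exp (e * L (z, s)) * deriv c s)
    (F' := fun z s => e * (Complex.exp (b₀ * L₀ s) * Complex.exp (b₁ * L₁ s) * f (c s)
      * Complex.exp ((e - 1) * L (z, s)) * deriv c s))
    (x₀ := z) (s := Metric.ball z r) (bound := fun _ => M * C) (a := 0) (b := 1) (μ := volume)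
    (Metric.ball_mem_nhds z hr)
    (by filter_upwards [H.isOpen.mem_nhds hz] with x hx using hF x hx e)
    (H.intervalIntegrable hz b₀ b₁ e hf)
    ((hF z hz (e - 1)).const_mul e)
    (Eventually.of_forall fun s hs x hx => ?_) (by simp)
    (Eventually.of_forall fun s hs x hx => ?_)
  · rw [intervalIntegral.integral_const_mul] at key
    exact key.2
  · have := hM (x, s) ⟨Metric.ball_subset_closedBall hx, hI hs⟩
    calc _ = ‖Complex.exp (b₀ * L₀ s) * Complex.exp (b₁ * L₁ s)
          * f (c s) * (e * Complex.exp ((e - 1) * L (x, s)))‖ * ‖deriv c s‖ := by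
          rw [← norm_mul]; congr 1; ring
      _ ≤ M * C := by
        gcongr
        · exact (norm_nonneg _).trans this
        · exact hC s
  · have hxD : x ∈ D := hball (Metric.ball_subset_closedBall hx)
    have hs' := hI hs
    have hcx : ContinuousOn (fun y => L (y, s)) D :=
      H.branch.1.comp (by fun_prop) fun y hy => ⟨hy, hs'⟩
    have d := hasDerivAt_of_exp_eq (f := fun y => y - c s) (l := fun y => L (y, s))
      (hcx.continuousAt (H.isOpen.mem_nhds hxD))
      (by filter_upwards [H.isOpen.mem_nhds hxD] with y hy using H.branch.2 (y, s) ⟨hy, hs'⟩)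
      ((hasDerivAt_id' x).sub_const (c s))
    refine (((d.const_mul e).cexp.const_mul (Complex.exp (b₀ * L₀ s) * Complex.exp (b₁ * L₁ s)
      * f (c s))).mul_const (deriv c s)).congr_deriv ?_
    rw [sub_mul, one_mul, Complex.exp_sub, (H.branch_left hxD).2 s hs']
    ring

end IsClosedContour

theorem isClosedContour_commutatorLoop {o : ℂ} {A B : Path o o} (hA : GoodPath A) (hB : GoodPath B)
    {D : Set ℂ} (hD : IsOpen D) {L₀ L₁ : ℝ → ℂ} {L : ℂ × ℝ → ℂ}
    (h : IsBranchData (commutatorLoop A B) D L₀ L₁ L) :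
    IsClosedContour 0 1 (commutatorLoop A B).extend D L₀ L₁ L := by
  obtain ⟨S, hS, hd, C, hC⟩ := goodPath_commutatorLoop hA hB
  refine ⟨Path.continuous_extend _, ⟨S, hS, hd⟩, ⟨C, hC⟩, hD, by simpa using h.1, h.2, h.3,
    commutator_closed (m := fun w => w) h.1, commutator_closed (m := fun w => w - 1) h.2,
    fun z hz => ?_, by simp⟩
  refine commutator_closed (m := fun w => z - w) (A := A) (B := B) (l := fun s => L (z, s))
    ⟨h.3.1.comp (by fun_prop) fun _ hs => ⟨hz, hs⟩, fun s hs => h.3.2 (z, s) ⟨hz, hs⟩⟩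

/-! ### The Pochhammer integrals solve Heun's equation -/

section Solution

variable {α β γ δ q t : ℂ}

/-- Kernel method: Heun's operator in `z`, applied to weight times `(z-w)^(-β)`, is a total
`w`-derivative as soon as `h` satisfies the kernel equation, and the contour is closed. -/
theorem IsKernelPoly.isHeunSolution_weightInt (hδ : γ + δ + (-2) = α + β + 1) {h : Polynomial ℂ}
    (hh : IsKernelPoly α β γ δ q t h) {c L₀ L₁ : ℝ → ℂ} {D : Set ℂ} {L : ℂ × ℝ → ℂ}
    (H : IsClosedContour 0 1 c D L₀ L₁ L) (h0 : 0 ∉ D) (h1 : 1 ∉ D) :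
    IsHeunSolution α β γ δ (-2) q t (D \ {t})
      (weightInt c L₀ L₁ L (β - γ) (β - δ) (-β) (fun w => h.eval w)) := by
  rw [isHeunSolution_iff (fun h => h0 h.1) (fun h => h1 h.1) (by simp)]
  have hc := H.continuous
  have hh0 : Continuous fun s => h.eval (c s) := h.continuous.comp hc
  set J := weightInt c L₀ L₁ L (β - γ) (β - δ) with hJ
  have d1 : ∀ z ∈ D, HasDerivAt (J (-β) (fun w => h.eval w))
      (-β * J (-β - 1) (fun w => h.eval w) z) z := fun z hz =>
    H.hasDerivAt_weightInt hz _ _ _ hh0.continuousOn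
  refine ⟨fun z hz => (d1 z hz.1).differentiableAt.differentiableWithinAt, fun z hz => ?_⟩
  have hz' := hz.1
  have d2 : HasDerivAt (deriv (J (-β) (fun w => h.eval w)))
      (-β * ((-β - 1) * J (-β - 1 - 1) (fun w => h.eval w) z)) z := by
    refine ((H.hasDerivAt_weightInt hz' _ _ _ hh0.continuousOn).const_mul (-β)).congr_of_eventuallyEq
      ?_
    filter_upwards [H.isOpen.mem_nhds hz'] with x hx using (d1 x hx).deriv
  rw [heunOp, d2.deriv, (d1 z hz').deriv]
  set P := z * (z - 1) * (z - t)
  set Q := γ * (z - 1) * (z - t) + δ * z * (z - t) + -2 * z * (z - 1)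
  -- The integrals for `y''`, `y'` and `y` carry the exponents `-β-2`, `-β-1` and `-β`; powers of `z
  -- - w` bring all three to `-β-2`.
  have s1 := H.weightInt_exp_succ hz' (β - γ) (β - δ) (-β - 1 - 1) (fun w => h.eval w)
  have s2 := H.weightInt_exp_succ hz' (β - γ) (β - δ) (-β - 1 - 1) (fun w => (z - w) * h.eval w)
  have s3 := H.weightInt_exp_succ hz' (β - γ) (β - δ) (-β - 1) (fun w => h.eval w)
  simp only [sub_add_cancel] at s1 s2 s3
  rw [← hJ] at s1 s2 s3
  have hexact : J (-β - 1 - 1) (fun w => (β * (β + 1) * P) * h.eval w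
      + ((-(β * Q)) * ((z - w) * h.eval w)
        + (α * β * z - q) * ((z - w) * ((z - w) * h.eval w)))) z = 0 := by
    -- With `K = (z-w)^(-β)`, the primitive is `w(w-1)((w-t)(h ∂K - K h') + (β+2) K h)`, rescaled by
    -- `(z-w)^(β+2)` to match the common exponent.
    refine H.weightInt_exact hz'
      (g := fun w => w * (w - 1) * (z - w) * (β * h.eval w * (w - t)
        + (z - w) * ((β + 2) * h.eval w - (w - t) * h.derivative.eval w)))
      (g' := fun w => (2 * w - 1) * (z - w) * (β * h.eval w * (w - t)
        + (z - w) * ((β + 2) * h.eval w - (w - t) * h.derivative.eval w))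
        - w * (w - 1) * (β * h.eval w * (w - t)
        + (z - w) * ((β + 2) * h.eval w - (w - t) * h.derivative.eval w))
        + w * (w - 1) * (z - w) * (β * h.derivative.eval w * (w - t) + β * h.eval w
          - ((β + 2) * h.eval w - (w - t) * h.derivative.eval w)
          + (z - w) * ((β + 1) * h.derivative.eval w - (w - t) * h.derivative.derivative.eval w)))
      (by fun_prop) (fun s hs => ?_) (fun s hs => ?_)
    · generalize c s = w
      have e0 := h.hasDerivAt w
      have e1 := h.derivative.hasDerivAt w
      have i := hasDerivAt_id' w
      have n0 := ((e0.const_mul β).fun_mul (i.sub_const t))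
      have n1 := ((e0.const_mul (β + 2)).fun_sub ((i.sub_const t).fun_mul e1))
      refine (((i.fun_mul (i.sub_const 1)).fun_mul (i.const_sub z)).fun_mul
        (n0.fun_add ((i.const_sub z).fun_mul n1))).congr_deriv ?_
      ring
    · have w0 := H.sub_ne_zero₀ hs
      rw [sub_zero] at w0
      have w1 := H.sub_ne_zero₁ hs
      have wz := H.sub_ne_zero hz' hs
      generalize c s = w at w0 w1 wz
      have key := hh w
      obtain rfl : δ = α + β + 3 - γ := by linear_combination hδ
      simp only [P, Q]
      rw [sub_zero]
      field_simp
      linear_combination (-(z - w) ^ 2) * key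
  rw [hJ, H.weightInt_add hz' _ _ _ (by fun_prop) (by fun_prop),
    H.weightInt_add hz' _ _ _ (by fun_prop) (by fun_prop), IsClosedContour.weightInt_const_mul,
    IsClosedContour.weightInt_const_mul, IsClosedContour.weightInt_const_mul, ← hJ, s1, s2, s3]
    at hexact
  linear_combination hexact

theorem isHeunSolution_contourIntegral (hδ : γ + δ + (-2) = α + β + 1)
    {h : Polynomial ℂ} (hh : IsKernelPoly α β γ δ q t h) {o z₀ u u' p : ℂ} {τ : Path o (z₀ + u)}
    {τ' : Path o (p + u')} (hadm : IsAdmissible p z₀ u u' τ τ') {L₀ L₁ : ℝ → ℂ} {L : ℂ × ℝ → ℂ}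
    (hb : IsBranchData (commutatorLoop (loopAround z₀ u τ) (loopAround p u' τ'))
      (Metric.ball z₀ ‖u‖) L₀ L₁ L) :
    IsHeunSolution α β γ δ (-2) q t (Metric.ball z₀ ‖u‖ \ {t})
      (contourIntegral β γ δ h (commutatorLoop (loopAround z₀ u τ) (loopAround p u' τ')) L₀ L₁ L) :=
  hh.isHeunSolution_weightInt hδ (isClosedContour_commutatorLoop (goodPath_loopAround hadm.smooth)
    (goodPath_loopAround hadm.smooth') Metric.isOpen_ball hb)
    (fun h => hadm.zero_notMem (Metric.ball_subset_closedBall h))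
    (fun h => hadm.one_notMem (Metric.ball_subset_closedBall h))

end Solution


/-! ### Averages along rays in star-shaped domains -/

/-- `∫₀¹ k(x) ω(a + x(z - a)) dx`. -/
noncomputable def starInt (k : ℝ → ℂ) (a : ℂ) (ω : ℂ → ℂ) (z : ℂ) : ℂ :=
  ∫ x in (0 : ℝ)..1, k x * ω (a + x * (z - a))

section StarInt

variable {k : ℝ → ℂ} {a z : ℂ} {ω : ℂ → ℂ} {U : Set ℂ}

theorem add_mul_sub_mem (hs : StarConvex ℝ a U) (hz : z ∈ U) {x : ℝ} (hx : x ∈ Icc (0 : ℝ) 1) :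
    a + x * (z - a) ∈ U := by
  have := hs hz (sub_nonneg.2 hx.2) hx.1 (by ring)
  convert this using 1
  simp only [Complex.real_smul]
  push_cast
  ring

theorem intervalIntegrable_starInt (hk : ContinuousOn k (Icc 0 1)) (hs : StarConvex ℝ a U)
    (hω : ContinuousOn ω U) (hz : z ∈ U) :
    IntervalIntegrable (fun x => k x * ω (a + x * (z - a))) volume 0 1 := by
  refine ContinuousOn.intervalIntegrable_of_Icc zero_le_one (hk.mul (hω.comp ?_ fun x hx =>
    add_mul_sub_mem hs hz hx))
  fun_prop

theorem hasDerivAt_starInt (hk : ContinuousOn k (Icc 0 1)) (hU : IsOpen U)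
    (hs : StarConvex ℝ a U) (hω : DifferentiableOn ℂ ω U) (hz : z ∈ U) :
    HasDerivAt (starInt k a ω) (starInt (fun x => x * k x) a (deriv ω) z) z := by
  obtain ⟨r, hr, hball⟩ := Metric.nhds_basis_closedBall.mem_iff.1 (hU.mem_nhds hz)
  have hω' := (hω.deriv hU).continuousOn
  have hxk : ContinuousOn (fun x : ℝ => (x : ℂ) * k x) (Icc 0 1) :=
    Complex.continuous_ofReal.continuousOn.mul hk
  have hcont : ContinuousOn (fun y : ℂ × ℝ => y.2 * k y.2 * deriv ω (a + y.2 * (y.1 - a)))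
      (Metric.closedBall z r ×ˢ Icc (0 : ℝ) 1) :=
    (hxk.comp continuousOn_snd fun y hy => hy.2).mul (hω'.comp (by fun_prop) fun y hy =>
      add_mul_sub_mem hs (hball hy.1) hy.2)
  obtain ⟨M, hM⟩ := ((isCompact_closedBall z r).prod isCompact_Icc).exists_bound_of_continuousOn
    hcont
  have hI : uIoc (0 : ℝ) 1 ⊆ Icc 0 1 := by
    rw [uIoc_of_le zero_le_one]; exact Ioc_subset_Icc_self
  refine (intervalIntegral.hasDerivAt_integral_of_dominated_loc_of_deriv_le
    (F := fun z x => k x * ω (a + x * (z - a)))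
    (F' := fun z x => x * k x * deriv ω (a + x * (z - a)))
    (x₀ := z) (s := Metric.ball z r) (bound := fun _ => M) (a := 0) (b := 1) (μ := volume)
    (Metric.ball_mem_nhds z hr) ?_ (intervalIntegrable_starInt hk hs hω.continuousOn hz)
    (intervalIntegrable_starInt hxk hs hω' hz).def'.aestronglyMeasurable
    (Eventually.of_forall fun x hx y hy => ?_) (by simp)
    (Eventually.of_forall fun x hx y hy => ?_)).2
  · filter_upwards [hU.mem_nhds hz] with y hy using
      (intervalIntegrable_starInt hk hs hω.continuousOn hy).def'.aestronglyMeasurable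
  · exact hM (y, x) ⟨Metric.ball_subset_closedBall hy, hI hx⟩
  · have hy' := add_mul_sub_mem hs (hball (Metric.ball_subset_closedBall hy)) (hI hx)
    have d1 := (hω.differentiableAt (hU.mem_nhds hy')).hasDerivAt
    have d2 : HasDerivAt (fun y : ℂ => a + x * (y - a)) (x : ℂ) y := by
      simpa using (((hasDerivAt_id' y).sub_const a).const_mul (x : ℂ)).const_add a
    refine ((d1.comp y d2).const_mul (k x)).congr_deriv ?_
    ring

theorem differentiableOn_starInt (hk : ContinuousOn k (Icc 0 1)) (hU : IsOpen U)
    (hs : StarConvex ℝ a U) (hω : DifferentiableOn ℂ ω U) :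
    DifferentiableOn ℂ (starInt k a ω) U := fun _ hz =>
  (hasDerivAt_starInt hk hU hs hω hz).differentiableAt.differentiableWithinAt

theorem iteratedDeriv_starInt (hU : IsOpen U) (hs : StarConvex ℝ a U) (n : ℕ) :
    ∀ {k : ℝ → ℂ} {ω : ℂ → ℂ} {z : ℂ}, ContinuousOn k (Icc 0 1) → DifferentiableOn ℂ ω U → z ∈ U →
    iteratedDeriv n (starInt k a ω) z =
      starInt (fun x => x ^ n * k x) a (iteratedDeriv n ω) z := by
  induction n with
  | zero => intro k ω z hk hω hz; simp
  | succ n ih =>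
    intro k ω z hk hω hz
    have h1 : deriv (starInt k a ω) =ᶠ[𝓝 z] starInt (fun x => x * k x) a (deriv ω) := by
      filter_upwards [hU.mem_nhds hz] with y hy using (hasDerivAt_starInt hk hU hs hω hy).deriv
    rw [iteratedDeriv_succ', h1.iteratedDeriv_eq,
      ih (k := fun x => x * k x) (Complex.continuous_ofReal.continuousOn.mul hk) (hω.deriv hU) hz,
      iteratedDeriv_succ']
    congr 1
    ext x
    ring

/-- Each derivative at the centre brings out a factor `x`, so averaging multiplies the `n`-th Taylor
coefficient by the `n`-th moment of `k`. -/
theorem hasTaylor_starInt {c : ℕ → ℂ} (hk : ContinuousOn k (Icc 0 1)) (hU : IsOpen U)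
    (hs : StarConvex ℝ 0 U) (h0 : 0 ∈ U) (hω : DifferentiableOn ℂ ω U) (hc : HasTaylor ω c) :
    HasTaylor (starInt k 0 ω) (fun n => (∫ x in (0 : ℝ)..1, x ^ n * k x) * c n) := by
  refine ⟨(differentiableOn_starInt hk hU hs hω).analyticAt (hU.mem_nhds h0), fun n => ?_⟩
  rw [iteratedDeriv_starInt hU hs n hk hω h0, starInt]
  simp only [sub_zero, mul_zero, add_zero, hc.2]
  rw [intervalIntegral.integral_mul_const]
  ring

/-- The regular solution of a first order Fuchsian equation on a star-shaped domain. -/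
theorem exists_euler_solution {b : ℂ} (hb : 0 < b.re) (hU : IsOpen U) (hs : StarConvex ℝ a U)
    (hω : DifferentiableOn ℂ ω U) :
    ∃ Γ : ℂ → ℂ, DifferentiableOn ℂ Γ U ∧ ∀ w ∈ U, (w - a) * deriv Γ w + (b + 1) * Γ w = ω w := by
  have hk : ContinuousOn (fun x : ℝ => (x : ℂ) ^ b) (Icc 0 1) :=
    (Complex.continuous_ofReal_cpow_const hb).continuousOn
  refine ⟨starInt (fun x => (x : ℂ) ^ b) a ω, differentiableOn_starInt hk hU hs hω, fun w hw => ?_⟩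
  rw [(hasDerivAt_starInt hk hU hs hω hw).deriv]
  have hb1 : 0 < (b + 1).re := by simp; linarith
  have hb0 : b ≠ 0 := fun h => by simp [h] at hb
  have hb10 : b + 1 ≠ 0 := fun h => by simp [h] at hb1
  have hxk : ContinuousOn (fun x : ℝ => (x : ℂ) * (x : ℂ) ^ b) (Icc 0 1) :=
    Complex.continuous_ofReal.continuousOn.mul hk
  have i1 := intervalIntegrable_starInt hxk hs (hω.deriv hU).continuousOn hw
  have i2 := intervalIntegrable_starInt hk hs hω.continuousOn hw
  have hcω : ContinuousOn (fun x : ℝ => ω (a + x * (w - a))) (Icc 0 1) :=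
    hω.continuousOn.comp (by fun_prop) fun x hx => add_mul_sub_mem hs hw hx
  -- The solution is the average with `k(x) = x^b`: the left side of the equation is the integral of
  -- the `x`-derivative of `x^(b+1) ω(a + x(w-a))`, which is `ω w` at `x = 1` and `0` at `x = 0`.
  have key := intervalIntegral.integral_eq_sub_of_hasDerivAt_of_le (a := (0 : ℝ)) (b := 1)
    (f := fun x : ℝ => (x : ℂ) ^ (b + 1) * ω (a + x * (w - a)))
    (f' := fun x : ℝ => (w - a) * (x * (x : ℂ) ^ b * deriv ω (a + x * (w - a)))
      + (b + 1) * ((x : ℂ) ^ b * ω (a + x * (w - a)))) zero_le_one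
    ((Complex.continuous_ofReal_cpow_const hb1).continuousOn.mul hcω) (fun x hx => ?_)
    ((i1.const_mul _).add (i2.const_mul _))
  · rw [intervalIntegral.integral_add (i1.const_mul _) (i2.const_mul _),
      intervalIntegral.integral_const_mul, intervalIntegral.integral_const_mul] at key
    unfold starInt
    rw [key]
    simp [Complex.zero_cpow hb10]
  · have hx0 : (x : ℂ) ≠ 0 := by exact_mod_cast hx.1.ne'
    have e1 : HasDerivAt (fun y : ℝ => (y : ℂ) ^ (b + 1)) ((b + 1) * (x : ℂ) ^ b) x := by
      have h1 := (hasDerivAt_ofReal_cpow_const' hx.1.ne' (r := b) (fun h => hb10 (by rw [h]; ring)))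
      refine ((h1.const_mul (b + 1)).congr_deriv rfl).congr_of_eventuallyEq
        (Eventually.of_forall fun y => ?_)
      field_simp
    have hy' := add_mul_sub_mem hs hw (Ioo_subset_Icc_self hx)
    have d1 := (hω.differentiableAt (hU.mem_nhds hy')).hasDerivAt
    have d2 : HasDerivAt (fun y : ℝ => a + (y : ℂ) * (w - a)) (w - a) x := by
      simpa using ((Complex.ofRealCLM.hasDerivAt (x := x)).mul_const (w - a)).const_add a
    have d3 : HasDerivAt (fun y : ℝ => ω (a + y * (w - a))) ((w - a) * deriv ω (a + x * (w - a))) x :=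
      d1.scomp x d2
    refine (e1.fun_mul d3).congr_deriv ?_
    rw [Complex.cpow_add _ _ hx0, Complex.cpow_one]
    ring

end StarInt

/-! ### First order Fuchsian equations on slit planes -/

section SlitDomain

/-- The plane cut from `r` along the ray pointing away from `a`. -/
def raySlit (a r : ℂ) : Set ℂ := {w | (w - r) / (a - r) ∈ Complex.slitPlane}

theorem isOpen_raySlit (a r : ℂ) : IsOpen (raySlit a r) :=
  Complex.isOpen_slitPlane.preimage (by fun_prop)

theorem starConvex_raySlit {a r : ℂ} (h : a ≠ r) : StarConvex ℝ a (raySlit a r) := by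
  intro w hw x y hx hy hxy
  have h1 := Complex.starConvex_one_slitPlane hw hx hy hxy
  have har : a - r ≠ 0 := sub_ne_zero.2 h
  have hxy' : (x : ℂ) + y = 1 := by exact_mod_cast hxy
  show (x • a + y • w - r) / (a - r) ∈ Complex.slitPlane
  convert h1 using 1
  simp only [Complex.real_smul]
  field_simp
  linear_combination r * hxy'

theorem self_mem_raySlit {a r : ℂ} (h : a ≠ r) : a ∈ raySlit a r := by
  show (a - r) / (a - r) ∈ Complex.slitPlane
  rw [div_self (sub_ne_zero.2 h)]
  exact Complex.one_mem_slitPlane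

theorem ne_of_mem_raySlit {a r w : ℂ} (h : w ∈ raySlit a r) : w ≠ r := by
  rintro rfl
  have := Complex.slitPlane_ne_zero h
  simp at this

/-- A point on the cut sees `a` only through `r`. -/
theorem mem_raySlit_of_notMem_segment {a r w : ℂ} (h : r ∉ segment ℝ w a) : w ∈ raySlit a r := by
  have ha : a - r ≠ 0 := sub_ne_zero.2 fun e => h (e ▸ right_mem_segment ℝ w a)
  by_contra hw
  have hw' : (w - r) / (a - r) ∉ Complex.slitPlane := hw
  rw [Complex.mem_slitPlane_iff, not_or, not_lt, not_not] at hw'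
  set s := -((w - r) / (a - r)).re with hs
  have hs0 : 0 ≤ s := by linarith [hw'.1]
  have e : (w - r) / (a - r) = -(s : ℂ) := by
    apply Complex.ext <;> simp [hs, hw'.2]
  rw [div_eq_iff ha] at e
  apply h
  have h1s : (1 : ℝ) + s ≠ 0 := by positivity
  have h1s' : (1 : ℂ) + s ≠ 0 := by exact_mod_cast h1s
  refine ⟨1 / (1 + s), s / (1 + s), by positivity, by positivity, by field_simp, ?_⟩
  simp only [Complex.real_smul]
  push_cast
  field_simp
  linear_combination e

theorem hasDerivAt_raySlit_cpow {a r w : ℂ} (c : ℂ) (hw : w ∈ raySlit a r) :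
    HasDerivAt (fun w => ((w - r) / (a - r)) ^ c) (((w - r) / (a - r)) ^ c * (c / (w - r))) w := by
  have hne : (w - r) / (a - r) ≠ 0 := Complex.slitPlane_ne_zero hw
  have h1 : w - r ≠ 0 := fun h => hne (by rw [h, zero_div])
  have h2 : a - r ≠ 0 := fun h => hne (by rw [h, div_zero])
  refine ((((hasDerivAt_id' w).sub_const r).div_const (a - r)).cpow_const hw).congr_deriv ?_
  rw [Complex.cpow_sub _ _ hne, Complex.cpow_one]
  field_simp

/-- An integrating factor, single-valued on the slit domain, absorbs the singular terms at `r` and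
`a'`; what is left is Euler's equation at `a`, whose solution is holomorphic at `a` itself. -/
theorem exists_fuchs_solution {a a' r b e c : ℂ} (ha : a ≠ a') (har : a ≠ r) (hb : 0 < b.re)
    {R : ℂ → ℂ} (hR : DifferentiableOn ℂ R {r}ᶜ) :
    ∃ G : ℂ → ℂ, DifferentiableOn ℂ G (raySlit a r ∩ raySlit a a') ∧
      ∀ w ∈ raySlit a r ∩ raySlit a a', (w - a) * (w - a') * deriv G w
        + ((b + 1) * (w - a') + (e + 1) * (w - a) + c * (w - a) * (w - a') / (w - r)) * G w
        = R w := by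
  set U := raySlit a r ∩ raySlit a a' with hUdef
  have hU : IsOpen U := (isOpen_raySlit a r).inter (isOpen_raySlit a a')
  have hs : StarConvex ℝ a U := (starConvex_raySlit har).inter (starConvex_raySlit ha)
  set M : ℂ → ℂ := fun w => ((w - r) / (a - r)) ^ (-c) * ((w - a') / (a - a')) ^ (-(e + 1)) with hM
  have hM' : ∀ w ∈ U, HasDerivAt M (M w * (-c / (w - r) + -(e + 1) / (w - a'))) w := fun w hw => by
    refine ((hasDerivAt_raySlit_cpow (-c) hw.1).fun_mul
      (hasDerivAt_raySlit_cpow (-(e + 1)) hw.2)).congr_deriv ?_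
    simp only [hM]
    ring
  have hM0 : ∀ w ∈ U, M w ≠ 0 := fun w hw => by
    have h1 := Complex.slitPlane_ne_zero hw.1
    have h2 := Complex.slitPlane_ne_zero hw.2
    simp [hM, Complex.cpow_eq_zero_iff, h1, h2]
  have hMd : DifferentiableOn ℂ M U := fun w hw =>
    (hM' w hw).differentiableAt.differentiableWithinAt
  obtain ⟨Γ, hΓ, hΓ'⟩ := exists_euler_solution (ω := fun w => R w / (M w * (w - a'))) hb hU hs
    ((hR.mono fun w hw => ne_of_mem_raySlit hw.1).div (hMd.mul (by fun_prop)) fun w hw =>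
      mul_ne_zero (hM0 w hw) (sub_ne_zero.2 (ne_of_mem_raySlit hw.2)))
  refine ⟨fun w => Γ w * M w, hΓ.mul hMd, fun w hw => ?_⟩
  have d := ((hΓ.differentiableAt (hU.mem_nhds hw)).hasDerivAt.fun_mul (hM' w hw)).deriv
  have h1 : w - r ≠ 0 := sub_ne_zero.2 (ne_of_mem_raySlit hw.1)
  have h2 : w - a' ≠ 0 := sub_ne_zero.2 (ne_of_mem_raySlit hw.2)
  have h3 := hM0 w hw
  have key := hΓ' w hw
  rw [d]
  field_simp at key ⊢
  linear_combination (w - r) * key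

end SlitDomain


/-! ### From a vanishing Pochhammer integral to a vanishing segment integral -/

theorem hasDerivAt_ofReal_cpow {b : ℂ} (hb : b + 1 ≠ 0) {x : ℝ} (hx : x ≠ 0) :
    HasDerivAt (fun y : ℝ => (y : ℂ) ^ (b + 1)) ((b + 1) * (x : ℂ) ^ b) x := by
  simpa using hasDerivAt_ofReal_cpow_const hx hb

theorem hasDerivAt_one_sub_ofReal_cpow {e : ℂ} (he : e + 1 ≠ 0) {x : ℝ} (hx : 1 - x ≠ 0) :
    HasDerivAt (fun y : ℝ => (1 - (y : ℂ)) ^ (e + 1)) (-((e + 1) * (1 - (x : ℂ)) ^ e)) x := by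
  have := (hasDerivAt_ofReal_cpow he hx).comp_const_sub 1 x
  simpa using this

theorem continuous_one_sub_ofReal_cpow {e : ℂ} (he : 0 < e.re) :
    Continuous (fun y : ℝ => (1 - (y : ℂ)) ^ e) := by
  have := (Complex.continuous_ofReal_cpow_const he).comp (continuous_const.sub continuous_id : Continuous fun y : ℝ => 1 - y)
  simpa [Function.comp_def] using this

/-- The two regular solutions at the ends of a Pochhammer contour agree at the base point if the
contour integral vanishes. -/
theorem IsClosedContour.eq_of_weightInt_eq_zero {p r : ℂ} {c L₀ L₁ : ℝ → ℂ} {D : Set ℂ}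
    {L : ℂ × ℝ → ℂ} (H : IsClosedContour p r c D L₀ L₁ L) {z : ℂ} (hz : z ∈ D) {b k e o : ℂ}
    {R g₁ g₂ g₁' g₂' : ℂ → ℂ} {U₁ U₂ : Set ℂ} (hR : ContinuousOn R {r}ᶜ)
    (h0 : c 0 = o) (h1 : c (1 / 8) = o) (h2 : c (1 / 4) = o) (h3 : c (1 / 2) = o) (h4 : c 1 = o)
    (hA : ∀ s ∈ Icc (0 : ℝ) (1 / 8), c s ∈ U₂) (hB : ∀ s ∈ Icc (1 / 8 : ℝ) (1 / 4), c s ∈ U₁)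
    (hA' : ∀ s ∈ Icc (1 / 4 : ℝ) (1 / 2), c s ∈ U₂) (hB' : ∀ s ∈ Icc (1 / 2 : ℝ) 1, c s ∈ U₁)
    (hL₀ : L₀ (1 / 8) = L₀ 0 ∧ L₀ (1 / 4) = L₀ 0 + 2 * Real.pi * Complex.I ∧
      L₀ (1 / 2) = L₀ 0 + 2 * Real.pi * Complex.I)
    (hL₁ : L₁ (1 / 8) = L₁ 0 ∧ L₁ (1 / 4) = L₁ 0 ∧ L₁ (1 / 2) = L₁ 0)
    (hL : L (z, 1 / 8) = L (z, 0) + 2 * Real.pi * Complex.I ∧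
      L (z, 1 / 4) = L (z, 0) + 2 * Real.pi * Complex.I ∧ L (z, 1 / 2) = L (z, 0))
    (hg₁ : ∀ w ∈ U₁, HasDerivAt g₁ (g₁' w) w) (hg₂ : ∀ w ∈ U₂, HasDerivAt g₂ (g₂' w) w)
    (hR₁ : ∀ w ∈ U₁, w ≠ p → w ≠ r → w ≠ z →
      (b / (w - p) + k / (w - r) - e / (z - w)) * g₁ w + g₁' w = R w)
    (hR₂ : ∀ w ∈ U₂, w ≠ p → w ≠ r → w ≠ z →
      (b / (w - p) + k / (w - r) - e / (z - w)) * g₂ w + g₂' w = R w)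
    (hb : Complex.exp (b * (2 * Real.pi * Complex.I)) ≠ 1)
    (he : Complex.exp (e * (2 * Real.pi * Complex.I)) ≠ 1)
    (hJ : weightInt c L₀ L₁ L b k e R z = 0) : g₁ o = g₂ o := by
  have np : ∀ s ∈ Icc (0 : ℝ) 1, c s ≠ p := fun s hs => _root_.sub_ne_zero.1 (H.sub_ne_zero₀ hs)
  have nr : ∀ s ∈ Icc (0 : ℝ) 1, c s ≠ r := fun s hs => _root_.sub_ne_zero.1 (H.sub_ne_zero₁ hs)
  have nz : ∀ s ∈ Icc (0 : ℝ) 1, c s ≠ z := fun s hs =>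
    (_root_.sub_ne_zero.1 (H.sub_ne_zero hz hs)).symm
  have hRc : ContinuousOn (fun s => R (c s)) (Icc 0 1) :=
    hR.comp H.continuous.continuousOn fun s hs => nr s hs
  have hint := H.intervalIntegrable hz b k e hRc
  have hsub : ∀ {a a' : ℝ}, 0 ≤ a → a ≤ a' → a' ≤ 1 → uIcc a a' ⊆ uIcc (0 : ℝ) 1 := by
    intro a a' h0 h1 h2
    rw [uIcc_of_le h1, uIcc_of_le zero_le_one]
    exact Icc_subset_Icc h0 h2
  have I1 := hint.mono_set (hsub (a := 0) (a' := 1 / 8) (by norm_num) (by norm_num) (by norm_num))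
  have I2 := hint.mono_set (hsub (a := 1 / 8) (a' := 1 / 4) (by norm_num) (by norm_num) (by norm_num))
  have I3 := hint.mono_set (hsub (a := 1 / 4) (a' := 1 / 2) (by norm_num) (by norm_num) (by norm_num))
  have I4 := hint.mono_set (hsub (a := 1 / 2) (a' := 1) (by norm_num) (by norm_num) (by norm_num))
  have piece : ∀ {a a' : ℝ} {g g' : ℂ → ℂ} {U : Set ℂ}, 0 ≤ a → a ≤ a' → a' ≤ 1 →
      (∀ s ∈ Icc a a', c s ∈ U) → (∀ w ∈ U, HasDerivAt g (g' w) w) →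
      (∀ w ∈ U, w ≠ p → w ≠ r → w ≠ z →
        (b / (w - p) + k / (w - r) - e / (z - w)) * g w + g' w = R w) → _ :=
    fun {a a' g g' U} h0 h1 h2 hU hg hRg => H.integral_deriv_eq_sub hz (b₀ := b) (b₁ := k) (e := e)
      (f := R) (g := g) (g' := g') h0 h1 h2 (hRc.mono (Icc_subset_Icc h0 h2))
      (fun s hs => hg _ (hU s hs)) (fun s hs =>
        have hs' := Icc_subset_Icc h0 h2 hs
        hRg _ (hU s hs) (np s hs') (nr s hs') (nz s hs'))
  -- On the loops around `z` the primitive regular at `z` is used, on the loops around `p` the one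
  -- regular at `p`; both are single-valued along their loops, so only the weight has monodromy.
  rw [weightInt, ← intervalIntegral.integral_add_adjacent_intervals ((I1.trans I2).trans I3) I4,
    ← intervalIntegral.integral_add_adjacent_intervals (I1.trans I2) I3,
    ← intervalIntegral.integral_add_adjacent_intervals I1 I2,
    piece (by norm_num) (by norm_num) (by norm_num) hA hg₂ hR₂,
    piece (by norm_num) (by norm_num) (by norm_num) hB hg₁ hR₁,
    piece (by norm_num) (by norm_num) (by norm_num) hA' hg₂ hR₂,
    piece (by norm_num) (by norm_num) (by norm_num) hB' hg₁ hR₁,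
    h0, h1, h2, h3, h4, H.closed₀, H.closed₁, H.closed z hz, hL₀.1, hL₀.2.1, hL₀.2.2, hL₁.1,
    hL₁.2.1, hL₁.2.2, hL.1, hL.2.1, hL.2.2] at hJ
  simp only [mul_add, Complex.exp_add] at hJ hb he
  set μ := Complex.exp (b * (2 * Real.pi * Complex.I)) with hμ
  set ν := Complex.exp (e * (2 * Real.pi * Complex.I)) with hν
  -- The eight boundary terms, all at `o`, collect into the factor `(ν-1)(μ-1)`, with `μ` and `ν`
  -- the monodromies at `p` and at `z`.
  have key : Complex.exp (b * L₀ 0) * Complex.exp (k * L₁ 0) * Complex.exp (e * L (z, 0)) * (ν - 1)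
      * (μ - 1) * (g₁ o - g₂ o) = 0 := by linear_combination hJ
  simpa [Complex.exp_ne_zero, _root_.sub_ne_zero.2 hb, _root_.sub_ne_zero.2 he,
    _root_.sub_eq_zero] using key

theorem mem_raySlit_of_eq_add_mul {p z : ℂ} (h : p ≠ z) {x : ℝ} (hx : 0 < x) :
    p + x * (z - p) ∈ raySlit z p := by
  show (p + x * (z - p) - p) / (z - p) ∈ Complex.slitPlane
  have : z - p ≠ 0 := sub_ne_zero.2 h.symm
  rw [add_sub_cancel_left, mul_div_cancel_right₀ _ this]
  exact Complex.ofReal_mem_slitPlane.2 hx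

theorem mem_raySlit_of_eq_add_mul' {p z : ℂ} (h : p ≠ z) {x : ℝ} (hx : x < 1) :
    p + x * (z - p) ∈ raySlit p z := by
  have := mem_raySlit_of_eq_add_mul h.symm (sub_pos.2 hx)
  convert this using 1
  push_cast
  ring

theorem add_mul_mem_segment {p z : ℂ} {x y : ℝ} {t : ℝ} (hxt : x ≤ t) (hty : t ≤ y) :
    p + t * (z - p) ∈ segment ℝ (p + x * (z - p)) (p + y * (z - p)) := by
  rcases (hxt.trans hty).eq_or_lt with h | h
  · obtain rfl : t = x := le_antisymm (h ▸ hty) hxt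
    exact left_mem_segment _ _ _
  · have h0 : y - x ≠ 0 := by linarith
    refine ⟨(y - t) / (y - x), (t - x) / (y - x), div_nonneg (by linarith) (by linarith),
      div_nonneg (by linarith) (by linarith), by field_simp; ring, ?_⟩
    have h0' : (y : ℂ) - x ≠ 0 := by exact_mod_cast h0
    simp only [Complex.real_smul]
    push_cast
    field_simp
    ring

/-- The two primitives integrate the form over `[0, x₀]` and `[x₀, 1]`. Their boundary terms cancel
at `x₀` by `hG` and vanish at the ends because `b + 1` and `e + 1` have positive real part. -/
theorem integral_segment_eq_zero {p r z b k e : ℂ} (hpz : p ≠ z) (hr : r ∉ segment ℝ p z)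
    (hb : 0 < b.re) (he : 0 < e.re) {R G₁ G₂ : ℂ → ℂ} (hR : ContinuousOn R {r}ᶜ)
    (hG₁ : DifferentiableOn ℂ G₁ (raySlit p r ∩ raySlit p z))
    (hG₂ : DifferentiableOn ℂ G₂ (raySlit z r ∩ raySlit z p))
    (hR₁ : ∀ w ∈ raySlit p r ∩ raySlit p z, (w - p) * (w - z) * deriv G₁ w
      + ((b + 1) * (w - z) + (e + 1) * (w - p) + k * (w - p) * (w - z) / (w - r)) * G₁ w = R w)
    (hR₂ : ∀ w ∈ raySlit z r ∩ raySlit z p, (w - p) * (w - z) * deriv G₂ w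
      + ((b + 1) * (w - z) + (e + 1) * (w - p) + k * (w - p) * (w - z) / (w - r)) * G₂ w = R w)
    {x₀ : ℝ} (h0 : 0 < x₀) (h1 : x₀ < 1) (hG : G₁ (p + x₀ * (z - p)) = G₂ (p + x₀ * (z - p))) :
    ∫ x in (0 : ℝ)..1, ((x : ℂ) ^ b * (1 - (x : ℂ)) ^ e) * ((((p + x * (z - p)) - r) / (p - r)) ^ k
      * R (p + x * (z - p))) = 0 := by
  have hb1 : 0 < (b + 1).re := by simp; linarith
  have he1 : 0 < (e + 1).re := by simp; linarith
  have hb10 : b + 1 ≠ 0 := fun h => by simp [h] at hb1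
  have he10 : e + 1 ≠ 0 := fun h => by simp [h] at he1
  have hℓ : z - p ≠ 0 := sub_ne_zero.2 hpz.symm
  set W : ℝ → ℂ := fun x => p + x * (z - p) with hW
  have hWc : Continuous W := by fun_prop
  have hWd : ∀ x, HasDerivAt W (z - p) x := fun x => by
    have h : HasDerivAt (fun x : ℝ => (x : ℂ) * (z - p)) (z - p) x := by
      simpa using (Complex.ofRealCLM.hasDerivAt (x := x)).mul_const (z - p)
    exact h.const_add p
  have mem : ∀ x ∈ Icc (0 : ℝ) 1, W x ∈ segment ℝ p z := fun x hx => by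
    simpa using add_mul_mem_segment (p := p) (z := z) hx.1 hx.2
  have mpr : ∀ x ∈ Icc (0 : ℝ) 1, W x ∈ raySlit p r := fun x hx =>
    mem_raySlit_of_notMem_segment fun h => hr
      ((convex_segment p z).segment_subset (mem x hx) (left_mem_segment ℝ p z) h)
  have mzr : ∀ x ∈ Icc (0 : ℝ) 1, W x ∈ raySlit z r := fun x hx =>
    mem_raySlit_of_notMem_segment fun h => hr
      ((convex_segment p z).segment_subset (mem x hx) (right_mem_segment ℝ p z) h)
  set A : ℝ → ℂ := fun x => ((W x - r) / (p - r)) ^ k with hA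
  have hAd : ∀ x ∈ Icc (0 : ℝ) 1, HasDerivAt A ((z - p) * (A x * (k / (W x - r)))) x :=
    fun x hx => (hasDerivAt_raySlit_cpow k (mpr x hx)).scomp x (hWd x)
  have hAc : ContinuousOn A (Icc 0 1) := fun x hx => (hAd x hx).continuousAt.continuousWithinAt
  have hRc : ContinuousOn (fun x => R (W x)) (Icc 0 1) :=
    hR.comp hWc.continuousOn fun x hx => ne_of_mem_raySlit (mpr x hx)
  have hbc := Complex.continuous_ofReal_cpow_const hb1
  have hec := continuous_one_sub_ofReal_cpow he1
  have hfc : ContinuousOn (fun x : ℝ => ((x : ℂ) ^ b * (1 - (x : ℂ)) ^ e) * (A x * R (W x)))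
      (Icc 0 1) :=
    ((Complex.continuous_ofReal_cpow_const hb).mul
      (continuous_one_sub_ofReal_cpow he)).continuousOn.mul (hAc.mul hRc)
  have piece : ∀ {G : ℂ → ℂ} {U : Set ℂ} {a a' : ℝ}, IsOpen U → DifferentiableOn ℂ G U →
      (∀ w ∈ U, (w - p) * (w - z) * deriv G w + ((b + 1) * (w - z) + (e + 1) * (w - p)
        + k * (w - p) * (w - z) / (w - r)) * G w = R w) → 0 ≤ a → a ≤ a' → a' ≤ 1 →
      (∀ x ∈ Icc a a', W x ∈ U) →
      ∫ x in a..a', ((x : ℂ) ^ b * (1 - (x : ℂ)) ^ e) * (A x * R (W x)) =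
        -(z - p) * ((a' : ℂ) ^ (b + 1) * (1 - (a' : ℂ)) ^ (e + 1) * (A a' * G (W a')))
          - -(z - p) * ((a : ℂ) ^ (b + 1) * (1 - (a : ℂ)) ^ (e + 1) * (A a * G (W a))) := by
    intro G U a a' hU hG hRG ha haa ha' hmem
    have hsub : Icc a a' ⊆ Icc (0 : ℝ) 1 := Icc_subset_Icc ha ha'
    have hGc : ContinuousOn (fun x => G (W x)) (Icc a a') :=
      hG.continuousOn.comp hWc.continuousOn hmem
    refine intervalIntegral.integral_eq_sub_of_hasDerivAt_of_le haa
      (f := fun x : ℝ => -(z - p) * ((x : ℂ) ^ (b + 1) * (1 - (x : ℂ)) ^ (e + 1) * (A x * G (W x))))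
      (continuousOn_const.mul ((hbc.mul hec).continuousOn.mul ((hAc.mono hsub).mul hGc)))
      (fun x hx => ?_) ((hfc.mono hsub).intervalIntegrable_of_Icc haa)
    have hx' := Ioo_subset_Icc_self hx
    have hx0 : x ≠ 0 := (ha.trans_lt hx.1).ne'
    have hx1 : 1 - x ≠ 0 := by have := hx.2; intro h; linarith
    have hxc : (x : ℂ) ≠ 0 := by exact_mod_cast hx0
    have hxc1 : 1 - (x : ℂ) ≠ 0 := by exact_mod_cast hx1
    have dG : HasDerivAt (fun x => G (W x)) ((z - p) * deriv G (W x)) x :=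
      ((hG.differentiableAt (hU.mem_nhds (hmem x hx'))).hasDerivAt).scomp x (hWd x)
    have key := hRG _ (hmem x hx')
    have hne : W x - r ≠ 0 := sub_ne_zero.2 (ne_of_mem_raySlit (mpr x (hsub hx')))
    refine ((((hasDerivAt_ofReal_cpow hb10 hx0).fun_mul
      (hasDerivAt_one_sub_ofReal_cpow he10 hx1)).fun_mul ((hAd x (hsub hx')).fun_mul dG)).const_mul
      (-(z - p))).congr_deriv ?_
    rw [← key, Complex.cpow_add _ _ hxc, Complex.cpow_add _ _ hxc1, Complex.cpow_one,
      Complex.cpow_one]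
    have e1 : W x - p = x * (z - p) := by simp [hW]
    have e2 : W x - z = -((1 - x) * (z - p)) := by simp only [hW]; ring
    rw [e1, e2]
    field_simp
    ring
  have i1 := (hfc.mono (Icc_subset_Icc le_rfl h1.le)).intervalIntegrable_of_Icc (μ := volume) h0.le
  have i2 := (hfc.mono (Icc_subset_Icc h0.le le_rfl)).intervalIntegrable_of_Icc (μ := volume) h1.le
  show ∫ x in (0 : ℝ)..1, ((x : ℂ) ^ b * (1 - (x : ℂ)) ^ e) * (A x * R (W x)) = 0
  rw [← intervalIntegral.integral_add_adjacent_intervals i1 i2,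
    piece ((isOpen_raySlit p r).inter (isOpen_raySlit p z)) hG₁ hR₁ le_rfl h0.le h1.le (fun x hx =>
      ⟨mpr x ⟨hx.1, hx.2.trans h1.le⟩, mem_raySlit_of_eq_add_mul' hpz (hx.2.trans_lt h1)⟩),
    piece ((isOpen_raySlit z r).inter (isOpen_raySlit z p)) hG₂ hR₂ h0.le h1.le le_rfl (fun x hx =>
      ⟨mzr x ⟨h0.le.trans hx.1, hx.2⟩, mem_raySlit_of_eq_add_mul hpz (h0.trans_le hx.1)⟩)]
  simp only [hW] at hG ⊢
  rw [hG]
  simp [Complex.zero_cpow hb10, Complex.zero_cpow he10]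


/-! ### Logarithmic increments on circles and pieces of the commutator -/

section CircleIncrements

theorem norm_mul_exp_div {κ υ : ℂ} (s : ℝ) :
    ‖υ * Complex.exp (2 * Real.pi * Complex.I * s) / κ‖ = ‖υ‖ / ‖κ‖ := by
  have : 2 * Real.pi * Complex.I * s = ((2 * Real.pi * s : ℝ) : ℂ) * Complex.I := by
    push_cast; ring
  rw [norm_div, norm_mul, this, Complex.norm_exp_ofReal_mul_I, mul_one]

/-- Factoring out the larger term leaves `1 + small`, which has a principal logarithm; here the
factor `κ` is constant and contributes nothing. In `hasLogIncr_of_lt_norm` it is the rotating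
factor, which contributes `2πi`. -/
theorem hasLogIncr_of_norm_lt {f : ℝ → ℂ} {κ υ : ℂ} (h : ‖υ‖ < ‖κ‖)
    (hf : ∀ s ∈ Icc (0 : ℝ) 1, f s = κ + υ * Complex.exp (2 * Real.pi * Complex.I * s)) :
    HasLogIncr f 0 := by
  have hκ : κ ≠ 0 := norm_pos_iff.1 ((norm_nonneg _).trans_lt h)
  have hslit : ∀ s : ℝ, 1 + υ * Complex.exp (2 * Real.pi * Complex.I * s) / κ ∈ Complex.slitPlane :=
    fun s => Complex.mem_slitPlane_of_norm_lt_one (by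
      rw [norm_mul_exp_div]; exact (div_lt_one ((norm_nonneg _).trans_lt h)).2 h)
  have hb : IsLogBranch (Icc (0 : ℝ) 1) f (fun s => Complex.log κ
      + Complex.log (1 + υ * Complex.exp (2 * Real.pi * Complex.I * s) / κ)) := by
    refine ⟨Continuous.continuousOn (continuous_const.add (Continuous.clog (by fun_prop) hslit)),
      fun s hs => ?_⟩
    rw [Complex.exp_add, Complex.exp_log hκ, Complex.exp_log (Complex.slitPlane_ne_zero (hslit s)),
      hf s hs]
    field_simp
  have := hb.hasLogIncr
  convert this using 1
  simp [Complex.exp_two_pi_mul_I]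

theorem hasLogIncr_of_lt_norm {f : ℝ → ℂ} {κ υ : ℂ} (h : ‖κ‖ < ‖υ‖)
    (hf : ∀ s ∈ Icc (0 : ℝ) 1, f s = κ + υ * Complex.exp (2 * Real.pi * Complex.I * s)) :
    HasLogIncr f (2 * Real.pi * Complex.I) := by
  have hυ : υ ≠ 0 := norm_pos_iff.1 ((norm_nonneg _).trans_lt h)
  have hslit : ∀ s : ℝ, 1 + κ * Complex.exp (2 * Real.pi * Complex.I * (-s : ℝ)) / υ
      ∈ Complex.slitPlane :=
    fun s => Complex.mem_slitPlane_of_norm_lt_one (by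
      rw [norm_mul_exp_div]; exact (div_lt_one ((norm_nonneg _).trans_lt h)).2 h)
  have hb : IsLogBranch (Icc (0 : ℝ) 1) f (fun s => Complex.log υ + 2 * Real.pi * Complex.I * s
      + Complex.log (1 + κ * Complex.exp (2 * Real.pi * Complex.I * (-s : ℝ)) / υ)) := by
    refine ⟨Continuous.continuousOn (((by fun_prop : Continuous _)).add
      (Continuous.clog (by fun_prop) hslit)), fun s hs => ?_⟩
    have e : (2 * Real.pi * Complex.I * (-s : ℝ) : ℂ) = -(2 * Real.pi * Complex.I * s) := by
      push_cast; ring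
    rw [Complex.exp_add, Complex.exp_add, Complex.exp_log hυ,
      Complex.exp_log (Complex.slitPlane_ne_zero (hslit s)), hf s hs, e, Complex.exp_neg]
    have := Complex.exp_ne_zero (2 * Real.pi * Complex.I * s)
    field_simp
    ring
  have := hb.hasLogIncr
  convert this using 1
  simp [Complex.exp_neg, Complex.exp_two_pi_mul_I]

/-- The tail is run in both directions, so its contribution cancels. The branch `l` serves only to
give the tail a well-defined increment. -/
theorem HasLogIncr.loopAround {m : ℂ → ℂ} {o c u d : ℂ} {τ : Path o (c + u)} {l : ℝ → ℂ}
    (hl : IsLogBranch (Icc (0 : ℝ) 1) (fun s => m ((loopAround c u τ).extend s)) l)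
    (hd : HasLogIncr (fun s => m ((circlePath c u).extend s)) d) :
    HasLogIncr (fun s => m ((HeunApp.loopAround c u τ).extend s)) d := by
  have h1 : IsLogBranch (Icc (0 : ℝ) 1) (fun s => m (((τ.trans (circlePath c u)).trans
    τ.symm).extend s)) l := hl
  have hτ := (IsLogBranch.left (IsLogBranch.left h1)).hasLogIncr
  have h2 := (hτ.trans hd).trans hτ.symm
  intro l' hl'
  linear_combination h2 l' hl'

end CircleIncrements

section CommutatorPieces

variable {o : ℂ} {A B : Path o o}

theorem commutatorLoop_extend₁ {s : ℝ} (hs : s ≤ 1 / 8) :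
    (commutatorLoop A B).extend s = A.extend (8 * s) := by
  unfold commutatorLoop
  rw [Path.extend_trans_of_le_half _ _ (by linarith), Path.extend_trans_of_le_half _ _ (by linarith),
    Path.extend_trans_of_le_half _ _ (by linarith)]
  congr 1; ring

theorem commutatorLoop_extend₂ {s : ℝ} (hs : s ∈ Icc (1 / 8 : ℝ) (1 / 4)) :
    (commutatorLoop A B).extend s = B.extend (8 * s - 1) := by
  have := hs.1
  have := hs.2
  unfold commutatorLoop
  rw [Path.extend_trans_of_le_half _ _ (by linarith), Path.extend_trans_of_le_half _ _ (by linarith),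
    Path.extend_trans_of_half_le _ _ (by linarith)]
  congr 1; ring

theorem commutatorLoop_extend₃ {s : ℝ} (hs : s ∈ Icc (1 / 4 : ℝ) (1 / 2)) :
    (commutatorLoop A B).extend s = A.extend (2 - 4 * s) := by
  have := hs.1
  have := hs.2
  unfold commutatorLoop
  rw [Path.extend_trans_of_le_half _ _ (by linarith), Path.extend_trans_of_half_le _ _ (by linarith),
    Path.extend_symm_apply]
  congr 1; ring

theorem commutatorLoop_extend₄ {s : ℝ} (hs : 1 / 2 ≤ s) :
    (commutatorLoop A B).extend s = B.extend (2 - 2 * s) := by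
  unfold commutatorLoop
  rw [Path.extend_trans_of_half_le _ _ (by linarith), Path.extend_symm_apply]
  congr 1; ring

theorem loopAround_extend_mem {c u : ℂ} (τ : Path o (c + u)) (s : ℝ) :
    (loopAround c u τ).extend s ∈ range τ ∪ Metric.closedBall c ‖u‖ := by
  have h1 : (loopAround c u τ).extend s ∈ range (loopAround c u τ) := by
    rw [← Path.extend_range]; exact mem_range_self s
  unfold loopAround at h1
  rw [Path.trans_range, Path.trans_range, Path.symm_range] at h1
  rcases h1 with (h | ⟨x, hx⟩) | h
  · exact Or.inl h
  · refine Or.inr ?_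
    show ((τ.trans (circlePath c u)).trans τ.symm).extend s ∈ _
    rw [← hx]
    show c + u * Complex.exp (2 * Real.pi * Complex.I * ((x : ℝ) : ℂ)) ∈ _
    have := norm_mul_exp_div (κ := 1) (υ := u) x
    simp at this
    simp [dist_eq_norm, this]
  · exact Or.inl h

end CommutatorPieces

/-! ### Shifting the exponents of identically vanishing integrals -/

section Vanishing

/-- Euler's operator, conjugated by `(w - r)^k`. -/
noncomputable def eulerOp (p r k : ℂ) (R : ℂ → ℂ) (w : ℂ) : ℂ :=
  (w - p) * deriv R w + k * (w - p) / (w - r) * R w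

theorem differentiableOn_eulerOp {p r k : ℂ} {R : ℂ → ℂ} (hR : DifferentiableOn ℂ R {r}ᶜ) :
    DifferentiableOn ℂ (eulerOp p r k R) {r}ᶜ := by
  have h1 := hR.deriv isOpen_compl_singleton
  have h2 : DifferentiableOn ℂ (fun w => k * (w - p) / (w - r)) {r}ᶜ :=
    DifferentiableOn.div (by fun_prop) (by fun_prop) fun w hw => sub_ne_zero.2 hw
  exact ((by fun_prop : DifferentiableOn ℂ (fun w => w - p) {r}ᶜ).mul h1).add (h2.mul hR)

namespace IsClosedContour

variable {p r : ℂ} {c L₀ L₁ : ℝ → ℂ} {D : Set ℂ} {L : ℂ × ℝ → ℂ}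

theorem continuousOn_comp (H : IsClosedContour p r c D L₀ L₁ L) {R : ℂ → ℂ}
    (hR : ContinuousOn R {r}ᶜ) : ContinuousOn (fun s => R (c s)) (Icc 0 1) :=
  hR.comp H.continuous.continuousOn fun _ hs => _root_.sub_ne_zero.1 (H.sub_ne_zero₁ hs)

theorem weightInt_succ_left (H : IsClosedContour p r c D L₀ L₁ L) (b k e : ℂ) (R : ℂ → ℂ) (z : ℂ) :
    weightInt c L₀ L₁ L (b + 1) k e R z = weightInt c L₀ L₁ L b k e (fun w => (w - p) * R w) z := by
  unfold weightInt
  refine intervalIntegral.integral_congr fun s hs => ?_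
  rw [uIcc_of_le zero_le_one] at hs
  simp only [add_mul, one_mul, Complex.exp_add, H.branch₀.2 s hs]
  ring

theorem weightInt_sub_mul (H : IsClosedContour p r c D L₀ L₁ L) {z : ℂ} (hz : z ∈ D) (b k e : ℂ)
    {R : ℂ → ℂ} (hR : ContinuousOn R {r}ᶜ) :
    weightInt c L₀ L₁ L b k e (fun w => (w - p) * R w) z =
      (z - p) * weightInt c L₀ L₁ L b k e R z - weightInt c L₀ L₁ L b k (e + 1) R z := by
  have h1 : ContinuousOn (fun w => (w - p) * R w) {r}ᶜ := (by fun_prop : ContinuousOn _ _).mul hR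
  have h2 : ContinuousOn (fun w => (z - w) * R w) {r}ᶜ := (by fun_prop : ContinuousOn _ _).mul hR
  have := H.weightInt_add hz b k e (H.continuousOn_comp h1) (H.continuousOn_comp h2)
  rw [H.weightInt_exp_succ hz] at this
  rw [eq_sub_iff_add_eq, ← this, ← weightInt_const_mul]
  exact weightInt_congr _ _ _ fun s _ => by ring

/-- Integration by parts with the primitive `(w-p) R` against the exponent `e + 1`. -/
theorem weightInt_eulerOp (H : IsClosedContour p r c D L₀ L₁ L) {z : ℂ} (hz : z ∈ D) (b k e : ℂ)
    {R : ℂ → ℂ} (hR : DifferentiableOn ℂ R {r}ᶜ) :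
    (b + 1) * weightInt c L₀ L₁ L b k (e + 1) R z
      + weightInt c L₀ L₁ L b k (e + 1) (eulerOp p r k R) z =
      (e + 1) * weightInt c L₀ L₁ L b k e (fun w => (w - p) * R w) z := by
  have hE := differentiableOn_eulerOp (p := p) (k := k) hR
  have hRc := hR.continuousOn
  have hEc := hE.continuousOn
  have c1 : ContinuousOn (fun w => (b + 1) * R w) {r}ᶜ := continuousOn_const.mul hRc
  have c2 : ContinuousOn (fun w => (z - w) * ((b + 1) * R w + eulerOp p r k R w)) {r}ᶜ :=
    (by fun_prop : ContinuousOn _ _).mul (c1.add hEc)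
  have c3 : ContinuousOn (fun w => -(e + 1) * ((w - p) * R w)) {r}ᶜ :=
    continuousOn_const.mul ((by fun_prop : ContinuousOn _ _).mul hRc)
  have key : weightInt c L₀ L₁ L b k e (fun w => (z - w) * ((b + 1) * R w + eulerOp p r k R w)
      + -(e + 1) * ((w - p) * R w)) z = 0 := by
    refine H.weightInt_exact hz (g := fun w => (z - w) * (w - p) * R w)
      (g' := fun w => (-(w - p) + (z - w)) * R w + (z - w) * (w - p) * deriv R w)
      (H.continuousOn_comp (c2.add c3)) (fun s hs => ?_) (fun s hs => ?_)
    · have hne := H.sub_ne_zero₁ hs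
      have d := (hR.differentiableAt (isOpen_compl_singleton.mem_nhds
        (_root_.sub_ne_zero.1 hne : c s ≠ r))).hasDerivAt
      refine ((((hasDerivAt_id' _).const_sub z).fun_mul ((hasDerivAt_id' _).sub_const p)).fun_mul
        d).congr_deriv ?_
      ring
    · have n0 := H.sub_ne_zero₀ hs
      have n1 := H.sub_ne_zero₁ hs
      have n2 := H.sub_ne_zero hz hs
      simp only [eulerOp]
      field_simp
      ring
  rw [H.weightInt_add hz _ _ _ (H.continuousOn_comp c2) (H.continuousOn_comp c3),
    weightInt_const_mul, H.weightInt_exp_succ hz, H.weightInt_add hz _ _ _ (H.continuousOn_comp c1)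
    (H.continuousOn_comp hEc), weightInt_const_mul] at key
  linear_combination key

/-- All integrals with the exponent of `z - w` lowered by an integer vanish. -/
def _root_.HeunApp.Vanishes (c L₀ L₁ : ℝ → ℂ) (L : ℂ × ℝ → ℂ) (D : Set ℂ) (b k e : ℂ)
    (R : ℂ → ℂ) : Prop :=
  ∀ n : ℕ, ∀ z ∈ D, weightInt c L₀ L₁ L b k (e - n) R z = 0

/-- Each derivative in `z` lowers the exponent by one and produces the factor `e - n`, which is
non-zero. -/
theorem vanishes_of_forall (H : IsClosedContour p r c D L₀ L₁ L) {b k e : ℂ} {R : ℂ → ℂ}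
    (hR : ContinuousOn R {r}ᶜ) (he : ∀ n : ℕ, e ≠ n)
    (h : ∀ z ∈ D, weightInt c L₀ L₁ L b k e R z = 0) : Vanishes c L₀ L₁ L D b k e R := by
  intro n
  induction n with
  | zero => simpa using h
  | succ n ih =>
    intro z hz
    have d := H.hasDerivAt_weightInt hz b k (e - n) (H.continuousOn_comp hR)
    have d0 : HasDerivAt (weightInt c L₀ L₁ L b k (e - n) R) 0 z := by
      refine (hasDerivAt_const z (0 : ℂ)).congr_of_eventuallyEq ?_
      filter_upwards [H.isOpen.mem_nhds hz] with x hx using ih x hx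
    have := d.unique d0
    have e' : e - (n + 1 : ℕ) = e - n - 1 := by push_cast; ring
    rw [e']
    exact (mul_eq_zero.1 this).resolve_left (_root_.sub_ne_zero.2 (he n))

/-- Since `w - p = (z-p) - (z-w)`, raising `b` by one costs one unit of `e`. -/
theorem vanishes_succ_left (H : IsClosedContour p r c D L₀ L₁ L) {b k e : ℂ} {R : ℂ → ℂ}
    (hR : ContinuousOn R {r}ᶜ) (h : Vanishes c L₀ L₁ L D b k e R) :
    Vanishes c L₀ L₁ L D (b + 1) k (e - 1) R := by
  intro n z hz
  have h1 := h n z hz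
  have h2 := h (n + 1) z hz
  have e1 : e - (n + 1 : ℕ) = e - 1 - n := by push_cast; ring
  have e2 : e - n = e - 1 - n + 1 := by ring
  rw [e1] at h2
  rw [e2] at h1
  rw [H.weightInt_succ_left, H.weightInt_sub_mul hz _ _ _ hR, h1, h2]
  ring

theorem vanishes_add_left (H : IsClosedContour p r c D L₀ L₁ L) {b k e : ℂ} {R : ℂ → ℂ}
    (hR : ContinuousOn R {r}ᶜ) (h : Vanishes c L₀ L₁ L D b k e R) (N : ℕ) :
    Vanishes c L₀ L₁ L D (b + N) k (e - N) R := by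
  induction N with
  | zero => simpa using h
  | succ N ih =>
    have := H.vanishes_succ_left hR ih
    convert this using 1 <;> push_cast <;> ring

/-- The exponent `e` can be regained, with `b` unchanged, at the cost of an Euler operator on `R`.
Substituting `w - p = (z-p) - (z-w)` in `weightInt_eulerOp` leaves only integrals with exponent `e +
1`, and the constant `b + e + 2` collects their coefficients. -/
theorem vanishes_raise (H : IsClosedContour p r c D L₀ L₁ L) {b k e : ℂ} {R : ℂ → ℂ}
    (hR : DifferentiableOn ℂ R {r}ᶜ) (h : Vanishes c L₀ L₁ L D b k e R) :
    Vanishes c L₀ L₁ L D b k (e + 1) (fun w => eulerOp p r k R w + (b + e + 2) * R w) := by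
  have hE := (differentiableOn_eulerOp (p := p) (k := k) hR).continuousOn
  have hRc := hR.continuousOn
  have hRc' : ContinuousOn (fun w => (b + e + 2) * R w) {r}ᶜ := continuousOn_const.mul hRc
  intro n z hz
  rw [H.weightInt_add hz _ _ _ (H.continuousOn_comp hE) (H.continuousOn_comp hRc'),
    weightInt_const_mul]
  have key := H.weightInt_eulerOp hz b k (e - n) hR
  rw [H.weightInt_sub_mul hz _ _ _ hRc, h n z hz] at key
  have e1 : e - n + 1 = e + 1 - n := by ring
  rw [e1] at key
  -- The constant is the right one for `n = 0`; for larger `n` the integral of `R` vanishes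
  -- separately, so the constant is immaterial.
  rcases n with _ | n
  · simp only [Nat.cast_zero, sub_zero] at key ⊢
    linear_combination key
  · have h1 := h n z hz
    have e2 : e + 1 - (n + 1 : ℕ) = e - n := by push_cast; ring
    rw [e2] at key ⊢
    rw [h1] at key ⊢
    linear_combination key

end IsClosedContour

end Vanishing


/-! ### The contour along a segment -/

section Geometry

variable {p z₀ u u' o : ℂ}

theorem exists_ofReal_of_mem_segment {p z w : ℂ} (h : w ∈ segment ℝ p z) :
    ∃ x : ℝ, 0 ≤ x ∧ x ≤ 1 ∧ w = p + x * (z - p) := by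
  rw [segment_eq_image'] at h
  obtain ⟨x, hx, rfl⟩ := h
  exact ⟨x, hx.1, hx.2, by simp⟩

theorem exists_ofReal_of_mem_segment_add_mul {p ℓ : ℂ} {a b : ℝ} {w : ℂ}
    (h : w ∈ segment ℝ (p + a * ℓ) (p + b * ℓ)) :
    ∃ x : ℝ, min a b ≤ x ∧ x ≤ max a b ∧ w = p + x * ℓ := by
  obtain ⟨x, h0, h1, rfl⟩ := exists_ofReal_of_mem_segment h
  refine ⟨a + x * (b - a), ?_, ?_, by push_cast; ring⟩
  · rcases le_total a b with hab | hab
    · rw [min_eq_left hab]; nlinarith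
    · rw [min_eq_right hab]; nlinarith
  · rcases le_total a b with hab | hab
    · rw [max_eq_right hab]; nlinarith
    · rw [max_eq_left hab]; nlinarith

theorem norm_add_mul_sub {p ℓ : ℂ} (x y : ℝ) : ‖p + x * ℓ - (p + y * ℓ)‖ = |x - y| * ‖ℓ‖ := by
  rw [show p + x * ℓ - (p + y * ℓ) = ((x - y : ℝ) : ℂ) * ℓ by push_cast; ring, norm_mul,
    Complex.norm_real, Real.norm_eq_abs]

/-- Everything is measured by the affine parameter on the segment from `p` to `z₀`. For `z` on the
segment inside the disc around `z₀`, each loop stays in the domain, star-shaped about its own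
centre, on which the regular Fuchsian solution lives. -/
theorem exists_segment_geometry (hp : p = 0 ∨ p = 1) (ho : o ∈ segment ℝ p z₀)
    (hu : z₀ + u ∈ segment ℝ p z₀) (hu' : p + u' ∈ segment ℝ p z₀)
    (hadm : IsAdmissible p z₀ u u' (Path.segment o (z₀ + u)) (Path.segment o (p + u'))) :
    ∃ xo xu : ℝ, 0 < xo ∧ xo ≤ xu ∧ xu < 1 ∧ o = p + xo * (z₀ - p) ∧ 1 - p ∉ segment ℝ p z₀ ∧
      p ∉ Metric.closedBall z₀ ‖u‖ ∧ 1 - p ∉ Metric.closedBall z₀ ‖u‖ ∧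
      ∀ ρ : ℝ, xu < ρ → ρ < 1 → p + ρ * (z₀ - p) ∈ Metric.ball z₀ ‖u‖ ∧
        (∀ s, (loopAround z₀ u (Path.segment o (z₀ + u))).extend s ∈
          raySlit (p + ρ * (z₀ - p)) (1 - p) ∩ raySlit (p + ρ * (z₀ - p)) p) ∧
        (∀ s, (loopAround p u' (Path.segment o (p + u'))).extend s ∈
          raySlit p (1 - p) ∩ raySlit p (p + ρ * (z₀ - p))) := by
  have hpB : p ∉ Metric.closedBall z₀ ‖u‖ := by
    rcases hp with rfl | rfl
    exacts [hadm.zero_notMem, hadm.one_notMem]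
  have hrB : 1 - p ∉ Metric.closedBall z₀ ‖u‖ := by
    rcases hp with rfl | rfl
    · simpa using hadm.one_notMem
    · simpa using hadm.zero_notMem
  have avp : ∀ w ∈ segment ℝ o (z₀ + u), w ≠ p ∧ w ≠ 1 - p ∧ w ∉ Metric.ball z₀ ‖u‖ := by
    intro w hw
    rw [← Path.range_segment] at hw
    obtain ⟨s, rfl⟩ := hw
    have := hadm.avoid s
    rcases hp with rfl | rfl
    · exact ⟨this.1, by simpa using this.2.1, this.2.2⟩
    · exact ⟨this.2.1, by simpa using this.1, this.2.2⟩
  have avp' : ∀ w ∈ segment ℝ o (p + u'), w ≠ p ∧ w ≠ 1 - p ∧ w ∉ Metric.ball z₀ ‖u‖ := by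
    intro w hw
    rw [← Path.range_segment] at hw
    obtain ⟨s, rfl⟩ := hw
    have := hadm.avoid' s
    rcases hp with rfl | rfl
    · exact ⟨this.1, by simpa using this.2.1, this.2.2⟩
    · exact ⟨this.2.1, by simpa using this.1, this.2.2⟩
  have hℓ : z₀ - p ≠ 0 := fun h => hpB (by
    rw [← sub_eq_zero.1 h]; exact Metric.mem_closedBall_self (norm_nonneg _))
  have hℓn : 0 < ‖z₀ - p‖ := norm_pos_iff.2 hℓ
  obtain ⟨xo, ho0, ho1, rfl⟩ := exists_ofReal_of_mem_segment ho
  obtain ⟨xu, hu0, hu1, hue⟩ := exists_ofReal_of_mem_segment hu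
  obtain ⟨xv, hv0, hv1, hve⟩ := exists_ofReal_of_mem_segment hu'
  have eu : z₀ = p + (1 : ℝ) * (z₀ - p) := by push_cast; ring
  have ep : p = p + (0 : ℝ) * (z₀ - p) := by push_cast; ring
  have nu : ‖u‖ = (1 - xu) * ‖z₀ - p‖ := by
    have : u = p + xu * (z₀ - p) - (p + (1 : ℝ) * (z₀ - p)) := by
      rw [← hue]; push_cast; ring
    rw [this, norm_add_mul_sub, abs_sub_comm, abs_of_nonneg (by linarith)]
  have nv : ‖u'‖ = xv * ‖z₀ - p‖ := by
    have : u' = p + xv * (z₀ - p) - (p + (0 : ℝ) * (z₀ - p)) := by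
      rw [← hve]; push_cast; ring
    rw [this, norm_add_mul_sub, sub_zero, abs_of_nonneg hv0]
  have memBz : ∀ x : ℝ, x ≤ 1 → xu ≤ x → p + x * (z₀ - p) ∈ Metric.closedBall z₀ ‖u‖ := by
    intro x h1 h2
    rw [mem_closedBall_iff_norm, nu]
    nth_rewrite 2 [eu]
    rw [norm_add_mul_sub, abs_sub_comm, abs_of_nonneg (by linarith)]
    gcongr
  have memBz' : ∀ x : ℝ, x ≤ 1 → xu < x → p + x * (z₀ - p) ∈ Metric.ball z₀ ‖u‖ := by
    intro x h1 h2
    rw [mem_ball_iff_norm, nu]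
    nth_rewrite 2 [eu]
    rw [norm_add_mul_sub, abs_sub_comm, abs_of_nonneg (by linarith)]
    gcongr
  have memBp : ∀ x : ℝ, 0 ≤ x → x ≤ xv → p + x * (z₀ - p) ∈ Metric.closedBall p ‖u'‖ := by
    intro x h1 h2
    rw [mem_closedBall_iff_norm, nv, add_sub_cancel_left, norm_mul, Complex.norm_real,
      Real.norm_of_nonneg h1]
    gcongr
  have hxu1 : xu < 1 := by
    rcases hu1.lt_or_eq with h | h
    · exact h
    · exact absurd (norm_eq_zero.1 (by rw [nu, h]; ring)) hadm.u_ne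
  have hxv0 : 0 < xv := by
    rcases hv0.lt_or_eq with h | h
    · exact h
    · exact absurd (norm_eq_zero.1 (by rw [nv, ← h]; ring)) hadm.u'_ne
  have hxo0 : 0 < xo := by
    rcases ho0.lt_or_eq with h | h
    · exact h
    · exact absurd (by rw [← h]; simp) (avp _ (left_mem_segment _ _ _)).1
  have hxou : xo ≤ xu := by
    by_contra h
    exact (avp _ (left_mem_segment _ _ _)).2.2 (memBz' xo ho1 (not_le.1 h))
  have hxvu : xv ≤ xu := by
    by_contra h
    exact (avp' _ (right_mem_segment _ _ _)).2.2 (hve ▸ memBz' xv hv1 (not_le.1 h))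
  -- The two closed discs and the two tails cover the segment, and all four avoid `1 - p`.
  have hr : 1 - p ∉ segment ℝ p z₀ := by
    intro hmem
    obtain ⟨x, h0, h1, he⟩ := exists_ofReal_of_mem_segment hmem
    rcases le_total x xv with h | h
    · exact hadm.other_notMem (he ▸ memBp x h0 h)
    rcases le_total xu x with h' | h'
    · exact hrB (he ▸ memBz x h1 h')
    rcases le_total x xo with h'' | h''
    · refine (avp' _ ?_).2.1 he.symm
      rw [hve, segment_symm]
      exact add_mul_mem_segment h h''
    · refine (avp _ ?_).2.1 he.symm
      rw [hue]
      exact add_mul_mem_segment h'' h'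
  refine ⟨xo, xu, hxo0, hxou, hxu1, rfl, hr, hpB, hrB, fun ρ hρ hρ1 => ?_⟩
  have hρ0 : 0 < ρ := hu0.trans_lt hρ
  have hzB := memBz' ρ hρ1.le hρ
  set z := p + ρ * (z₀ - p) with hz
  have hzp : p ≠ z := by
    intro h
    rw [← h] at hzB
    exact hpB (Metric.ball_subset_closedBall hzB)
  have scale : ∀ x : ℝ, p + x * (z₀ - p) = p + ((x / ρ : ℝ) : ℂ) * (z - p) := by
    intro x
    have : (ρ : ℂ) ≠ 0 := by exact_mod_cast hρ0.ne'
    rw [hz]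
    push_cast
    field_simp
    ring
  have zseg : z ∈ segment ℝ p z₀ := by
    simpa using add_mul_mem_segment (p := p) (z := z₀) hρ0.le hρ1.le
  have wseg : ∀ x : ℝ, 0 ≤ x → x ≤ 1 → p + x * (z₀ - p) ∈ segment ℝ p z₀ := fun x h0 h1 => by
    simpa using add_mul_mem_segment (p := p) (z := z₀) h0 h1
  refine ⟨hzB, fun s => ?_, fun s => ?_⟩
  · rcases loopAround_extend_mem (Path.segment (p + xo * (z₀ - p)) (z₀ + u)) s with h | h
    · rw [Path.range_segment] at h
      obtain ⟨x, h0, h1, he⟩ := exists_ofReal_of_mem_segment_add_mul (a := xo) (b := xu)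
        (by rw [← hue]; exact h)
      rw [min_eq_left hxou] at h0
      rw [max_eq_right hxou] at h1
      rw [he]
      refine ⟨mem_raySlit_of_notMem_segment fun h => hr ?_, ?_⟩
      · exact (convex_segment p z₀).segment_subset (wseg x (by linarith) (by linarith)) zseg h
      · rw [scale]
        exact mem_raySlit_of_eq_add_mul hzp (div_pos (by linarith) hρ0)
    · have hzB' := Metric.ball_subset_closedBall hzB
      exact ⟨mem_raySlit_of_notMem_segment fun h' => hrB
          ((convex_closedBall z₀ ‖u‖).segment_subset h hzB' h'),
        mem_raySlit_of_notMem_segment fun h' => hpB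
          ((convex_closedBall z₀ ‖u‖).segment_subset h hzB' h')⟩
  · rcases loopAround_extend_mem (Path.segment (p + xo * (z₀ - p)) (p + u')) s with h | h
    · rw [Path.range_segment] at h
      obtain ⟨x, h0, h1, he⟩ := exists_ofReal_of_mem_segment_add_mul (a := xo) (b := xv)
        (by rw [← hve]; exact h)
      have h0' : 0 < x := (lt_min hxo0 hxv0).trans_le h0
      have h1' : x ≤ xu := h1.trans (max_le hxou hxvu)
      rw [he]
      refine ⟨mem_raySlit_of_notMem_segment fun h => hr ?_, ?_⟩
      · exact (convex_segment p z₀).segment_subset (wseg x (by linarith) (by linarith))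
          (left_mem_segment _ _ _) h
      · rw [scale]
        exact mem_raySlit_of_eq_add_mul' hzp ((div_lt_one hρ0).2 (by linarith))
    · have hpm := Metric.mem_closedBall_self (x := p) (norm_nonneg u')
      exact ⟨mem_raySlit_of_notMem_segment fun h' => hadm.other_notMem
          ((convex_closedBall p ‖u'‖).segment_subset h hpm h'),
        mem_raySlit_of_notMem_segment fun h' => disjoint_left.1 hadm.disj
          (Metric.ball_subset_closedBall hzB)
          ((convex_closedBall p ‖u'‖).segment_subset h hpm h')⟩

end Geometry

section Increments

variable {o z₀ u p u' : ℂ} {τ : Path o (z₀ + u)} {τ' : Path o (p + u')} {l : ℝ → ℂ}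

theorem commutator_values_of_circles {m : ℂ → ℂ} {d d' : ℂ}
    (hd : HasLogIncr (fun s => m ((circlePath z₀ u).extend s)) d)
    (hd' : HasLogIncr (fun s => m ((circlePath p u').extend s)) d')
    (h : IsLogBranch (Icc (0 : ℝ) 1) (fun s => m ((commutatorLoop (loopAround z₀ u τ)
      (loopAround p u' τ')).extend s)) l) :
    l (1 / 8) = l 0 + d ∧ l (1 / 4) = l 0 + d + d' ∧ l (1 / 2) = l 0 + d' ∧ l 1 = l 0 :=
  commutator_values (m := m)
    (HasLogIncr.loopAround (IsLogBranch.left (IsLogBranch.left (IsLogBranch.left h))) hd)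
    (HasLogIncr.loopAround (IsLogBranch.right (IsLogBranch.left (IsLogBranch.left h))) hd') h

theorem hasLogIncr_sub_of_notMem {c v a : ℂ} (h : a ∉ Metric.closedBall c ‖v‖) :
    HasLogIncr (fun s => (circlePath c v).extend s - a) 0 := by
  rw [mem_closedBall_iff_norm, not_le, norm_sub_rev] at h
  exact hasLogIncr_of_norm_lt h fun s hs => by rw [circlePath_extend c v hs]; ring

theorem hasLogIncr_sub_center {c v : ℂ} (h : v ≠ 0) :
    HasLogIncr (fun s => (circlePath c v).extend s - c) (2 * Real.pi * Complex.I) :=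
  hasLogIncr_of_lt_norm (κ := 0) (υ := v) (by simpa using h) fun s hs => by
    rw [circlePath_extend c v hs]; ring

theorem hasLogIncr_rsub_of_notMem {c v a : ℂ} (h : a ∉ Metric.closedBall c ‖v‖) :
    HasLogIncr (fun s => a - (circlePath c v).extend s) 0 := by
  rw [mem_closedBall_iff_norm, not_le] at h
  exact hasLogIncr_of_norm_lt (κ := a - c) (υ := -v) (by simpa using h) fun s hs => by
    rw [circlePath_extend c v hs]; ring

theorem hasLogIncr_rsub_of_mem {c v a : ℂ} (h : a ∈ Metric.ball c ‖v‖) :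
    HasLogIncr (fun s => a - (circlePath c v).extend s) (2 * Real.pi * Complex.I) := by
  rw [mem_ball_iff_norm] at h
  exact hasLogIncr_of_lt_norm (κ := a - c) (υ := -v) (by simpa using h) fun s hs => by
    rw [circlePath_extend c v hs]; ring

end Increments


/-! ### Beta moments -/

section Moments

theorem betaIntegral_ne_zero {u v : ℂ} (hu : 0 < u.re) (hv : 0 < v.re) :
    Complex.betaIntegral u v ≠ 0 := by
  intro h
  have := Complex.Gamma_mul_Gamma_eq_betaIntegral hu hv
  rw [h, mul_zero] at this
  exact mul_ne_zero (Complex.Gamma_ne_zero_of_re_pos hu) (Complex.Gamma_ne_zero_of_re_pos hv) this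

theorem integral_pow_mul_eq_betaIntegral {b e : ℂ} (hb : 0 < b.re) (n : ℕ) :
    ∫ x in (0 : ℝ)..1, (x : ℂ) ^ n * ((x : ℂ) ^ b * (1 - (x : ℂ)) ^ e) =
      Complex.betaIntegral (b + n + 1) (e + 1) := by
  rw [Complex.betaIntegral]
  refine intervalIntegral.integral_congr fun x _ => ?_
  have hb0 : b ≠ 0 := fun h => by simp [h] at hb
  have hbn : b + n ≠ 0 := fun h => by
    have := congrArg Complex.re h
    simp at this
    have h2 : (0 : ℝ) ≤ n := n.cast_nonneg
    linarith
  simp only [add_sub_cancel_right]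
  -- The addition rule for powers fails at base 0; there both sides vanish because `b` and `b + n`
  -- are non-zero.
  rcases eq_or_ne x 0 with rfl | hx
  · simp [Complex.zero_cpow hb0, Complex.zero_cpow hbn]
  · rw [Complex.cpow_add _ _ (by exact_mod_cast hx), Complex.cpow_natCast]
    ring

theorem continuousOn_betaKernel {b e : ℂ} (hb : 0 < b.re) (he : 0 < e.re) :
    ContinuousOn (fun x : ℝ => (x : ℂ) ^ b * (1 - (x : ℂ)) ^ e) (Icc 0 1) :=
  ((Complex.continuous_ofReal_cpow_const hb).mul (continuous_one_sub_ofReal_cpow he)).continuousOn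

end Moments

/-! ### Taylor coefficients along the segment -/

section RaySection

variable {p r ℓ : ℂ}

/-- The restriction of `(w - r)^k R(w)` to the line through `p` in direction `ℓ`. -/
noncomputable def lineSection (p r ℓ k : ℂ) (R : ℂ → ℂ) (y : ℂ) : ℂ :=
  ((p + y * ℓ - r) / (p - r)) ^ k * R (p + y * ℓ)

theorem isOpen_preimage_raySlit : IsOpen ((fun y => p + y * ℓ) ⁻¹' raySlit p r) :=
  (isOpen_raySlit p r).preimage (by fun_prop)

theorem starConvex_preimage_raySlit (h : p ≠ r) :
    StarConvex ℝ 0 ((fun y => p + y * ℓ) ⁻¹' raySlit p r) := by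
  intro y hy a b ha hb hab
  have := starConvex_raySlit h hy ha hb hab
  show p + (a • (0 : ℂ) + b • y) * ℓ ∈ raySlit p r
  have hab' : (a : ℂ) + b = 1 := by exact_mod_cast hab
  convert this using 1
  simp only [Complex.real_smul]
  linear_combination -p * hab'

theorem zero_mem_preimage_raySlit (h : p ≠ r) : (0 : ℂ) ∈ (fun y => p + y * ℓ) ⁻¹' raySlit p r := by
  show p + 0 * ℓ ∈ raySlit p r
  simpa using self_mem_raySlit h

theorem hasDerivAt_lineSection {k : ℂ} {R : ℂ → ℂ} (hR : DifferentiableOn ℂ R {r}ᶜ) {y : ℂ}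
    (hy : p + y * ℓ ∈ raySlit p r) :
    HasDerivAt (lineSection p r ℓ k R) (((p + y * ℓ - r) / (p - r)) ^ k *
      (k / (p + y * ℓ - r) * R (p + y * ℓ) + deriv R (p + y * ℓ)) * ℓ) y := by
  have d0 : HasDerivAt (fun y => p + y * ℓ) ℓ y := by
    simpa using ((hasDerivAt_id' y).mul_const ℓ).const_add p
  have d1 := hasDerivAt_raySlit_cpow k hy
  have d2 := (hR.differentiableAt (isOpen_compl_singleton.mem_nhds
    (ne_of_mem_raySlit hy : p + y * ℓ ≠ r))).hasDerivAt
  refine ((d1.fun_mul d2).comp y d0).congr_deriv ?_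
  ring

theorem differentiableOn_lineSection {k : ℂ} {R : ℂ → ℂ} (hR : DifferentiableOn ℂ R {r}ᶜ) :
    DifferentiableOn ℂ (lineSection p r ℓ k R) ((fun y => p + y * ℓ) ⁻¹' raySlit p r) :=
  fun _ hy => (hasDerivAt_lineSection hR hy).differentiableAt.differentiableWithinAt

theorem analyticAt_lineSection (h : p ≠ r) {k : ℂ} {R : ℂ → ℂ} (hR : DifferentiableOn ℂ R {r}ᶜ) :
    AnalyticAt ℂ (lineSection p r ℓ k R) 0 :=
  (differentiableOn_lineSection hR).analyticAt
    (isOpen_preimage_raySlit.mem_nhds (zero_mem_preimage_raySlit h))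

theorem lineSection_eulerOp {k κ : ℂ} {R : ℂ → ℂ} (hR : DifferentiableOn ℂ R {r}ᶜ)
    {y : ℂ} (hy : p + y * ℓ ∈ raySlit p r) :
    lineSection p r ℓ k (fun w => eulerOp p r k R w + κ * R w) y =
      y * deriv (lineSection p r ℓ k R) y + κ * lineSection p r ℓ k R y := by
  rw [(hasDerivAt_lineSection hR hy).deriv]
  simp only [lineSection, eulerOp]
  ring

theorem eventually_natCast_add_ne_zero (κ : ℂ) : ∀ᶠ n : ℕ in atTop, (n : ℂ) + κ ≠ 0 := by
  by_cases h : ∃ m : ℕ, (m : ℂ) + κ = 0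
  · obtain ⟨m, hm⟩ := h
    filter_upwards [eventually_gt_atTop m] with n hn h'
    have : (n : ℂ) = m := by linear_combination h' - hm
    exact hn.ne' (by exact_mod_cast this)
  · push Not at h
    exact Eventually.of_forall h

/-- Only finitely many Taylor coefficients of the section are non-zero. -/
def TaylorFinite (p r ℓ k : ℂ) (R : ℂ → ℂ) : Prop :=
  ∃ a, HasTaylor (lineSection p r ℓ k R) a ∧ ∀ᶠ n in atTop, a n = 0

/-- On the line the Euler operator is `y d/dy`, so the `n`-th coefficient is multiplied by `n + κ`,
which vanishes for at most one `n`. Finiteness is the property that survives this loss, unlike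
vanishing. -/
theorem TaylorFinite.of_eulerOp (h : p ≠ r) {k κ : ℂ} {R : ℂ → ℂ} (hR : DifferentiableOn ℂ R {r}ᶜ)
    (hT : TaylorFinite p r ℓ k (fun w => eulerOp p r k R w + κ * R w)) :
    TaylorFinite p r ℓ k R := by
  obtain ⟨a, ha, ha0⟩ := hT
  have hc := HasTaylor.of_analyticAt (analyticAt_lineSection (ℓ := ℓ) (k := k) h hR)
  refine ⟨_, hc, ?_⟩
  set c := fun n => iteratedDeriv n (lineSection p r ℓ k R) 0 / (n.factorial : ℂ) with hcdef
  have h1 := (hc.deriv.id_mul.add (hc.const_mul κ)).congr (g := lineSection p r ℓ k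
    (fun w => eulerOp p r k R w + κ * R w)) (by
      filter_upwards [isOpen_preimage_raySlit.mem_nhds (zero_mem_preimage_raySlit (ℓ := ℓ) h)]
        with y hy using (lineSection_eulerOp hR hy).symm)
  have h2 := ha.unique h1
  filter_upwards [ha0, eventually_natCast_add_ne_zero κ] with n hn hκ
  have h3 : a n = (n + κ) * c n := by
    rw [h2]
    rcases n with _ | n
    · simp
    · simp only [shiftSeq_succ]
      push_cast
      ring
  rw [h3] at hn
  exact (mul_eq_zero.1 hn).resolve_left hκ

/-- The integral is holomorphic in `ρ` on a star-shaped domain, so vanishing on a real interval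
gives vanishing identically. Its Taylor coefficients are Beta values times those of the section, and
Beta values are non-zero. -/
theorem taylorFinite_of_integral_eq_zero (h : p ≠ r) (hseg : r ∉ segment ℝ p (p + ℓ)) {b k e : ℂ}
    (hb : 0 < b.re) (he : 0 < e.re) {R : ℂ → ℂ} (hR : DifferentiableOn ℂ R {r}ᶜ) {x₁ : ℝ}
    (h0 : 0 < x₁) (h1 : x₁ < 1) (hI : ∀ ρ : ℝ, x₁ < ρ → ρ < 1 →
      starInt (fun x : ℝ => (x : ℂ) ^ b * (1 - (x : ℂ)) ^ e) 0 (lineSection p r ℓ k R) ρ = 0) :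
    TaylorFinite p r ℓ k R := by
  set S := (fun y => p + y * ℓ) ⁻¹' raySlit p r with hS
  have hSo : IsOpen S := isOpen_preimage_raySlit
  have hSs : StarConvex ℝ 0 S := starConvex_preimage_raySlit h
  have hS0 : (0 : ℂ) ∈ S := zero_mem_preimage_raySlit h
  have hk := continuousOn_betaKernel hb he
  have hc := HasTaylor.of_analyticAt (analyticAt_lineSection (ℓ := ℓ) (k := k) h hR)
  have hW := hasTaylor_starInt hk hSo hSs hS0 (differentiableOn_lineSection hR) hc
  have hWd := differentiableOn_starInt hk hSo hSs (differentiableOn_lineSection (k := k) hR)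
  set W := starInt (fun x : ℝ => (x : ℂ) ^ b * (1 - (x : ℂ)) ^ e) 0 (lineSection p r ℓ k R)
  set x₂ : ℝ := (x₁ + 1) / 2 with hx₂
  have hx₂S : (x₂ : ℂ) ∈ S := by
    refine mem_raySlit_of_notMem_segment fun hm => hseg ?_
    refine (convex_segment p (p + ℓ)).segment_subset ?_ (left_mem_segment _ _ _) hm
    have := add_mul_mem_segment (p := p) (z := p + ℓ) (x := 0) (y := 1) (t := x₂)
      (by linarith) (by linarith)
    simpa using this
  have hfreq : ∃ᶠ y in 𝓝[≠] (x₂ : ℂ), W y = 0 := by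
    have ht : Tendsto (fun x : ℝ => (x : ℂ)) (𝓝[≠] x₂) (𝓝[≠] (x₂ : ℂ)) := by
      refine tendsto_nhdsWithin_iff.2 ⟨Complex.continuous_ofReal.continuousAt.mono_left
        nhdsWithin_le_nhds, ?_⟩
      filter_upwards [self_mem_nhdsWithin] with x hx
      have hx' : x ≠ x₂ := hx
      show (x : ℂ) ≠ x₂
      exact_mod_cast hx'
    refine ht.frequently (Eventually.frequently ?_)
    filter_upwards [nhdsWithin_le_nhds (Ioo_mem_nhds (a := x₁) (b := 1) (x := x₂)
      (by linarith) (by linarith))] with x hx using hI x hx.1 hx.2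
  have hzero := (hWd.analyticOnNhd hSo).eqOn_zero_of_preconnected_of_frequently_eq_zero
    (hSs.isPathConnected hS0).isConnected.isPreconnected hx₂S hfreq
  have hW0 : HasTaylor W (fun _ => 0) := by
    refine HasTaylor.congr (f := fun _ => 0) ⟨analyticAt_const, fun n => by
      simp⟩ ?_
    filter_upwards [hSo.mem_nhds hS0] with y hy using (hzero hy).symm
  refine ⟨_, hc, Eventually.of_forall fun n => ?_⟩
  have := congrFun (hW.unique hW0) n
  simp only [integral_pow_mul_eq_betaIntegral hb n] at this
  refine (mul_eq_zero.1 this).resolve_left (betaIntegral_ne_zero ?_ ?_)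
  · have : (0 : ℝ) ≤ n := n.cast_nonneg
    simp
    linarith
  · simp
    linarith

end RaySection

/-! ### A non-integral power of a linear function is not rational -/

section PolynomialSection

open Polynomial

/-- The equation is the logarithmic derivative of `P = (1 + aX)^k H`. Comparing top coefficients
gives `k = deg P - deg H`. -/
theorem not_notInt_of_polynomial_ode {k a : ℂ} (ha : a ≠ 0) {H P : ℂ[X]} (hH : H ≠ 0) (hP : P ≠ 0)
    (h : (C a * X + 1) * derivative P * H = C (k * a) * P * H + (C a * X + 1) * P * derivative H) :
    ¬ NotInt k := by
  intro hk
  have hd : ∀ Q : ℂ[X], ((C a * X + 1) * derivative Q).natDegree ≤ Q.natDegree ∧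
      ((C a * X + 1) * derivative Q).coeff Q.natDegree = a * Q.natDegree * Q.leadingCoeff := by
    intro Q
    have hc : ∀ n, ((C a * X + 1) * derivative Q).coeff n =
        a * n * Q.coeff n + Q.coeff (n + 1) * (n + 1) := by
      intro n
      rw [add_mul, one_mul, mul_assoc, coeff_add, coeff_C_mul, coeff_derivative]
      rcases n with _ | n
      · simp
      · rw [coeff_X_mul, coeff_derivative]; push_cast; ring
    refine ⟨natDegree_le_iff_coeff_eq_zero.2 fun n hn => ?_, ?_⟩
    · rw [hc, coeff_eq_zero_of_natDegree_lt hn, coeff_eq_zero_of_natDegree_lt (by omega)]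
      ring
    · rw [hc, coeff_eq_zero_of_natDegree_lt (Nat.lt_succ_self Q.natDegree), leadingCoeff]
      ring
  have h' := congrArg (fun Q => Q.coeff (P.natDegree + H.natDegree)) h
  simp only [coeff_add] at h'
  rw [show (C a * X + 1) * P * derivative H = P * ((C a * X + 1) * derivative H) by ring, mul_assoc (C (k * a)),
    coeff_C_mul, coeff_mul_add_eq_of_natDegree_le (hd P).1 le_rfl,
    coeff_mul_add_eq_of_natDegree_le le_rfl (hd H).1, coeff_mul_add_eq_of_natDegree_le le_rfl le_rfl,
    (hd P).2, (hd H).2] at h'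
  have h1 : P.leadingCoeff ≠ 0 := leadingCoeff_ne_zero.2 hP
  have h2 : H.leadingCoeff ≠ 0 := leadingCoeff_ne_zero.2 hH
  have h3 : a * P.leadingCoeff * H.leadingCoeff * (k - ((P.natDegree : ℂ) - H.natDegree)) = 0 := by
    simp only [leadingCoeff] at h' ⊢
    linear_combination -h'
  have h4 := (mul_eq_zero.1 h3).resolve_left (mul_ne_zero (mul_ne_zero ha h1) h2)
  exact hk ((P.natDegree : ℤ) - H.natDegree) (by push_cast; linear_combination h4)

theorem not_taylorFinite_of_polynomial {p r ℓ k : ℂ} (h : p ≠ r) (hℓ : ℓ ≠ 0) (hk : NotInt k)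
    {Q : ℂ[X]} (hQ : Q ≠ 0) : ¬ TaylorFinite p r ℓ k (fun w => Q.eval w) := by
  rintro ⟨a, ha, ha0⟩
  obtain ⟨N, hN⟩ := eventually_atTop.1 ha0
  set P : ℂ[X] := ∑ n ∈ Finset.range N, C (a n) * X ^ n with hPdef
  have hP : HasTaylor (fun y => P.eval y) a := by
    refine ⟨?_, fun n => ?_⟩
    · exact (P.differentiable.differentiableOn (s := univ)).analyticAt univ_mem
    · have e : iteratedDeriv n (fun y => P.eval y) = fun y => (derivative^[n] P).eval y := by
        induction n with
        | zero => simp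
        | succ n ih =>
          rw [iteratedDeriv_succ, ih]
          ext y
          rw [Polynomial.deriv, Function.iterate_succ_apply']
      rw [e]
      simp only
      rw [← coeff_zero_eq_eval_zero, coeff_iterate_derivative, zero_add,
        Nat.descFactorial_self, nsmul_eq_mul]
      congr 1
      rw [hPdef, finsetSum_coeff]
      simp only [coeff_C_mul_X_pow]
      rw [Finset.sum_ite_eq]
      split_ifs with hn
      · rfl
      · exact (hN n (by simpa using hn)).symm
  have hev := ha.eventuallyEq hP
  set H : ℂ[X] := Q.comp (C p + X * C ℓ) with hHdef
  have hHev : ∀ y, H.eval y = Q.eval (p + y * ℓ) := fun y => by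
    rw [hHdef, eval_comp, eval_add, eval_mul, eval_C, eval_X, eval_C]
  have hH0 : H ≠ 0 := by
    intro h0
    refine hQ (Polynomial.funext fun w => ?_)
    have := hHev ((w - p) / ℓ)
    rw [h0, div_mul_cancel₀ _ hℓ] at this
    simpa using this.symm
  have hpr : p - r ≠ 0 := sub_ne_zero.2 h
  have hlam : ℓ / (p - r) ≠ 0 := div_ne_zero hℓ hpr
  have hS : ∀ᶠ y in 𝓝 (0 : ℂ), p + y * ℓ ∈ raySlit p r :=
    isOpen_preimage_raySlit.mem_nhds (zero_mem_preimage_raySlit h)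
  have hQd : DifferentiableOn ℂ (fun w => Q.eval w) {r}ᶜ := Q.differentiable.differentiableOn
  have eq_of_ev : ∀ A B : ℂ[X], (∀ᶠ y in 𝓝 (0 : ℂ), A.eval y = B.eval y) → A = B := by
    intro A B hAB
    refine Polynomial.eq_of_infinite_eval_eq A B ?_
    exact infinite_of_mem_nhds (0 : ℂ) hAB
  have hP0 : P ≠ 0 := by
    intro h0
    refine hH0 (eq_of_ev _ _ ?_)
    filter_upwards [hev, hS] with y hy hyS
    rw [h0] at hy
    simp only [eval_zero, lineSection] at hy
    rw [hHev, eval_zero]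
    refine (mul_eq_zero.1 hy).resolve_left ?_
    exact fun hh => Complex.slitPlane_ne_zero hyS ((Complex.cpow_eq_zero_iff _ _).1 hh).1
  refine not_notInt_of_polynomial_ode hlam hH0 hP0 (eq_of_ev _ _ ?_) hk
  have hd : ∀ᶠ y in 𝓝 (0 : ℂ), deriv (lineSection p r ℓ k (fun w => Q.eval w)) y =
      (derivative P).eval y := by
    filter_upwards [hev.eventuallyEq_nhds] with y hy
    rw [hy.deriv_eq, Polynomial.deriv]
  filter_upwards [hev, hd, hS] with y h1 h2 hyS
  rw [(hasDerivAt_lineSection hQd hyS).deriv, Polynomial.deriv] at h2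
  simp only [lineSection] at h1
  have hne : p + y * ℓ - r ≠ 0 := sub_ne_zero.2 (ne_of_mem_raySlit hyS)
  have hdH : (derivative H).eval y = ℓ * (derivative Q).eval (p + y * ℓ) := by
    rw [hHdef, derivative_comp, eval_mul, eval_comp, eval_add, eval_mul, eval_C, eval_X, eval_C]
    simp
  simp only [eval_add, eval_mul, eval_C, eval_X, eval_one, hHev, hdH, ← h1, ← h2]
  have hv : (ℓ / (p - r) * y + 1) * (ℓ * (k / (p + y * ℓ - r))) = k * (ℓ / (p - r)) := by
    rw [show ℓ / (p - r) * y + 1 = (p + y * ℓ - r) / (p - r) by field_simp; ring]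
    field_simp
  linear_combination ((p + y * ℓ - r) / (p - r)) ^ k * Q.eval (p + y * ℓ) ^ 2 * hv

end PolynomialSection


/-! ### Non-vanishing of the Pochhammer integrals -/

theorem NotInt.add_natCast {a : ℂ} (h : NotInt a) (n : ℕ) : NotInt (a + n) := fun m hm =>
  h (m - n) (by push_cast; linear_combination hm)

theorem NotInt.neg {a : ℂ} (h : NotInt a) : NotInt (-a) := fun m hm =>
  h (-m) (by push_cast; linear_combination -hm)

theorem NotInt.exp_ne_one {a : ℂ} (h : NotInt a) :
    Complex.exp (a * (2 * Real.pi * Complex.I)) ≠ 1 := by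
  rw [Ne, Complex.exp_eq_one_iff]
  rintro ⟨n, hn⟩
  exact h n (mul_right_cancel₀ Complex.two_pi_I_ne_zero hn)

theorem IsClosedContour.swap {a₀ a₁ : ℂ} {c L₀ L₁ : ℝ → ℂ} {D : Set ℂ} {L : ℂ × ℝ → ℂ}
    (H : IsClosedContour a₀ a₁ c D L₀ L₁ L) : IsClosedContour a₁ a₀ c D L₁ L₀ L :=
  ⟨H.continuous, H.exists_differentiableAt, H.exists_norm_deriv_le, H.isOpen, H.branch₁, H.branch₀,
    H.branch, H.closed₁, H.closed₀, H.closed, H.closed_curve⟩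

theorem weightInt_swap (c L₀ L₁ : ℝ → ℂ) (L : ℂ × ℝ → ℂ) (b₀ b₁ e : ℂ) (f : ℂ → ℂ) (z : ℂ) :
    weightInt c L₀ L₁ L b₀ b₁ e f z = weightInt c L₁ L₀ L b₁ b₀ e f z := by
  unfold weightInt
  congr 1
  ext s
  ring

section SegmentContour

variable {p z₀ u u' o : ℂ} {Lp Lr : ℝ → ℂ} {L : ℂ × ℝ → ℂ}

/-- The case of positive real parts. Vanishing on the contour makes the two regular primitives agree
at `o`; hence the segment integral from `p` to `z` vanishes for all `z` on part of the segment. -/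
theorem taylorFinite_of_weightInt_eq_zero (hp : p = 0 ∨ p = 1) (ho : o ∈ segment ℝ p z₀)
    (hu : z₀ + u ∈ segment ℝ p z₀) (hu' : p + u' ∈ segment ℝ p z₀)
    (hadm : IsAdmissible p z₀ u u' (Path.segment o (z₀ + u)) (Path.segment o (p + u')))
    (H : IsClosedContour p (1 - p) (commutatorLoop (loopAround z₀ u (Path.segment o (z₀ + u)))
      (loopAround p u' (Path.segment o (p + u')))).extend (Metric.ball z₀ ‖u‖) Lp Lr L)
    {b k e : ℂ} (hb : 0 < b.re) (he : 0 < e.re) (hbi : NotInt b) (hei : NotInt e) {R : ℂ → ℂ}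
    (hR : DifferentiableOn ℂ R {1 - p}ᶜ)
    (hV : ∀ z ∈ Metric.ball z₀ ‖u‖, weightInt (commutatorLoop (loopAround z₀ u (Path.segment o
      (z₀ + u))) (loopAround p u' (Path.segment o (p + u')))).extend Lp Lr L b k e R z = 0) :
    TaylorFinite p (1 - p) (z₀ - p) k R := by
  obtain ⟨xo, xu, hxo, hxou, hxu, hoe, hr, hpB, hrB, hgeom⟩ :=
    exists_segment_geometry hp ho hu hu' hadm
  have hpr : p ≠ 1 - p := by rcases hp with rfl | rfl <;> norm_num
  have hrp : 1 - p ∉ Metric.closedBall p ‖u'‖ := hadm.other_notMem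
  refine taylorFinite_of_integral_eq_zero hpr (by simpa using hr) hb he hR (hxo.trans_le hxou) hxu
    fun ρ hρ hρ1 => ?_
  obtain ⟨hzB, hA, hB⟩ := hgeom ρ hρ hρ1
  set z := p + ρ * (z₀ - p) with hz
  have hzcl := Metric.ball_subset_closedBall hzB
  have hpz : p ≠ z := fun h => hpB (by rw [h]; exact hzcl)
  have hzr : z ≠ 1 - p := fun h => hrB (by rw [← h]; exact hzcl)
  have hzBp : z ∉ Metric.closedBall p ‖u'‖ := fun h => disjoint_left.1 hadm.disj hzcl h
  have hρ0 : 0 < ρ := (hxo.trans_le hxou).trans hρ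
  have hρc : (ρ : ℂ) ≠ 0 := by exact_mod_cast hρ0.ne'
  -- The primitives are sought as `(w-p)(z-w) G`; the sign of `R` changes because the Fuchsian
  -- equation has `w - z` in place of `z - w`.
  obtain ⟨G₁, hG₁, hG₁'⟩ := exists_fuchs_solution (e := e) (c := k) hpz hpr hb hR.neg
  obtain ⟨G₂, hG₂, hG₂'⟩ := exists_fuchs_solution (e := b) (c := k) hpz.symm hzr he hR.neg
  have hG₂'' : ∀ w ∈ raySlit z (1 - p) ∩ raySlit z p, (w - p) * (w - z) * deriv G₂ w
      + ((b + 1) * (w - z) + (e + 1) * (w - p) + k * (w - p) * (w - z) / (w - (1 - p))) * G₂ w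
      = (-R) w := fun w hw => by rw [← hG₂' w hw]; ring
  have hoz : o = p + ((xo / ρ : ℝ) : ℂ) * (z - p) := by
    rw [hoe, hz]
    push_cast
    field_simp
    ring
  have toward : ∀ {G : ℂ → ℂ} {U : Set ℂ}, IsOpen U → DifferentiableOn ℂ G U →
      ∀ w ∈ U, HasDerivAt (fun w => (w - p) * (z - w) * G w)
        ((z - w - (w - p)) * G w + (w - p) * (z - w) * deriv G w) w := by
    intro G U hU hG w hw
    refine ((((hasDerivAt_id' w).sub_const p).fun_mul ((hasDerivAt_id' w).const_sub z)).fun_mul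
      (hG.differentiableAt (hU.mem_nhds hw)).hasDerivAt).congr_deriv ?_
    ring
  have eqn : ∀ {G : ℂ → ℂ} {w : ℂ}, (w - p) * (w - z) * deriv G w
      + ((b + 1) * (w - z) + (e + 1) * (w - p) + k * (w - p) * (w - z) / (w - (1 - p))) * G w
      = (-R) w → w ≠ p → w ≠ 1 - p → w ≠ z →
      (b / (w - p) + k / (w - (1 - p)) - e / (z - w)) * ((w - p) * (z - w) * G w)
        + ((z - w - (w - p)) * G w + (w - p) * (z - w) * deriv G w) = R w := by
    intro G w h h1 h2 h3
    have h1' := sub_ne_zero.2 h1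
    have h2' := sub_ne_zero.2 h2
    have h3' := sub_ne_zero.2 h3.symm
    have : R w = -(-R) w := by simp
    rw [this, ← h]
    field_simp
    ring
  have key := H.eq_of_weightInt_eq_zero hzB (b := b) (k := k) (e := e) (o := o) (R := R)
    (g₁ := fun w => (w - p) * (z - w) * G₁ w) (g₂ := fun w => (w - p) * (z - w) * G₂ w)
    (U₁ := raySlit p (1 - p) ∩ raySlit p z) (U₂ := raySlit z (1 - p) ∩ raySlit z p)
    hR.continuousOn (by simp)
    (by rw [commutatorLoop_extend₁ le_rfl]; norm_num)
    (by rw [commutatorLoop_extend₂ (by norm_num)]; norm_num)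
    (by rw [commutatorLoop_extend₃ (by norm_num)]; norm_num)
    (by simp)
    (fun s hs => by rw [commutatorLoop_extend₁ hs.2]; exact hA _)
    (fun s hs => by rw [commutatorLoop_extend₂ hs]; exact hB _)
    (fun s hs => by rw [commutatorLoop_extend₃ hs]; exact hA _)
    (fun s hs => by rw [commutatorLoop_extend₄ hs.1]; exact hB _)
    (by
      have := commutator_values_of_circles (m := fun w => w - p) (hasLogIncr_sub_of_notMem hpB)
        (hasLogIncr_sub_center hadm.u'_ne) H.branch₀
      simpa only [add_zero] using And.intro this.1 (And.intro this.2.1 this.2.2.1))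
    (by
      have := commutator_values_of_circles (m := fun w => w - (1 - p))
        (hasLogIncr_sub_of_notMem hrB) (hasLogIncr_sub_of_notMem hrp) H.branch₁
      simpa only [add_zero] using And.intro this.1 (And.intro this.2.1 this.2.2.1))
    (by
      have := commutator_values_of_circles (m := fun w => z - w)
        (hasLogIncr_rsub_of_mem hzB) (hasLogIncr_rsub_of_notMem hzBp) (H.branch_left hzB)
      simpa only [add_zero] using And.intro this.1 (And.intro this.2.1 this.2.2.1))
    (toward ((isOpen_raySlit _ _).inter (isOpen_raySlit _ _)) hG₁)
    (toward ((isOpen_raySlit _ _).inter (isOpen_raySlit _ _)) hG₂)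
    (fun w hw h1 h2 h3 => eqn (hG₁' w hw) h1 h2 h3)
    (fun w hw h1 h2 h3 => eqn (hG₂'' w hw) h1 h2 h3)
    hbi.exp_ne_one hei.exp_ne_one (hV z hzB)
  have hx0 : 0 < xo / ρ := div_pos hxo hρ0
  have hx1 : xo / ρ < 1 := (div_lt_one hρ0).2 (by linarith)
  have hxc0 : ((xo / ρ : ℝ) : ℂ) ≠ 0 := by exact_mod_cast hx0.ne'
  have hxc1 : 1 - ((xo / ρ : ℝ) : ℂ) ≠ 0 := by
    have : 1 - xo / ρ ≠ 0 := by linarith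
    exact_mod_cast this
  have hzp0 : z - p ≠ 0 := sub_ne_zero.2 hpz.symm
  have hGo : G₁ (p + ((xo / ρ : ℝ) : ℂ) * (z - p)) = G₂ (p + ((xo / ρ : ℝ) : ℂ) * (z - p)) := by
    rw [← hoz]
    refine mul_left_cancel₀ (mul_ne_zero ?_ ?_) key
    · rw [hoz, add_sub_cancel_left]
      exact mul_ne_zero hxc0 hzp0
    · rw [show z - o = (1 - ((xo / ρ : ℝ) : ℂ)) * (z - p) by rw [hoz]; ring]
      exact mul_ne_zero hxc1 hzp0
  have hsegz : 1 - p ∉ segment ℝ p z := fun h => hr ((convex_segment p z₀).segment_subset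
    (left_mem_segment _ _ _) (by
      simpa using add_mul_mem_segment (p := p) (z := z₀) hρ0.le hρ1.le) h)
  have hint := integral_segment_eq_zero hpz hsegz hb he hR.neg.continuousOn hG₁ hG₂ hG₁' hG₂''
    hx0 hx1 hGo
  rw [starInt, ← neg_eq_zero, ← intervalIntegral.integral_neg]
  refine Eq.trans ?_ hint
  refine intervalIntegral.integral_congr fun x _ => ?_
  have e1 : p + (x : ℂ) * (z - p) = p + (0 + x * ((ρ : ℂ) - 0)) * (z₀ - p) := by rw [hz]; ring
  simp only [lineSection, Pi.neg_apply, e1]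
  ring

theorem TaylorFinite.of_vanishes {p r ℓ : ℂ} {c L₀ L₁ : ℝ → ℂ} {D : Set ℂ} {L : ℂ × ℝ → ℂ}
    (H : IsClosedContour p r c D L₀ L₁ L) (hpr : p ≠ r) {b k : ℂ} (M : ℕ) : ∀ {e : ℂ} {R : ℂ → ℂ},
    DifferentiableOn ℂ R {r}ᶜ → Vanishes c L₀ L₁ L D b k e R →
    (∀ R' : ℂ → ℂ, DifferentiableOn ℂ R' {r}ᶜ → Vanishes c L₀ L₁ L D b k (e + M) R' →
      TaylorFinite p r ℓ k R') → TaylorFinite p r ℓ k R := by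
  induction M with
  | zero => intro e R hR hV h; exact h R hR (by simpa using hV)
  | succ M ih =>
    intro e R hR hV h
    refine TaylorFinite.of_eulerOp (κ := b + e + 2) hpr hR (ih (e := e + 1) ?_ (H.vanishes_raise hR hV)
      fun R' hR' hV' => h R' hR' ?_)
    · exact (differentiableOn_eulerOp hR).add (hR.const_mul _)
    · convert hV' using 1
      push_cast
      ring

/-- By contradiction: shift the exponents to positive real part, apply the convergent case, and undo
the Euler operators. Finitely many Taylor coefficients would remain, which a non-integral `k`
forbids. -/
theorem exists_weightInt_ne_zero (hp : p = 0 ∨ p = 1) (ho : o ∈ segment ℝ p z₀)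
    (hu : z₀ + u ∈ segment ℝ p z₀) (hu' : p + u' ∈ segment ℝ p z₀)
    (hadm : IsAdmissible p z₀ u u' (Path.segment o (z₀ + u)) (Path.segment o (p + u')))
    (H : IsClosedContour p (1 - p) (commutatorLoop (loopAround z₀ u (Path.segment o (z₀ + u)))
      (loopAround p u' (Path.segment o (p + u')))).extend (Metric.ball z₀ ‖u‖) Lp Lr L)
    {b k e : ℂ} (hbi : NotInt b) (hki : NotInt k) (hei : NotInt e) {Q : Polynomial ℂ} (hQ : Q ≠ 0)
    (t : ℂ) :
    ∃ z ∈ Metric.ball z₀ ‖u‖ \ {t}, weightInt (commutatorLoop (loopAround z₀ u (Path.segment o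
      (z₀ + u))) (loopAround p u' (Path.segment o (p + u')))).extend Lp Lr L b k e
      (fun w => Q.eval w) z ≠ 0 := by
  by_contra! hcon
  set c := (commutatorLoop (loopAround z₀ u (Path.segment o (z₀ + u)))
      (loopAround p u' (Path.segment o (p + u')))).extend with hc
  have hR : DifferentiableOn ℂ (fun w => Q.eval w) {1 - p}ᶜ := Q.differentiable.differentiableOn
  have hV : ∀ z ∈ Metric.ball z₀ ‖u‖, weightInt c Lp Lr L b k e (fun w => Q.eval w) z = 0 := by
    intro z hz
    by_cases hzt : z = t
    -- The integral is holomorphic at `t` as well, so its value there follows by continuity.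
    · have hd := (H.hasDerivAt_weightInt hz b k e (H.continuousOn_comp hR.continuousOn)).continuousAt
      refine tendsto_nhds_unique (hd.mono_left nhdsWithin_le_nhds : Tendsto _ (𝓝[≠] z) _)
        (tendsto_const_nhds.congr' ?_)
      filter_upwards [nhdsWithin_le_nhds (H.isOpen.mem_nhds hz), self_mem_nhdsWithin] with x hx hx'
      exact (hcon x ⟨hx, fun h => hx' (h.trans hzt.symm)⟩).symm
    · exact hcon z ⟨hz, hzt⟩
  have hpr : p ≠ 1 - p := by rcases hp with rfl | rfl <;> norm_num
  have hz₀p : z₀ - p ≠ 0 := by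
    intro h
    have : p ∈ Metric.closedBall z₀ ‖u‖ := by
      rw [← sub_eq_zero.1 h]; exact Metric.mem_closedBall_self (norm_nonneg _)
    rcases hp with rfl | rfl
    exacts [hadm.zero_notMem this, hadm.one_notMem this]
  refine not_taylorFinite_of_polynomial hpr hz₀p hki hQ ?_
  -- First `(b, e)` becomes `(b+N, e-N)`, then `2N` raises of the second exponent give `(b+N, e+N)`.
  obtain ⟨N, hN⟩ := exists_nat_gt (|b.re| + |e.re|)
  have h1 := neg_abs_le b.re
  have h2 := neg_abs_le e.re
  have h3 := abs_nonneg b.re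
  have h4 := abs_nonneg e.re
  have v1 := H.vanishes_add_left hR.continuousOn (H.vanishes_of_forall hR.continuousOn
    (fun n => by simpa using hei n) hV) N
  refine TaylorFinite.of_vanishes H hpr (2 * N) hR v1 fun R' hR' hV' => ?_
  refine taylorFinite_of_weightInt_eq_zero hp ho hu hu' hadm H (b := b + N)
    (e := e + N) ?_ ?_ (hbi.add_natCast N) (hei.add_natCast N) hR' fun z hz => ?_
  · simp; linarith
  · simp; linarith
  · have := hV' 0 z hz
    convert this using 2
    push_cast
    ring

theorem exists_contourIntegral_ne_zero {β γ δ t : ℂ} {h : Polynomial ℂ} (hh : h ≠ 0)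
    (hβ : NotInt β) (hβγ : NotInt (β - γ)) (hβδ : NotInt (β - δ)) (hp : p = 0 ∨ p = 1)
    (ho : o ∈ segment ℝ p z₀) (hu : z₀ + u ∈ segment ℝ p z₀) (hu' : p + u' ∈ segment ℝ p z₀)
    (hadm : IsAdmissible p z₀ u u' (Path.segment o (z₀ + u)) (Path.segment o (p + u')))
    {L₀ L₁ : ℝ → ℂ}
    (hb : IsBranchData (commutatorLoop (loopAround z₀ u (Path.segment o (z₀ + u)))
      (loopAround p u' (Path.segment o (p + u')))) (Metric.ball z₀ ‖u‖) L₀ L₁ L) :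
    ∃ z ∈ Metric.ball z₀ ‖u‖ \ {t}, contourIntegral β γ δ h (commutatorLoop (loopAround z₀ u
      (Path.segment o (z₀ + u))) (loopAround p u' (Path.segment o (p + u')))) L₀ L₁ L z ≠ 0 := by
  have H := isClosedContour_commutatorLoop (goodPath_loopAround hadm.smooth)
    (goodPath_loopAround hadm.smooth') Metric.isOpen_ball hb
  show ∃ z ∈ Metric.ball z₀ ‖u‖ \ {t}, weightInt (commutatorLoop (loopAround z₀ u (Path.segment o
      (z₀ + u))) (loopAround p u' (Path.segment o (p + u')))).extend L₀ L₁ L (β - γ) (β - δ) (-β)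
      (fun w => h.eval w) z ≠ 0
  rcases hp with rfl | rfl
  · exact exists_weightInt_ne_zero (Or.inl rfl) ho hu hu' hadm (by simpa using H) hβγ hβδ hβ.neg hh t
  · simp only [weightInt_swap _ L₀ L₁]
    exact exists_weightInt_ne_zero (Or.inr rfl) ho hu hu' hadm (by simpa using H.swap) hβδ hβγ hβ.neg
      hh t

end SegmentContour


/-! ### Pochhammer quotients as Taylor multipliers -/

section Pochhammer

/-- The quotient `(b)ₙ / (c)ₙ`. -/
noncomputable def pochRatio (b c : ℂ) (n : ℕ) : ℂ :=
  (ascPochhammer ℂ n).eval b / (ascPochhammer ℂ n).eval c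

theorem ascPochhammer_eval_succ_left (b : ℂ) (n : ℕ) :
    (ascPochhammer ℂ (n + 1)).eval b = b * (ascPochhammer ℂ n).eval (b + 1) := by
  rw [ascPochhammer_succ_left]
  simp

theorem ascPochhammer_eval_ne_zero {b : ℂ} (hb : NotNonposInt b) (n : ℕ) :
    (ascPochhammer ℂ n).eval b ≠ 0 := by
  induction n with
  | zero => simp
  | succ n ih =>
    rw [ascPochhammer_succ_eval]
    exact mul_ne_zero ih fun h => hb n (by linear_combination h)

theorem NotNonposInt.add_one {c : ℂ} (h : NotNonposInt c) : NotNonposInt (c + 1) := fun n hn =>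
  h (n + 1) (by push_cast; linear_combination hn)

theorem NotNonposInt.add_natCast {c : ℂ} (h : NotNonposInt c) (k : ℕ) : NotNonposInt (c + k) :=
  fun n hn => h (n + k) (by push_cast; linear_combination hn)

theorem NotNonposInt.add_natCast_ne_zero {c : ℂ} (h : NotNonposInt c) (n : ℕ) : c + n ≠ 0 :=
  fun h' => h n (by linear_combination h')

theorem NotInt.notNonposInt {c : ℂ} (h : NotInt c) : NotNonposInt c := fun n hn =>
  h (-n) (by simpa using hn)

@[simp] theorem pochRatio_zero (b c : ℂ) : pochRatio b c 0 = 1 := by simp [pochRatio]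

theorem pochRatio_ne_zero {b c : ℂ} (hb : NotNonposInt b) (hc : NotNonposInt c) (n : ℕ) :
    pochRatio b c n ≠ 0 :=
  div_ne_zero (ascPochhammer_eval_ne_zero hb n) (ascPochhammer_eval_ne_zero hc n)

theorem pochRatio_succ (b c : ℂ) (n : ℕ) :
    pochRatio b c (n + 1) = pochRatio b c n * ((b + n) / (c + n)) := by
  simp only [pochRatio, ascPochhammer_succ_eval, mul_div_mul_comm]

theorem pochRatio_succ_left (b c : ℂ) (n : ℕ) :
    pochRatio b c (n + 1) = b / c * pochRatio (b + 1) (c + 1) n := by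
  simp only [pochRatio, ascPochhammer_eval_succ_left, mul_div_mul_comm]

theorem pochRatio_lower (b : ℂ) {c : ℂ} (hc : NotNonposInt c) (n : ℕ) :
    pochRatio b c n = (1 + n / c) * pochRatio b (c + 1) n := by
  have h := ascPochhammer_succ_eval n c
  rw [ascPochhammer_eval_succ_left] at h
  have h0 : c ≠ 0 := by simpa using hc 0
  have h1 := ascPochhammer_eval_ne_zero hc n
  have h2 := ascPochhammer_eval_ne_zero hc.add_one n
  simp only [pochRatio]
  field_simp
  linear_combination (ascPochhammer ℂ n).eval b * h

end Pochhammer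

section Multiplier

variable {S : Set ℂ}

/-- Multiplication of the Taylor coefficients by `(b)ₙ / (c)ₙ` preserves holomorphy on `S`. -/
def HasMultiplier (S : Set ℂ) (b c : ℂ) : Prop :=
  ∀ φ a, DifferentiableOn ℂ φ S → HasTaylor φ a →
    ∃ ψ, DifferentiableOn ℂ ψ S ∧ HasTaylor ψ (fun n => pochRatio b c n * a n)

theorem betaIntegral_add_one_left {u v : ℂ} (hu : 0 < u.re) (hv : 0 < v.re) :
    (u + v) * Complex.betaIntegral (u + 1) v = u * Complex.betaIntegral u v := by
  have huv : 0 < (u + v).re := by simp; linarith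
  have h1 := Complex.Gamma_mul_Gamma_eq_betaIntegral hu hv
  have h2 := Complex.Gamma_mul_Gamma_eq_betaIntegral (s := u + 1) (t := v) (by simp; linarith) hv
  have hu0 : u ≠ 0 := fun h => by simp [h] at hu
  have huv0 : u + v ≠ 0 := fun h => by simp [h] at huv
  rw [Complex.Gamma_add_one u hu0, show u + 1 + v = u + v + 1 by ring,
    Complex.Gamma_add_one _ huv0] at h2
  refine mul_left_cancel₀ (Complex.Gamma_ne_zero_of_re_pos huv) ?_
  linear_combination u * h1 - h2

theorem betaIntegral_add_natCast {u v : ℂ} (hu : 0 < u.re) (hv : 0 < v.re) (n : ℕ) :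
    Complex.betaIntegral (u + n) v = Complex.betaIntegral u v * pochRatio u (u + v) n := by
  induction n with
  | zero => simp
  | succ n ih =>
    have hn : (0 : ℝ) ≤ n := n.cast_nonneg
    have h1 := betaIntegral_add_one_left (u := u + n) (v := v) (by simp; linarith) hv
    have h0 : u + v + n ≠ 0 := fun h => by
      have := congrArg Complex.re h
      simp at this
      linarith
    rw [ih] at h1
    rw [pochRatio_succ]
    push_cast
    rw [← add_assoc]
    field_simp
    linear_combination h1

/-- Euler's integral: the moments of `x^(b-1)(1-x)^(c-b-1)`, divided by the zeroth one, are
`(b)ₙ/(c)ₙ`. Bounds by 1 rather than 0 keep the kernel continuous on `[0, 1]`. -/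
theorem hasMultiplier_of_re_pos (hS : IsOpen S) (hs : StarConvex ℝ 0 S) (h0 : 0 ∈ S) {b c : ℂ}
    (hb : 1 < b.re) (hc : 1 < (c - b).re) : HasMultiplier S b c := by
  intro φ a hφ ha
  have hb1 : 0 < (b - 1).re := by simp; linarith
  have hc1 : 0 < (c - b - 1).re := by
    simp only [Complex.sub_re, Complex.one_re] at hc ⊢
    linarith
  have hk := continuousOn_betaKernel hb1 hc1
  have hB := betaIntegral_ne_zero (u := b) (v := c - b) (by linarith) (by linarith)
  refine ⟨fun z => (Complex.betaIntegral b (c - b))⁻¹ * starInt _ 0 φ z,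
    (differentiableOn_starInt hk hS hs hφ).const_mul _, ?_⟩
  have := (hasTaylor_starInt hk hS hs h0 hφ ha).const_mul (Complex.betaIntegral b (c - b))⁻¹
  convert this using 2 with n
  rw [integral_pow_mul_eq_betaIntegral hb1, show b - 1 + n + 1 = b + n by ring, sub_add_cancel,
    betaIntegral_add_natCast (by linarith) (by linarith), add_sub_cancel]
  field_simp

/-- The factor `1 + n/c` between the two quotients is the action of `1 + c⁻¹ z d/dz`. -/
theorem HasMultiplier.lower_right (hS : IsOpen S) {b c : ℂ} (hc : NotNonposInt c)
    (h : HasMultiplier S b (c + 1)) : HasMultiplier S b c := by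
  intro φ a hφ ha
  obtain ⟨ψ, hψ, hψa⟩ := h φ a hφ ha
  refine ⟨fun z => ψ z + c⁻¹ * (z * deriv ψ z),
    hψ.add ((differentiableOn_id.mul (hψ.deriv hS)).const_mul _), ?_⟩
  convert hψa.add (hψa.deriv.id_mul.const_mul c⁻¹) using 2 with n
  rw [pochRatio_lower b hc n]
  rcases n with _ | n
  · simp
  · rw [shiftSeq_succ]
    push_cast
    ring

theorem hasTaylor_const (k : ℂ) : HasTaylor (fun _ => k) (fun n => if n = 0 then k else 0) := by
  refine ⟨analyticAt_const, fun n => ?_⟩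
  rw [iteratedDeriv_const]
  rcases n with _ | n <;> simp

/-- Split off the constant term, `φ = φ 0 + z φ₁`, and use `(b)ₙ₊₁/(c)ₙ₊₁ = (b/c)(b+1)ₙ/(c+1)ₙ` on
`φ₁`. -/
theorem HasMultiplier.lower (hS : IsOpen S) (h0 : 0 ∈ S) {b c : ℂ}
    (h : HasMultiplier S (b + 1) (c + 1)) : HasMultiplier S b c := by
  intro φ a hφ ha
  have hφ' : DifferentiableOn ℂ (dslope φ 0) S :=
    (Complex.differentiableOn_dslope (hS.mem_nhds h0)).2 hφ
  have hd := HasTaylor.of_analyticAt (hφ'.analyticAt (hS.mem_nhds h0))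
  set d := fun n => iteratedDeriv n (dslope φ 0) 0 / (n.factorial : ℂ)
  have e : (fun z => φ 0 + z * dslope φ 0 z) = φ := by
    ext z
    have := sub_smul_dslope φ 0 z
    simp only [sub_zero, smul_eq_mul] at this
    rw [this]
    ring
  have hφ2 := (hasTaylor_const (φ 0)).add hd.id_mul
  rw [e] at hφ2
  have had := ha.unique hφ2
  obtain ⟨ψ, hψ, hψa⟩ := h _ d hφ' hd
  refine ⟨fun z => φ 0 + b / c * (z * ψ z),
    (differentiableOn_const _).add ((differentiableOn_id.mul hψ).const_mul _), ?_⟩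
  convert (hasTaylor_const (φ 0)).add (hψa.id_mul.const_mul (b / c)) using 2 with n
  rw [had]
  rcases n with _ | n
  · simp
  · simp only [shiftSeq_succ, pochRatio_succ_left]
    simp
    ring

theorem hasMultiplier (hS : IsOpen S) (hs : StarConvex ℝ 0 S) (h0 : 0 ∈ S) {b c : ℂ}
    (hc : NotNonposInt c) : HasMultiplier S b c := by
  obtain ⟨N, hN⟩ := exists_nat_gt (1 - b.re)
  have step1 : HasMultiplier S (b + N) (c + N) := by
    obtain ⟨M, hM⟩ := exists_nat_gt (1 - (c - b).re)
    have base : HasMultiplier S (b + N) (c + N + M) := hasMultiplier_of_re_pos hS hs h0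
      (by simp; linarith) (by simp at hM ⊢; linarith)
    clear hM
    induction M with
    | zero => simpa using base
    | succ M ih =>
      refine ih (HasMultiplier.lower_right hS ((hc.add_natCast N).add_natCast M) ?_)
      convert base using 1
      push_cast
      ring
  clear hN
  induction N with
  | zero => simpa using step1
  | succ N ih =>
    refine ih (HasMultiplier.lower hS h0 ?_)
    convert step1 using 1 <;> push_cast <;> ring

end Multiplier

/-! ### Continuation of the hypergeometric function -/

section Hypergeometric

/-- The plane cut along `[1, ∞)`. -/
def rightCut : Set ℂ := {z | 1 - z ∈ Complex.slitPlane}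

theorem isOpen_rightCut : IsOpen rightCut := Complex.isOpen_slitPlane.preimage (by fun_prop)

theorem zero_mem_rightCut : (0 : ℂ) ∈ rightCut := by
  show 1 - (0 : ℂ) ∈ Complex.slitPlane
  simp

theorem starConvex_rightCut : StarConvex ℝ 0 rightCut := by
  intro z hz a b ha hb hab
  have := Complex.starConvex_one_slitPlane hz ha hb hab
  show 1 - (a • (0 : ℂ) + b • z) ∈ Complex.slitPlane
  have hab' : (a : ℂ) + b = 1 := by exact_mod_cast hab
  convert this using 1
  simp only [Complex.real_smul]
  linear_combination -hab'

theorem isPreconnected_rightCut : IsPreconnected rightCut :=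
  (starConvex_rightCut.isPathConnected zero_mem_rightCut).isConnected.isPreconnected

theorem mem_rightCut_of_norm_lt {z : ℂ} (hz : ‖z‖ < 1) : z ∈ rightCut := by
  refine Or.inl ?_
  have := Complex.re_le_norm z
  simp
  linarith

theorem ball_subset_rightCut : Metric.ball 0 1 ⊆ rightCut := fun z hz =>
  mem_rightCut_of_norm_lt (by simpa using hz)

theorem hasDerivAt_one_sub_cpow (A : ℂ) {z : ℂ} (hz : z ∈ rightCut) :
    HasDerivAt (fun w => (1 - w) ^ A) ((1 - z) ^ A * (A / (z - 1))) z := by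
  have hz' : 1 - z ∈ Complex.slitPlane := hz
  have hne : 1 - z ≠ 0 := Complex.slitPlane_ne_zero hz'
  have hne' : z - 1 ≠ 0 := fun h => hne (by linear_combination -h)
  refine (((hasDerivAt_id' z).const_sub 1).cpow_const hz').congr_deriv ?_
  rw [Complex.cpow_sub _ _ hne, Complex.cpow_one]
  have h2 : (1 - z)⁻¹ = -(z - 1)⁻¹ := by rw [← inv_neg, neg_sub]
  rw [div_eq_mul_inv, div_eq_mul_inv, h2]
  ring

theorem differentiableOn_one_sub_cpow (A : ℂ) :
    DifferentiableOn ℂ (fun w => (1 - w) ^ A) rightCut := fun _ hz =>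
  (hasDerivAt_one_sub_cpow A hz).differentiableAt.differentiableWithinAt

theorem hasTaylor_one_sub_cpow (A : ℂ) :
    HasTaylor (fun w => (1 - w) ^ (-A))
      (fun n => (n.factorial : ℂ)⁻¹ * (ascPochhammer ℂ n).eval A) := by
  have hc := HasTaylor.of_analyticAt ((differentiableOn_one_sub_cpow (-A)).analyticAt
    (isOpen_rightCut.mem_nhds zero_mem_rightCut))
  set c := fun n => iteratedDeriv n (fun w : ℂ => (1 - w) ^ (-A)) 0 / (n.factorial : ℂ) with hcdef
  have c0 : c 0 = 1 := by simp [hcdef]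
  have h1 := hc.deriv.add ((hc.deriv.id_mul.const_mul (-1)).add (hc.const_mul (-A)))
  have h0 := h1.congr (g := fun _ => 0) (by
    filter_upwards [isOpen_rightCut.mem_nhds zero_mem_rightCut] with z hz
    have hz' : z - 1 ≠ 0 := fun h => Complex.slitPlane_ne_zero (show 1 - z ∈ Complex.slitPlane from hz)
      (by linear_combination -h)
    rw [(hasDerivAt_one_sub_cpow (-A) hz).deriv]
    field_simp
    ring)
  have hrec := h0.unique (hasTaylor_const 0)
  have : c = fun n => (n.factorial : ℂ)⁻¹ * (ascPochhammer ℂ n).eval A := by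
    ext n
    induction n with
    | zero => simp [c0]
    | succ n ih =>
      have h2 := congrFun hrec n
      have hn : (n : ℂ) + 1 ≠ 0 := by exact_mod_cast Nat.succ_ne_zero n
      have h3 : (n + 1) * c (n + 1) = (A + n) * c n := by
        rcases n with _ | n
        · simp at h2 ⊢
          linear_combination h2
        · simp at h2 ⊢
          linear_combination h2
      have h4 : c (n + 1) = (A + n) * c n / (n + 1) := by rw [← h3]; field_simp
      rw [h4, ih, ascPochhammer_succ_eval, Nat.factorial_succ]
      have : (n.factorial : ℂ) ≠ 0 := by exact_mod_cast n.factorial_ne_zero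
      push_cast
      field_simp
  rw [← this]
  exact hc

/-- The hypergeometric series is the multiplier `(b)ₙ/(c)ₙ` applied to the binomial series
`(1-z)^(-a)`, which is holomorphic on the cut plane; no condition on the size of `b` is needed. -/
theorem exists_hypergeometric_continuation (a b : ℂ) {c : ℂ} (hc : NotNonposInt c) :
    ∃ F : ℂ → ℂ, DifferentiableOn ℂ F rightCut ∧
      HasTaylor F (fun n => pochRatio b c n * ((n.factorial : ℂ)⁻¹ * (ascPochhammer ℂ n).eval a)) ∧
      ∀ z, ‖z‖ < 1 → F z = ordinaryHypergeometric a b c z := by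
  obtain ⟨F, hF, hFa⟩ := hasMultiplier isOpen_rightCut starConvex_rightCut zero_mem_rightCut hc
    (b := b) _ _ (differentiableOn_one_sub_cpow (-a)) (hasTaylor_one_sub_cpow a)
  refine ⟨F, hF, hFa, fun z hz => ?_⟩
  obtain ⟨r, hr, hr1⟩ := exists_between hz
  lift r to NNReal using (norm_nonneg z).trans hr.le
  have hr0 : 0 < r := by
    have := (norm_nonneg z).trans_lt hr
    exact_mod_cast this
  have hsub : Metric.closedBall (0 : ℂ) r ⊆ rightCut :=
    (Metric.closedBall_subset_ball hr1).trans ball_subset_rightCut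
  have hp := (hF.mono hsub).hasFPowerSeriesOnBall hr0
  have hs := hp.hasFPowerSeriesAt.eq_formalMultilinearSeries hFa.hasFPowerSeriesAt
  rw [hs] at hp
  have := hp.sum (y := z) (by
    rw [mem_eball_zero_iff]
    exact_mod_cast (by exact_mod_cast hr : ‖z‖₊ < r))
  rw [zero_add] at this
  rw [this, ordinaryHypergeometric, ordinaryHypergeometricSeries]
  congr 2
  ext n
  simp only [pochRatio, ordinaryHypergeometricCoefficient]
  ring

end Hypergeometric


/-! ### The solution at `0` as a sum of three hypergeometric functions -/

section LocalSolution

variable {α β γ δ q t : ℂ} {h : Polynomial ℂ}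

theorem IsKernelPoly.heunOp_cpow_mul (hδ : γ + δ + (-2) = α + β + 1)
    (hh : IsKernelPoly α β γ δ q t h) {w : ℂ} (hw : w ∈ rightCut) :
    heunOp (2 - γ) (α + 1 - γ) (β + 1 - γ) (δ - β + 1) (-1 - β) (q + (1 - γ) * (δ * t - 2)) t
      (fun w => (1 - w) ^ (β - δ) * h.eval w) w = 0 := by
  set E : ℂ → ℂ := fun w => (1 - w) ^ (β - δ) with hE
  have ne1 : ∀ {w : ℂ}, w ∈ rightCut → w - 1 ≠ 0 := fun {w} hw e =>
    Complex.slitPlane_ne_zero (show 1 - w ∈ Complex.slitPlane from hw) (by linear_combination -e)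
  have hE' : ∀ w ∈ rightCut, HasDerivAt E (E w * ((β - δ) / (w - 1))) w := fun w hw =>
    hasDerivAt_one_sub_cpow (β - δ) hw
  have hv : ∀ w ∈ rightCut, HasDerivAt (fun w => E w * h.eval w)
      (E w * ((β - δ) / (w - 1) * h.eval w + h.derivative.eval w)) w := fun w hw => by
    refine ((hE' w hw).fun_mul (h.hasDerivAt w)).congr_deriv ?_
    ring
  have hv2 : ∀ w ∈ rightCut, HasDerivAt (deriv fun w => E w * h.eval w)
      (E w * ((((β - δ) / (w - 1)) ^ 2 - (β - δ) / (w - 1) ^ 2)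
        * h.eval w + 2 * ((β - δ) / (w - 1)) * h.derivative.eval w
        + h.derivative.derivative.eval w)) w := fun w hw => by
    have hw1 : w - 1 ≠ 0 := ne1 hw
    have d1 := (hasDerivAt_const w (β - δ)).fun_div ((hasDerivAt_id' w).sub_const 1) hw1
    have := (hE' w hw).fun_mul ((d1.fun_mul (h.hasDerivAt w)).fun_add
      (h.derivative.hasDerivAt w))
    refine (this.congr_of_eventuallyEq ?_).congr_deriv ?_
    · filter_upwards [isOpen_rightCut.mem_nhds hw] with x hx using (hv x hx).deriv
    · field_simp
      ring
  have hw1 := ne1 hw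
  rw [heunOp, (hv2 w hw).deriv, (hv w hw).deriv]
  have key := hh w
  obtain rfl : δ = α + β + 3 - γ := by linear_combination hδ
  field_simp
  linear_combination (E w * (w - 1)) * key

/-- The Euler transformation on power series: the multiplier carries the recurrence of the
transformed equation, stripped of `w^(β-γ)`, to that of Heun's equation stripped of `z^(1-γ)`. -/
theorem odeCoeff_pochRatio_eq_zero (hδ : γ + δ + (-2) = α + β + 1) (hγ : NotNonposInt (2 - γ))
    {a : ℕ → ℂ} {Q : ℂ}
    (ha : ∀ n, odeCoeff (-(1 + t)) t (β + 1 - γ + (δ - β + 1) + (-1 - β))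
      (-((β + 1 - γ) * (1 + t) + (δ - β + 1) * t + (-1 - β))) ((β + 1 - γ) * t)
      ((2 - γ) * (α + 1 - γ)) (-Q) a n = 0) (n : ℕ) :
    odeCoeff (-(1 + t)) t (2 - γ + δ + -2) (-((2 - γ) * (1 + t) + δ * t + -2)) ((2 - γ) * t)
      ((α + 1 - γ) * (β + 1 - γ)) (-Q) (fun n => pochRatio (β - γ + 1) (2 - γ) n * a n) n = 0 := by
  have hn := ha n
  obtain rfl : δ = α + β + 3 - γ := by linear_combination hδ
  have c0 := hγ.add_natCast_ne_zero n
  rcases n with _ | n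
  · have c0' : 2 - γ ≠ 0 := by simpa using c0
    have e1 : pochRatio (β - γ + 1) (2 - γ) 1 = (β - γ + 1) / (2 - γ) := by
      simpa using pochRatio_succ (β - γ + 1) (2 - γ) 0
    simp only [odeCoeff, shiftSeq_zero, zero_add, pochRatio_zero, e1] at hn ⊢
    push_cast at hn ⊢
    field_simp
    linear_combination (2 - γ) * hn
  · have c1 := hγ.add_natCast_ne_zero n
    have e1 := pochRatio_succ (β - γ + 1) (2 - γ) n
    have e2 := pochRatio_succ (β - γ + 1) (2 - γ) (n + 1)
    simp only [odeCoeff, shiftSeq_succ] at hn ⊢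
    rw [e2, e1]
    push_cast at hn c0 ⊢
    have hx := div_mul_cancel₀ (β - γ + 1 + n) c1
    have hy := div_mul_cancel₀ (β - γ + 1 + (n + 1)) c0
    generalize pochRatio (β - γ + 1) (2 - γ) n = m
    generalize (β - γ + 1 + n) / (2 - γ + n) = x at hx ⊢
    generalize (β - γ + 1 + (n + 1)) / (2 - γ + (n + 1)) = y at hy ⊢
    linear_combination m * x * hn + t * (n + 2) * m * x * a (n + 2) * hy
      - (n + 1 + α - γ) * m * a n * hx

theorem eval_eq_of_natDegree_le_two (hdeg : h.natDegree ≤ 2) (w : ℂ) :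
    h.eval w = h.coeff 0 + (h.coeff 1 * w + h.coeff 2 * w ^ 2) := by
  rw [Polynomial.eval_eq_sum_range' (Nat.lt_succ_of_le hdeg)]
  simp [Finset.sum_range_succ]
  ring

theorem exists_local_solution (hδ : γ + δ + (-2) = α + β + 1) (hh : IsKernelPoly α β γ δ q t h)
    (hdeg : h.natDegree ≤ 2) (hne : h ≠ 0) (hβγ : NotInt (β - γ)) (hγ : NotNonposInt (2 - γ)) :
    ∃ (F : Fin 3 → ℂ → ℂ) (V : ℂ → ℂ) (a : Fin 3 → ℂ),
      (∀ k, DifferentiableOn ℂ (F k) rightCut) ∧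
      (∀ (k : Fin 3) (z : ℂ), ‖z‖ < 1 → F k z =
        ordinaryHypergeometric (α - γ + 3) (β - γ + (k : ℂ) + 1) (2 - γ + (k : ℂ)) z) ∧
      DifferentiableOn ℂ V rightCut ∧ (¬ ∀ᶠ z in 𝓝 0, V z = 0) ∧
      (∀ z ∈ rightCut, heunOp (α + 1 - γ) (β + 1 - γ) (2 - γ) δ (-2) (q + (1 - γ) * (δ * t - 2)) t
        V z = 0) ∧
      ∀ z, V z = ∑ k, a k * (z ^ (k : ℕ) * F k z) := by
  have hA : -(α - γ + 3) = β - δ := by linear_combination hδ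
  have hb : NotNonposInt (β - γ + 1) := by simpa using (hβγ.add_natCast 1).notNonposInt
  set A := α - γ + 3 with hAdef
  set cA : ℕ → ℂ := fun n => (n.factorial : ℂ)⁻¹ * (ascPochhammer ℂ n).eval A with hcA
  set m := pochRatio (β - γ + 1) (2 - γ) with hm
  have hcont : ∀ k : Fin 3, ∃ F : ℂ → ℂ, DifferentiableOn ℂ F rightCut ∧
      HasTaylor F (fun n => pochRatio (β - γ + (k : ℂ) + 1) (2 - γ + (k : ℂ)) n * cA n) ∧
      ∀ z, ‖z‖ < 1 → F z = ordinaryHypergeometric A (β - γ + (k : ℂ) + 1) (2 - γ + (k : ℂ)) z :=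
    fun k => exists_hypergeometric_continuation A _ (by
      simpa using hγ.add_natCast (k : ℕ))
  choose F hF hFT hFh using hcont
  set φ : ℂ → ℂ := fun w => (1 - w) ^ (β - δ) * h.eval w with hφ
  have hφd : DifferentiableOn ℂ φ rightCut :=
    (differentiableOn_one_sub_cpow _).mul h.differentiable.differentiableOn
  have hp := hasTaylor_one_sub_cpow A
  rw [hA] at hp
  set a : ℕ → ℂ := fun n => h.coeff 0 * cA n + (h.coeff 1 * shiftSeq cA n
    + h.coeff 2 * shiftSeq (shiftSeq cA) n) with ha
  have hφT : HasTaylor φ a := by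
    convert (hp.const_mul (h.coeff 0)).add ((hp.id_mul.const_mul (h.coeff 1)).add
      (hp.id_mul.id_mul.const_mul (h.coeff 2))) using 1
    ext w
    rw [hφ]
    beta_reduce
    rw [eval_eq_of_natDegree_le_two hdeg]
    ring
  set v : Fin 3 → ℂ := fun k => h.coeff k * m k with hv
  set V : ℂ → ℂ := fun z => ∑ k, v k * (z ^ (k : ℕ) * F k z) with hV
  have hVe : V = fun z => v 0 * F 0 z + (v 1 * (z * F 1 z) + v 2 * (z * (z * F 2 z))) := by
    ext z
    simp [hV, Fin.sum_univ_three]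
    ring
  have hVT : HasTaylor V (fun n => m n * a n) := by
    rw [hVe]
    convert ((hFT 0).const_mul (v 0)).add (((hFT 1).id_mul.const_mul (v 1)).add
      ((hFT 2).id_mul.id_mul.const_mul (v 2))) using 1
    ext n
    -- Multiplication by `w^k` shifts the coefficients by `k`, and the shifted multiplier is a
    -- constant times the Pochhammer quotient with both parameters raised by `k`.
    have m1 : ∀ n, m (n + 1) = m 1 * pochRatio (β - γ + 1 + 1) (2 - γ + 1) n := fun n => by
      have e0 := pochRatio_succ_left (β - γ + 1) (2 - γ) n
      have e1 := pochRatio_succ_left (β - γ + 1) (2 - γ) 0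
      simp only [pochRatio_zero, mul_one, zero_add] at e1
      rw [hm, e0, e1]
    have m2 : ∀ n, m (n + 2) = m 2 * pochRatio (β - γ + 2 + 1) (2 - γ + 2) n := fun n => by
      have e0 := pochRatio_succ_left (β - γ + 1 + 1) (2 - γ + 1) n
      have e1 := pochRatio_succ_left (β - γ + 1 + 1) (2 - γ + 1) 0
      simp only [pochRatio_zero, mul_one, zero_add] at e1
      rw [m1 (n + 1), m1 1, e0, e1, show β - γ + 1 + 1 + 1 = β - γ + 2 + 1 by ring,
        show 2 - γ + 1 + 1 = 2 - γ + 2 by ring]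
      ring
    have m0 : m 0 = 1 := pochRatio_zero _ _
    rcases n with _ | _ | n
    · simp [ha, hv, m0]
    · simp [ha, hv, m0, ← hm]
      ring
    · have key := (m1 (n + 1)).symm.trans (m2 n)
      simp [ha, hv, m0, ← hm, m1 (n + 1)]
      linear_combination h.coeff 2 * cA n * key
  have hVd : DifferentiableOn ℂ V rightCut := by
    rw [hVe]
    have := hF 0
    have := hF 1
    have := hF 2
    fun_prop
  have hev : ∀ᶠ w in 𝓝 (0 : ℂ), w ∈ rightCut := isOpen_rightCut.mem_nhds zero_mem_rightCut
  have hφ0 := (hφT.odeOp_eventually_eq_zero_iff _ _ _ _ _ _ _).1 (hev.mono fun w hw => by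
    rw [← heunOp_eq_odeOp]
    exact hh.heunOp_cpow_mul hδ hw)
  have hV0 := (hVT.odeOp_eventually_eq_zero_iff _ _ _ _ _ _ _).2
    (odeCoeff_pochRatio_eq_zero hδ hγ hφ0)
  have hVz := ((differentiableOn_heunOp (α := α + 1 - γ) (β := β + 1 - γ) (γ := 2 - γ) (δ := δ)
    (ε := -2) (q := q + (1 - γ) * (δ * t - 2)) (t := t) isOpen_rightCut hVd).analyticOnNhd
    isOpen_rightCut).eqOn_zero_of_preconnected_of_eventuallyEq_zero isPreconnected_rightCut
    zero_mem_rightCut (hV0.mono fun w hw => by rw [heunOp_eq_odeOp]; exact hw)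
  -- No value of the multiplier is zero, so a vanishing `V` would force `(1-w)^(β-δ) h(w) = 0` near
  -- 0 and then `h = 0`.
  refine ⟨F, V, v, hF, hFh, hVd, fun hz => ?_, hVz, fun z => rfl⟩
  have z1 := (hVT.congr (g := fun _ => 0) hz).unique (hasTaylor_const 0)
  have z2 : a = fun n => if n = 0 then (0 : ℂ) else 0 := by
    ext n
    have := congrFun z1 n
    simp only [ite_self, mul_eq_zero] at this ⊢
    exact this.resolve_left (pochRatio_ne_zero hb hγ n)
  rw [z2] at hφT
  have z3 := hφT.eventuallyEq (hasTaylor_const 0)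
  refine hne (Polynomial.eq_of_infinite_eval_eq h 0 (infinite_of_mem_nhds (0 : ℂ) ?_))
  filter_upwards [z3, hev] with w hw hwS
  have hwS' : 1 - w ∈ Complex.slitPlane := hwS
  simp only [hφ] at hw
  rw [Polynomial.eval_zero]
  exact (mul_eq_zero.1 hw).resolve_left fun h0 =>
    Complex.slitPlane_ne_zero hwS' ((Complex.cpow_eq_zero_iff _ _).1 h0).1

end LocalSolution


/-! ### Conjugation, reflection and uniqueness for Heun's operator -/

section Operator

variable {α β γ δ ε q t : ℂ}

theorem deriv_power_mul {E V : ℂ → ℂ} {ν c z : ℂ} (hz : z ≠ c)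
    (hE : ∀ᶠ w in 𝓝 z, HasDerivAt E (E w * (ν / (w - c))) w) (hV : AnalyticAt ℂ V z) :
    deriv (fun w => E w * V w) z = E z * (ν / (z - c) * V z + deriv V z) ∧
    deriv (deriv fun w => E w * V w) z = E z * ((ν ^ 2 - ν) / (z - c) ^ 2 * V z
      + 2 * (ν / (z - c)) * deriv V z + deriv (deriv V) z) := by
  have hzc := sub_ne_zero.2 hz
  have h1 : ∀ᶠ w in 𝓝 z, HasDerivAt (fun w => E w * V w)
      (E w * (ν / (w - c) * V w + deriv V w)) w := by
    filter_upwards [hE, hV.eventually_analyticAt] with w hw hw'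
    refine (hw.fun_mul hw'.differentiableAt.hasDerivAt).congr_deriv ?_
    ring
  refine ⟨h1.self_of_nhds.deriv, HasDerivAt.deriv ?_⟩
  have d1 := (hasDerivAt_const z ν).fun_div ((hasDerivAt_id' z).sub_const c) hzc
  have := hE.self_of_nhds.fun_mul ((d1.fun_mul hV.differentiableAt.hasDerivAt).fun_add
    hV.deriv.differentiableAt.hasDerivAt)
  refine (this.congr_of_eventuallyEq ?_).congr_deriv ?_
  · filter_upwards [h1] with w hw using hw.deriv
  · field_simp
    ring

theorem heunOp_power_mul_zero (hs : γ + δ + ε = α + β + 1) {E V : ℂ → ℂ} {z : ℂ} (hz : z ≠ 0)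
    (hE : ∀ᶠ w in 𝓝 z, HasDerivAt E (E w * ((1 - γ) / (w - 0))) w) (hV : AnalyticAt ℂ V z) :
    heunOp α β γ δ ε q t (fun w => E w * V w) z = E z * heunOp (α + 1 - γ) (β + 1 - γ) (2 - γ) δ ε
      (q + (1 - γ) * (δ * t + ε)) t V z := by
  obtain ⟨e1, e2⟩ := deriv_power_mul hz hE hV
  obtain rfl : ε = α + β + 1 - γ - δ := by linear_combination hs
  rw [heunOp, e1, e2, heunOp]
  simp only [sub_zero]
  field_simp
  ring

theorem heunOp_power_mul_one (hs : γ + δ + ε = α + β + 1) {E V : ℂ → ℂ} {z : ℂ} (hz : z ≠ 1)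
    (hE : ∀ᶠ w in 𝓝 z, HasDerivAt E (E w * ((1 - δ) / (w - 1))) w) (hV : AnalyticAt ℂ V z) :
    heunOp α β γ δ ε q t (fun w => E w * V w) z = E z * heunOp (α + 1 - δ) (β + 1 - δ) γ (2 - δ) ε
      (q + (1 - δ) * (γ * t)) t V z := by
  obtain ⟨e1, e2⟩ := deriv_power_mul hz hE hV
  have hz1 := sub_ne_zero.2 hz
  obtain rfl : ε = α + β + 1 - γ - δ := by linear_combination hs
  rw [heunOp, e1, e2, heunOp]
  field_simp
  ring

theorem heunOp_reflect (α β γ δ ε q t : ℂ) (y : ℂ → ℂ) (z : ℂ) :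
    heunOp α β γ δ ε q t (fun z => y (1 - z)) z =
      -heunOp α β δ γ ε (α * β - q) (1 - t) y (1 - z) := by
  have h1 : deriv (fun z => y (1 - z)) = fun z => -deriv y (1 - z) :=
    funext fun x => deriv_comp_const_sub _ _ _
  have h2 : deriv (fun z => -deriv y (1 - z)) z = deriv (deriv y) (1 - z) := by
    rw [deriv.fun_neg, deriv_comp_const_sub, neg_neg]
  simp only [heunOp, h1, h2]
  ring

theorem heunOp_linear (α β γ δ ε q t : ℂ) {y₁ y₂ : ℂ → ℂ} {z : ℂ} (h₁ : AnalyticAt ℂ y₁ z)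
    (h₂ : AnalyticAt ℂ y₂ z) (a b : ℂ) : heunOp α β γ δ ε q t (fun w => a * y₁ w + b * y₂ w) z =
      a * heunOp α β γ δ ε q t y₁ z + b * heunOp α β γ δ ε q t y₂ z := by
  have d1 : ∀ {w : ℂ}, AnalyticAt ℂ y₁ w → AnalyticAt ℂ y₂ w →
      deriv (fun w => a * y₁ w + b * y₂ w) w = a * deriv y₁ w + b * deriv y₂ w := fun k₁ k₂ =>
    ((k₁.differentiableAt.hasDerivAt.const_mul a).fun_add
      (k₂.differentiableAt.hasDerivAt.const_mul b)).deriv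
  have d2 : deriv (deriv fun w => a * y₁ w + b * y₂ w) z =
      a * deriv (deriv y₁) z + b * deriv (deriv y₂) z := by
    have : deriv (fun w => a * y₁ w + b * y₂ w) =ᶠ[𝓝 z] fun w => a * deriv y₁ w + b * deriv y₂ w := by
      filter_upwards [h₁.eventually_analyticAt, h₂.eventually_analyticAt] with w k₁ k₂ using d1 k₁ k₂
    rw [this.deriv_eq]
    exact ((h₁.deriv.differentiableAt.hasDerivAt.const_mul a).fun_add
      (h₂.deriv.differentiableAt.hasDerivAt.const_mul b)).deriv
  simp only [heunOp, d1 h₁ h₂, d2]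
  ring

/-- The combinations `A y' + B y` with analytic coefficients are closed under differentiation, by
the equation, and all of them vanish at `z`. With `A = 0`, `B = 1` this is uniqueness for the
initial value problem. -/
theorem iteratedDeriv_eq_zero_of_linear_ode {y a b : ℂ → ℂ} {z : ℂ} (hy : AnalyticAt ℂ y z)
    (ha : AnalyticAt ℂ a z) (hb : AnalyticAt ℂ b z)
    (h : ∀ᶠ w in 𝓝 z, deriv (deriv y) w = a w * deriv y w + b w * y w) (h0 : y z = 0)
    (h1 : deriv y z = 0) (n : ℕ) : ∀ {A B : ℂ → ℂ}, AnalyticAt ℂ A z → AnalyticAt ℂ B z →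
      iteratedDeriv n (fun w => A w * deriv y w + B w * y w) z = 0 := by
  induction n with
  | zero => intro A B _ _; simp [h0, h1]
  | succ n ih =>
    intro A B hA hB
    have e : deriv (fun w => A w * deriv y w + B w * y w) =ᶠ[𝓝 z] fun w =>
        (deriv A w + B w + A w * a w) * deriv y w + (deriv B w + A w * b w) * y w := by
      filter_upwards [h, hy.eventually_analyticAt, hA.eventually_analyticAt,
        hB.eventually_analyticAt] with w hw hy' hA' hB'
      have := ((hA'.differentiableAt.hasDerivAt.fun_mul
        hy'.deriv.differentiableAt.hasDerivAt).fun_add (hB'.differentiableAt.hasDerivAt.fun_mul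
        hy'.differentiableAt.hasDerivAt)).deriv
      rw [this, hw]
      ring
    rw [iteratedDeriv_succ', e.iteratedDeriv_eq]
    exact ih ((hA.deriv.add hB).add (hA.mul ha)) (hB.deriv.add (hA.mul hb))

theorem eventually_eq_zero_of_iteratedDeriv {y : ℂ → ℂ} {z : ℂ} (hy : AnalyticAt ℂ y z)
    (h : ∀ n, iteratedDeriv n y z = 0) : ∀ᶠ w in 𝓝 z, y w = 0 := by
  have := hy.hasFPowerSeriesAt
  simp only [h, zero_div] at this
  have e : FormalMultilinearSeries.ofScalars ℂ (fun _ : ℕ => (0 : ℂ)) = 0 := by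
    ext n
    simp [FormalMultilinearSeries.ofScalars]
  rw [e] at this
  exact this.eventually_eq_zero

theorem eventually_eq_zero_of_heunOp {y : ℂ → ℂ} {z : ℂ} (hy : AnalyticAt ℂ y z) (hz0 : z ≠ 0)
    (hz1 : z ≠ 1) (hzt : z ≠ t) (h : ∀ᶠ w in 𝓝 z, heunOp α β γ δ ε q t y w = 0) (h0 : y z = 0)
    (h1 : deriv y z = 0) : ∀ᶠ w in 𝓝 z, y w = 0 := by
  have hlead : z * (z - 1) * (z - t) ≠ 0 :=
    mul_ne_zero (mul_ne_zero hz0 (sub_ne_zero.2 hz1)) (sub_ne_zero.2 hzt)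
  set L : ℂ → ℂ := fun w => w * (w - 1) * (w - t) with hL
  have hLa : AnalyticAt ℂ L z := by simp only [hL]; fun_prop
  have hLne : ∀ᶠ w in 𝓝 z, L w ≠ 0 := hLa.continuousAt.eventually_ne hlead
  have key := iteratedDeriv_eq_zero_of_linear_ode hy
    (a := fun w => -(γ * (w - 1) * (w - t) + δ * w * (w - t) + ε * w * (w - 1)) / L w)
    (b := fun w => -(α * β * w - q) / L w)
    (by refine AnalyticAt.div ?_ hLa hlead; fun_prop)
    (by refine AnalyticAt.div ?_ hLa hlead; fun_prop) (by
      filter_upwards [h, hLne] with w hw hw'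
      rw [heunOp] at hw
      have : deriv (deriv y) w = (L w * deriv (deriv y) w) / L w := by field_simp
      rw [this, div_mul_eq_mul_div, div_mul_eq_mul_div, ← add_div]
      congr 1
      linear_combination hw) h0 h1
  refine eventually_eq_zero_of_iteratedDeriv hy fun n => ?_
  have := key n (A := fun _ => 0) (B := fun _ => 1) analyticAt_const analyticAt_const
  simpa using this

end Operator

/-! ### Recurrences without rapidly decaying solutions -/

section Recurrence

/-- Solved for its lowest term, the recurrence bounds `p n` by later terms. With `R > 4M` each use
halves the bound on `‖p n‖ R^n`, so iteration drives it to zero. -/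
theorem eq_zero_of_backward_recurrence {p A B C : ℕ → ℂ} {M : ℝ}
    (hrec : ∀ n, A n * p (n + 2) + B n * p (n + 1) + C n * p n = 0) (hC : ∀ n, C n ≠ 0)
    (hA : ∀ n, ‖A n‖ ≤ M * ‖C n‖) (hB : ∀ n, ‖B n‖ ≤ M * ‖C n‖)
    (hp : ∀ R : ℝ, 0 < R → ∃ K, ∀ n, ‖p n‖ * R ^ n ≤ K) (n : ℕ) : p n = 0 := by
  have hM : 0 ≤ M := by
    have := (norm_nonneg _).trans (hA 0)
    exact nonneg_of_mul_nonneg_left this (norm_pos_iff.2 (hC 0))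
  have hstep : ∀ n, ‖p n‖ ≤ M * (‖p (n + 2)‖ + ‖p (n + 1)‖) := by
    intro n
    have hCn := norm_pos_iff.2 (hC n)
    refine le_of_mul_le_mul_left ?_ hCn
    calc ‖C n‖ * ‖p n‖ = ‖A n * p (n + 2) + B n * p (n + 1)‖ := by
          rw [← norm_mul, ← norm_neg (A n * p (n + 2) + B n * p (n + 1))]
          congr 1
          linear_combination hrec n
      _ ≤ ‖A n‖ * ‖p (n + 2)‖ + ‖B n‖ * ‖p (n + 1)‖ := by
          rw [← norm_mul, ← norm_mul]; exact norm_add_le _ _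
      _ ≤ M * ‖C n‖ * ‖p (n + 2)‖ + M * ‖C n‖ * ‖p (n + 1)‖ := by
          gcongr
          exacts [hA n, hB n]
      _ = _ := by ring
  set R : ℝ := 4 * M + 1 with hR
  have hR0 : 0 < R := by positivity
  obtain ⟨K, hK⟩ := hp R hR0
  have hind : ∀ j : ℕ, ∀ n, ‖p n‖ * R ^ n ≤ K * (1 / 2) ^ j := by
    intro j
    induction j with
    | zero => intro n; simpa using hK n
    | succ j ih =>
      intro n
      set K' := K * (1 / 2) ^ j with hK'
      have h1 := ih (n + 1)
      have h2 := ih (n + 2)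
      have hK0 : 0 ≤ K' := le_trans (by positivity) h1
      have hRn : 0 < R ^ n := pow_pos hR0 n
      have h3 : R * (‖p (n + 1)‖ * R ^ n) ≤ K' := by rw [pow_succ] at h1; linarith
      have h4 : R * (‖p (n + 2)‖ * R ^ n) ≤ K' := by
        have hn2 : 0 ≤ ‖p (n + 2)‖ * R ^ n := by positivity
        have : R * (R * (‖p (n + 2)‖ * R ^ n)) ≤ K' := by
          rw [pow_succ, pow_succ] at h2; linarith
        nlinarith [mul_nonneg hM (mul_nonneg hR0.le hn2)]
      have h5 := mul_le_mul_of_nonneg_right (hstep n) hRn.le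
      have hX : 0 ≤ ‖p (n + 1)‖ * R ^ n := by positivity
      have hY : 0 ≤ ‖p (n + 2)‖ * R ^ n := by positivity
      rw [pow_succ, ← mul_assoc, ← hK']
      rw [hR] at h3 h4
      nlinarith
  have hlim : Tendsto (fun j : ℕ => K * (1 / 2 : ℝ) ^ j) atTop (𝓝 0) := by
    simpa using (tendsto_pow_atTop_nhds_zero_of_lt_one (by norm_num : (0 : ℝ) ≤ 1 / 2)
      (by norm_num)).const_mul K
  have h0 : ‖p n‖ * R ^ n ≤ 0 := ge_of_tendsto' hlim fun j => hind j n
  have hRn : 0 < R ^ n := pow_pos hR0 n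
  exact norm_eq_zero.1 (le_antisymm (by nlinarith [norm_nonneg (p n)]) (norm_nonneg _))

theorem exists_natCast_add_one_le (a : ℂ) (h : ∀ n : ℕ, (n : ℂ) + a ≠ 0) :
    ∃ M : ℝ, 0 ≤ M ∧ ∀ n : ℕ, (n : ℝ) + 1 ≤ M * ‖(n : ℂ) + a‖ := by
  obtain ⟨N, hN⟩ := exists_nat_gt (2 * ‖a‖ + 1)
  have hpos : ∀ n : ℕ, 0 < ‖(n : ℂ) + a‖ := fun n => norm_pos_iff.2 (h n)
  refine ⟨4 + ∑ i ∈ Finset.range N, ((i : ℝ) + 1) / ‖(i : ℂ) + a‖, by positivity, fun n => ?_⟩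
  have hs0 : 0 ≤ ∑ i ∈ Finset.range N, ((i : ℝ) + 1) / ‖(i : ℂ) + a‖ := by positivity
  rw [add_mul]
  by_cases hn : n < N
  · have h1 := Finset.single_le_sum (f := fun i : ℕ => ((i : ℝ) + 1) / ‖(i : ℂ) + a‖)
      (fun i _ => by positivity) (Finset.mem_range.2 hn)
    have h2 := (div_le_iff₀ (hpos n)).1 h1
    have := hpos n
    linarith
  · have hnN : (N : ℝ) ≤ n := by exact_mod_cast not_lt.1 hn
    have h1 : (n : ℝ) ≤ ‖(n : ℂ) + a‖ + ‖a‖ := by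
      have := norm_sub_le ((n : ℂ) + a) a
      rwa [add_sub_cancel_right, Complex.norm_natCast] at this
    have h2 := mul_nonneg hs0 (hpos n).le
    have := norm_nonneg a
    linarith

theorem exists_taylor_decay {f : ℂ → ℂ} {p : ℕ → ℂ} (hf : Differentiable ℂ f) (hp : HasTaylor f p)
    {R : ℝ} (hR : 0 < R) : ∃ K, ∀ n, ‖p n‖ * R ^ n ≤ K := by
  obtain ⟨K, hK⟩ := (isCompact_sphere (0 : ℂ) R).exists_bound_of_continuousOn
    hf.continuous.continuousOn
  refine ⟨K, fun n => ?_⟩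
  have h1 := Complex.norm_iteratedDeriv_le_of_forall_mem_sphere_norm_le n hR hf.diffContOnCl hK
  have hn : (0 : ℝ) < n.factorial := by exact_mod_cast n.factorial_pos
  rw [hp.2, norm_mul, Complex.norm_natCast, mul_div_assoc] at h1
  exact (le_div_iff₀ (pow_pos hR n)).1 (le_of_mul_le_mul_left h1 hn)

end Recurrence


/-! ### The doubly cut plane and independence of the two solutions -/

section CutPlane

theorem isOpen_cutPlane : IsOpen cutPlane := Complex.isOpen_slitPlane.inter isOpen_rightCut

theorem cutPlane_subset_rightCut : cutPlane ⊆ rightCut := fun _ hz => hz.2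

theorem half_mem_cutPlane : (1 / 2 : ℂ) ∈ cutPlane := by
  constructor <;> refine Or.inl ?_ <;> norm_num

theorem isPreconnected_cutPlane : IsPreconnected cutPlane := by
  have e : cutPlane = raySlit (1 / 2) 0 ∩ raySlit (1 / 2) 1 := by
    ext z
    refine and_congr ?_ ?_
    · show z ∈ Complex.slitPlane ↔ (z - 0) / (1 / 2 - 0) ∈ Complex.slitPlane
      rw [show (z - 0) / (1 / 2 - 0) = ((2 : ℝ) : ℂ) * z by push_cast; ring]
      simp [Complex.mem_slitPlane_iff]
    · show 1 - z ∈ Complex.slitPlane ↔ (z - 1) / (1 / 2 - 1) ∈ Complex.slitPlane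
      rw [show (z - 1) / (1 / 2 - 1) = ((2 : ℝ) : ℂ) * (1 - z) by push_cast; norm_num; ring]
      simp [Complex.mem_slitPlane_iff]
  rw [e]
  have hs := (starConvex_raySlit (a := (1 / 2 : ℂ)) (r := 0) (by norm_num)).inter
    (starConvex_raySlit (a := (1 / 2 : ℂ)) (r := 1) (by norm_num))
  exact (hs.isPathConnected (e ▸ half_mem_cutPlane)).isConnected.isPreconnected

theorem one_sub_mem_cutPlane {z : ℂ} (hz : z ∈ cutPlane) : 1 - z ∈ cutPlane :=
  ⟨hz.2, by simpa using hz.1⟩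

theorem ne_zero_of_mem_cutPlane {z : ℂ} (hz : z ∈ cutPlane) : z ≠ 0 :=
  Complex.slitPlane_ne_zero hz.1

theorem ne_one_of_mem_cutPlane {z : ℂ} (hz : z ∈ cutPlane) : z ≠ 1 := fun h =>
  Complex.slitPlane_ne_zero hz.2 (by rw [h, sub_self])

theorem mem_slitPlane_or_mem_rightCut (z : ℂ) : z ∈ Complex.slitPlane ∨ z ∈ rightCut := by
  by_contra! h
  have h1 : z ∉ Complex.slitPlane := h.1
  have h2 : 1 - z ∉ Complex.slitPlane := h.2
  rw [Complex.mem_slitPlane_iff, not_or, not_lt] at h1 h2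
  have := h1.1
  have := h2.1
  simp at this
  linarith

theorem hasDerivAt_cpow_slit (ν : ℂ) {z : ℂ} (hz : z ∈ Complex.slitPlane) :
    HasDerivAt (fun w : ℂ => w ^ ν) (z ^ ν * (ν / (z - 0))) z := by
  have hne := Complex.slitPlane_ne_zero hz
  refine ((hasDerivAt_id' z).cpow_const hz).congr_deriv ?_
  rw [Complex.cpow_sub _ _ hne, Complex.cpow_one, sub_zero]
  ring

end CutPlane

section Independence

variable {α β γ δ q t : ℂ}

/-- Proportionality would make `(1-z)^(δ-1) V` continue to an entire function `P`. It solves a Heun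
equation in whose recurrence the lowest term has the factor `(n-α-1)(n-β-1)`, non-zero as `α, β` are
not integers. Taylor coefficients of entire functions decay faster than any geometric sequence, so
`P = 0`. -/
theorem not_proportional (hδ : γ + δ + (-2) = α + β + 1) (hα : NotInt α) (hβ : NotInt β)
    {V W : ℂ → ℂ} {Q : ℂ} (hV : DifferentiableOn ℂ V rightCut) (hW : DifferentiableOn ℂ W rightCut)
    (hV0 : ¬ ∀ᶠ z in 𝓝 0, V z = 0)
    (hVh : ∀ z ∈ rightCut, heunOp (α + 1 - γ) (β + 1 - γ) (2 - γ) δ (-2) Q t V z = 0) {c : ℂ}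
    (h : ∀ z ∈ cutPlane, z ^ (1 - γ) * V z = c * ((1 - z) ^ (1 - δ) * W (1 - z))) : False := by
  classical
  -- Each formula is holomorphic on one singly cut plane; they agree on the overlap by `h`, and the
  -- two cut planes cover everything.
  set P : ℂ → ℂ := fun z => if z ∈ rightCut then (1 - z) ^ (-(1 - δ)) * V z
    else c * (z ^ (-(1 - γ)) * W (1 - z)) with hP
  have hP1 : ∀ z ∈ rightCut, P z = (1 - z) ^ (-(1 - δ)) * V z := fun z hz => if_pos hz
  have hP2 : ∀ z ∈ Complex.slitPlane, P z = c * (z ^ (-(1 - γ)) * W (1 - z)) := by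
    intro z hz
    by_cases hz' : z ∈ rightCut
    · rw [hP1 z hz']
      have h1 := h z ⟨hz, hz'⟩
      have n0 : z ^ (1 - γ) ≠ 0 := fun h0 =>
        Complex.slitPlane_ne_zero hz ((Complex.cpow_eq_zero_iff _ _).1 h0).1
      have n1 : (1 - z) ^ (1 - δ) ≠ 0 := fun h0 =>
        Complex.slitPlane_ne_zero (show 1 - z ∈ Complex.slitPlane from hz')
          ((Complex.cpow_eq_zero_iff _ _).1 h0).1
      rw [Complex.cpow_neg, Complex.cpow_neg]
      field_simp
      linear_combination h1
    · exact if_neg hz'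
  have hPd : Differentiable ℂ P := by
    intro z
    rcases mem_slitPlane_or_mem_rightCut z with hz | hz
    · have hsub : DifferentiableAt ℂ (fun z => W (1 - z)) z := by
        have h1 : 1 - z ∈ rightCut := by
          show 1 - (1 - z) ∈ Complex.slitPlane
          simpa using hz
        exact (hW.differentiableAt (isOpen_rightCut.mem_nhds h1)).comp z
          ((differentiableAt_id).const_sub 1)
      refine (((hasDerivAt_cpow_slit (-(1 - γ)) hz).differentiableAt.mul hsub).const_mul
        c).congr_of_eventuallyEq ?_
      filter_upwards [Complex.isOpen_slitPlane.mem_nhds hz] with w hw using hP2 w hw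
    · refine ((hasDerivAt_one_sub_cpow (-(1 - δ)) hz).differentiableAt.mul
        (hV.differentiableAt (isOpen_rightCut.mem_nhds hz))).congr_of_eventuallyEq ?_
      filter_upwards [isOpen_rightCut.mem_nhds hz] with w hw using hP1 w hw
  have hnear : ∀ᶠ z in 𝓝 (0 : ℂ), z ∈ rightCut := isOpen_rightCut.mem_nhds zero_mem_rightCut
  have hne : ∀ z ∈ rightCut, (1 - z) ^ (1 - δ) ≠ 0 := fun z hz h0 =>
    Complex.slitPlane_ne_zero (show 1 - z ∈ Complex.slitPlane from hz)
      ((Complex.cpow_eq_zero_iff _ _).1 h0).1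
  have hVP : ∀ z ∈ rightCut, V z = (1 - z) ^ (1 - δ) * P z := by
    intro z hz
    rw [hP1 z hz, Complex.cpow_neg]
    have := hne z hz
    field_simp
  have hPa : ∀ z, AnalyticAt ℂ P z := fun z => hPd.analyticAt z
  have hPh : ∀ᶠ z in 𝓝 (0 : ℂ), heunOp (-β - 1) (-α - 1) (2 - γ) (2 - δ) (-2)
      (Q + (1 - δ) * ((2 - γ) * t)) t P z = 0 := by
    filter_upwards [hnear, isOpen_ne.mem_nhds (zero_ne_one : (0 : ℂ) ≠ 1)] with z hz hz1
    have h1 := hVh z hz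
    rw [heunOp_congr (y₂ := fun w => (1 - w) ^ (1 - δ) * P w) (by
        filter_upwards [isOpen_rightCut.mem_nhds hz] with w hw using hVP w hw),
      heunOp_power_mul_one (by linear_combination hδ) hz1 (by
        filter_upwards [isOpen_rightCut.mem_nhds hz] with w hw
          using hasDerivAt_one_sub_cpow (1 - δ) hw) (hPa z)] at h1
    have h2 := (mul_eq_zero.1 h1).resolve_left (hne z hz)
    rw [← h2, show α + 1 - γ + 1 - δ = -β - 1 by linear_combination -hδ,
      show β + 1 - γ + 1 - δ = -α - 1 by linear_combination -hδ]
  have hT := HasTaylor.of_analyticAt (hPa 0)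
  set p := fun n => iteratedDeriv n P 0 / (n.factorial : ℂ) with hp
  have hrec := (hT.odeOp_eventually_eq_zero_iff _ _ _ _ _ _ _).1 (hPh.mono fun z hz => by
    rw [← heunOp_eq_odeOp]; exact hz)
  have na : ∀ n : ℕ, (n : ℂ) + (-α - 1) ≠ 0 := fun n hn =>
    hα (n - 1) (by push_cast; linear_combination -hn)
  have nb : ∀ n : ℕ, (n : ℂ) + (-β - 1) ≠ 0 := fun n hn =>
    hβ (n - 1) (by push_cast; linear_combination -hn)
  obtain ⟨Ma, hMa0, hMa⟩ := exists_natCast_add_one_le _ na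
  obtain ⟨Mb, hMb0, hMb⟩ := exists_natCast_add_one_le _ nb
  set K := -(Q + (1 - δ) * ((2 - γ) * t)) with hK
  set k₁ := -((2 - γ) * (1 + t) + (2 - δ) * t + -2) with hk₁
  set A : ℕ → ℂ := fun n => t * (n * (n + 1)) + (2 * t + (2 - γ) * t) * n + (2 * t + 2 * ((2 - γ) * t))
    with hA
  set B : ℕ → ℂ := fun n => (-(1 + t)) * (n * (n + 1)) + k₁ * n + (k₁ + K) with hB
  have bound : ∀ a b d : ℂ, ∀ n : ℕ, ‖a * (n * (n + 1)) + b * n + d‖ ≤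
      ((‖a‖ + ‖b‖ + ‖d‖) * (Ma * Mb)) * ‖((n : ℂ) + (-β - 1)) * (n + (-α - 1))‖ := by
    intro a b d n
    refine (norm_quadratic_le a b d n).trans ?_
    rw [norm_mul, mul_assoc]
    refine mul_le_mul_of_nonneg_left ?_ (by positivity)
    have hn : (0 : ℝ) ≤ n + 1 := by positivity
    calc ((n : ℝ) + 1) ^ 2 = (n + 1) * (n + 1) := by ring
      _ ≤ (Mb * ‖(n : ℂ) + (-β - 1)‖) * (Ma * ‖(n : ℂ) + (-α - 1)‖) :=
        mul_le_mul (hMb n) (hMa n) hn (by positivity)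
      _ = _ := by ring
  have hp0 : ∀ n, p n = 0 := by
    refine eq_zero_of_backward_recurrence (A := A) (B := B)
      (C := fun n => ((n : ℂ) + (-β - 1)) * (n + (-α - 1)))
      (M := max ((‖t‖ + ‖2 * t + (2 - γ) * t‖ + ‖2 * t + 2 * ((2 - γ) * t)‖) * (Ma * Mb))
        ((‖-(1 + t)‖ + ‖k₁‖ + ‖k₁ + K‖) * (Ma * Mb))) ?_
      (fun n => mul_ne_zero (nb n) (na n)) ?_ ?_
      (fun R hR => exists_taylor_decay hPd hT hR)
    · intro n
      have := hrec (n + 1)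
      simp only [odeCoeff, shiftSeq_succ] at this
      push_cast at this
      simp only [hA, hB]
      obtain rfl : δ = α + β + 3 - γ := by linear_combination hδ
      linear_combination this
    · intro n
      exact (bound _ _ _ n).trans (mul_le_mul_of_nonneg_right (le_max_left _ _) (norm_nonneg _))
    · intro n
      exact (bound _ _ _ n).trans (mul_le_mul_of_nonneg_right (le_max_right _ _) (norm_nonneg _))
  have hp' : p = fun n => if n = 0 then (0 : ℂ) else 0 := by
    ext n
    rw [hp0 n, ite_self]
  rw [hp'] at hT
  refine hV0 ?_
  filter_upwards [hT.eventuallyEq (hasTaylor_const 0), hnear] with z hz hz'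
  rw [hVP z hz', hz, mul_zero]

/-- The Wronskian is non-zero at a point of `U`, so Cramer's rule matches the initial data there;
uniqueness and the identity theorem do the rest. -/
theorem exists_linear_combination_of_solutions {ε : ℂ} {Y₀ Y₁ : ℂ → ℂ}
    (hY₀ : DifferentiableOn ℂ Y₀ cutPlane) (hY₁ : DifferentiableOn ℂ Y₁ cutPlane)
    (h₀ : ∀ z ∈ cutPlane, heunOp α β γ δ ε q t Y₀ z = 0)
    (h₁ : ∀ z ∈ cutPlane, heunOp α β γ δ ε q t Y₁ z = 0)
    (hind : ∀ a b : ℂ, (∀ z ∈ cutPlane, a * Y₀ z + b * Y₁ z = 0) → a = 0 ∧ b = 0)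
    {U : Set ℂ} {y : ℂ → ℂ} (hU : IsOpen U) (hUc : IsPreconnected U) (hUs : U ⊆ cutPlane \ {t})
    (hy : IsHeunSolution α β γ δ ε q t U y) :
    ∃ a b : ℂ, ∀ z ∈ U, y z = a * Y₀ z + b * Y₁ z := by
  rcases U.eq_empty_or_nonempty with rfl | ⟨x, hx⟩
  · exact ⟨0, 0, fun z hz => hz.elim⟩
  have hxc := (hUs hx).1
  have hxt : x ≠ t := (hUs hx).2
  have hx0 := ne_zero_of_mem_cutPlane hxc
  have hx1 := ne_one_of_mem_cutPlane hxc
  rw [isHeunSolution_iff (fun h => ne_zero_of_mem_cutPlane (hUs h).1 rfl)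
    (fun h => ne_one_of_mem_cutPlane (hUs h).1 rfl) (fun h => (hUs h).2 rfl)] at hy
  have a₀ : ∀ z ∈ cutPlane, AnalyticAt ℂ Y₀ z := hY₀.analyticOnNhd isOpen_cutPlane
  have a₁ : ∀ z ∈ cutPlane, AnalyticAt ℂ Y₁ z := hY₁.analyticOnNhd isOpen_cutPlane
  have ay : ∀ z ∈ U, AnalyticAt ℂ y z := hy.1.analyticOnNhd hU
  have combA : ∀ a b, ∀ z ∈ cutPlane, AnalyticAt ℂ (fun w => a * Y₀ w + b * Y₁ w) z :=
    fun a b z hz => (analyticAt_const.mul (a₀ z hz)).add (analyticAt_const.mul (a₁ z hz))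
  have combD : ∀ a b, deriv (fun w => a * Y₀ w + b * Y₁ w) x = a * deriv Y₀ x + b * deriv Y₁ x :=
    fun a b => (((a₀ x hxc).differentiableAt.hasDerivAt.const_mul a).fun_add
      ((a₁ x hxc).differentiableAt.hasDerivAt.const_mul b)).deriv
  have combH : ∀ a b, ∀ z ∈ cutPlane, heunOp α β γ δ ε q t (fun w => a * Y₀ w + b * Y₁ w) z = 0 :=
    fun a b z hz => by
      rw [heunOp_linear _ _ _ _ _ _ _ (a₀ z hz) (a₁ z hz), h₀ z hz, h₁ z hz]; ring
  have hW : Y₀ x * deriv Y₁ x - Y₁ x * deriv Y₀ x ≠ 0 := by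
    intro hW
    have key : ∀ a b, a * Y₀ x + b * Y₁ x = 0 → a * deriv Y₀ x + b * deriv Y₁ x = 0 →
        a = 0 ∧ b = 0 := by
      intro a b e0 e1
      refine hind a b ?_
      have hev := eventually_eq_zero_of_heunOp (combA a b x hxc) hx0 hx1 hxt
        (by filter_upwards [isOpen_cutPlane.mem_nhds hxc] with w hw using combH a b w hw) e0
        ((combD a b).trans e1)
      exact AnalyticOnNhd.eqOn_zero_of_preconnected_of_eventuallyEq_zero (combA a b)
        isPreconnected_cutPlane hxc hev
    -- Were the Wronskian zero, these two relations would give `Y₀ x = 0` and `deriv Y₀ x = 0`, and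
    -- the third that `Y₀` itself is a trivial combination.
    have k1 := key (Y₁ x) (-Y₀ x) (by ring) (by linear_combination -hW)
    have k2 := key (deriv Y₁ x) (-deriv Y₀ x) (by linear_combination hW) (by ring)
    have k3 := key 1 0 (by linear_combination -k1.2) (by linear_combination -k2.2)
    exact one_ne_zero k3.1
  set D := Y₀ x * deriv Y₁ x - Y₁ x * deriv Y₀ x with hD
  set a := (y x * deriv Y₁ x - Y₁ x * deriv y x) / D with ha
  set b := (Y₀ x * deriv y x - y x * deriv Y₀ x) / D with hb
  refine ⟨a, b, fun z hz => ?_⟩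
  have an : ∀ z ∈ U, AnalyticAt ℂ (fun w => 1 * y w + (-1) * (a * Y₀ w + b * Y₁ w)) z :=
    fun z hz => (analyticAt_const.mul (ay z hz)).add
      (analyticAt_const.mul (combA a b z (hUs hz).1))
  have hev := eventually_eq_zero_of_heunOp (α := α) (β := β) (γ := γ) (δ := δ) (ε := ε) (q := q)
    (an x hx) hx0 hx1 hxt (by
      filter_upwards [hU.mem_nhds hx] with w hw
      rw [heunOp_linear _ _ _ _ _ _ _ (ay w hw) (combA a b w (hUs hw).1), hy.2 w hw,
        combH a b w (hUs hw).1]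
      ring) (by rw [ha, hb]; field_simp; rw [hD]; ring) (by
      have := ((ay x hx).differentiableAt.hasDerivAt.const_mul 1).fun_add
        ((combA a b x hxc).differentiableAt.hasDerivAt.const_mul (-1))
      rw [this.deriv, combD, ha, hb]
      field_simp
      rw [hD]
      ring)
  have := AnalyticOnNhd.eqOn_zero_of_preconnected_of_eventuallyEq_zero an hUc hx hev hz
  simp only [Pi.zero_apply] at this
  linear_combination this

end Independence


/-! ### The six hypergeometric functions -/

section SixFunctions

variable {α β γ δ q t : ℂ}

/-- Apparency is invariant under `z ↦ 1 - z`, so the construction at `0` can be repeated with `δ, αβ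
- q, 1 - t` to obtain the family at `1`. -/
theorem apparentCubic_reflect (hδ : γ + δ + (-2) = α + β + 1) :
    apparentCubic α β δ (α * β - q) (1 - t) = -apparentCubic α β γ q t := by
  obtain rfl : δ = α + β + 3 - γ := by linear_combination hδ
  unfold apparentCubic
  ring

theorem natDegree_hPoly_le : (hPoly α β γ q t).natDegree ≤ 2 := Polynomial.natDegree_quadratic_le

theorem eq_zero_near_zero_of_forall_cutPlane {V : ℂ → ℂ} (hV : DifferentiableOn ℂ V rightCut)
    (h : ∀ z ∈ cutPlane, V z = 0) : ∀ᶠ z in 𝓝 0, V z = 0 := by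
  have hev : ∀ᶠ z in 𝓝 (1 / 2 : ℂ), V z = 0 := by
    filter_upwards [isOpen_cutPlane.mem_nhds half_mem_cutPlane] with z hz using h z hz
  have := (hV.analyticOnNhd isOpen_rightCut).eqOn_zero_of_preconnected_of_eventuallyEq_zero
    isPreconnected_rightCut half_mem_cutPlane.2 hev
  filter_upwards [isOpen_rightCut.mem_nhds zero_mem_rightCut] with z hz using this hz

theorem exists_six_functions (hδ : γ + δ + (-2) = α + β + 1) (hcubic : apparentCubic α β γ q t = 0)
    (hα : NotInt α) (hβ : NotInt β) (hβγ : NotInt (β - γ)) (hβδ : NotInt (β - δ))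
    (hγ : NotNonposInt (2 - γ)) (hγ' : NotNonposInt (γ - α - β - 1)) :
    ∃ f g : Fin 3 → ℂ → ℂ,
      (∀ k, DifferentiableOn ℂ (f k) cutPlane) ∧ (∀ k, DifferentiableOn ℂ (g k) cutPlane) ∧
      (∀ k, ∀ z ∈ cutPlane, ‖z‖ < 1 → f k z = z ^ (1 - γ + (k : ℂ)) *
        ordinaryHypergeometric (α - γ + 3) (β - γ + (k : ℂ) + 1) (2 - γ + (k : ℂ)) z) ∧
      (∀ k, ∀ z ∈ cutPlane, ‖1 - z‖ < 1 → g k z = (1 - z) ^ (γ - α - β - 2 + (k : ℂ)) *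
        ordinaryHypergeometric (γ - α - 2 + (k : ℂ)) (γ - β) (γ - α - β - 1 + (k : ℂ)) (1 - z)) ∧
      ∀ (U : Set ℂ) (y : ℂ → ℂ), IsOpen U → IsPreconnected U → U ⊆ cutPlane \ {t} →
        IsHeunSolution α β γ δ (-2) q t U y →
        ∃ a b : Fin 3 → ℂ, ∀ z ∈ U, y z = ∑ k, (a k * f k z + b k * g k z) := by
  have hδ' : δ + γ + (-2) = α + β + 1 := by linear_combination hδ
  have ne : ∀ {c r s : ℂ}, hPoly α β c r s ≠ 0 := fun {c r s} h0 => by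
    rcases hPoly_eq_zero_iff.1 h0 with h1 | h1
    · exact hα 0 (by simpa using h1.1)
    · exact hα (-1) (by simpa using h1.1)
  obtain ⟨F, V, a, hF, hFh, hV, hV0, hVh, hVF⟩ := exists_local_solution hδ
    (isKernelPoly_hPoly hδ hcubic) natDegree_hPoly_le ne hβγ hγ
  obtain ⟨G, W, b, hG, hGh, hW, hW0, hWh, hWG⟩ := exists_local_solution hδ'
    (isKernelPoly_hPoly hδ' (by rw [apparentCubic_reflect hδ, hcubic, neg_zero])) natDegree_hPoly_le
    ne hβδ (by rwa [show 2 - δ = γ - α - β - 1 by linear_combination -hδ])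
  have cpow_add_nat : ∀ {z : ℂ} (ν : ℂ) (k : Fin 3), z ≠ 0 →
      z ^ (ν + (k : ℂ)) = z ^ ν * z ^ (k : ℕ) := fun ν k hz => by
    rw [Complex.cpow_add _ _ hz, Complex.cpow_natCast]
  have dpow : ∀ ν : ℂ, DifferentiableOn ℂ (fun z : ℂ => z ^ ν) cutPlane := fun ν z hz =>
    (hasDerivAt_cpow_slit ν hz.1).differentiableAt.differentiableWithinAt
  have refl : ∀ {y : ℂ → ℂ}, DifferentiableOn ℂ y cutPlane →
      DifferentiableOn ℂ (fun z => y (1 - z)) cutPlane := fun hy =>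
    hy.comp (by fun_prop) fun z hz => one_sub_mem_cutPlane hz
  set f : Fin 3 → ℂ → ℂ := fun k z => z ^ (1 - γ + (k : ℂ)) * F k z with hf
  set g₀ : Fin 3 → ℂ → ℂ := fun k z => z ^ (1 - δ + (k : ℂ)) * G k z with hg₀
  set g : Fin 3 → ℂ → ℂ := fun k z => g₀ k (1 - z) with hg
  set Y₀ : ℂ → ℂ := fun z => z ^ (1 - γ) * V z with hY₀
  set X : ℂ → ℂ := fun z => z ^ (1 - δ) * W z with hX
  set Y₁ : ℂ → ℂ := fun z => X (1 - z) with hY₁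
  have dY₀ : DifferentiableOn ℂ Y₀ cutPlane := (dpow _).mul (hV.mono cutPlane_subset_rightCut)
  have dX : DifferentiableOn ℂ X cutPlane := (dpow _).mul (hW.mono cutPlane_subset_rightCut)
  have hY₀h : ∀ z ∈ cutPlane, heunOp α β γ δ (-2) q t Y₀ z = 0 := fun z hz => by
    rw [hY₀, heunOp_power_mul_zero hδ (ne_zero_of_mem_cutPlane hz) (by
        filter_upwards [Complex.isOpen_slitPlane.mem_nhds hz.1] with w hw
          using hasDerivAt_cpow_slit (1 - γ) hw) (hV.analyticOnNhd isOpen_rightCut z hz.2)]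
    have := hVh z hz.2
    rw [sub_eq_add_neg (δ * t)] at this
    rw [this, mul_zero]
  have hXh : ∀ z ∈ cutPlane, heunOp α β δ γ (-2) (α * β - q) (1 - t) X z = 0 := fun z hz => by
    rw [hX, heunOp_power_mul_zero hδ' (ne_zero_of_mem_cutPlane hz) (by
        filter_upwards [Complex.isOpen_slitPlane.mem_nhds hz.1] with w hw
          using hasDerivAt_cpow_slit (1 - δ) hw) (hW.analyticOnNhd isOpen_rightCut z hz.2)]
    have := hWh z hz.2
    rw [sub_eq_add_neg (γ * (1 - t))] at this
    rw [this, mul_zero]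
  have hY₁h : ∀ z ∈ cutPlane, heunOp α β γ δ (-2) q t Y₁ z = 0 := fun z hz => by
    rw [hY₁, heunOp_reflect, hXh _ (one_sub_mem_cutPlane hz), neg_zero]
  have sum₀ : ∀ z ∈ cutPlane, Y₀ z = ∑ k, a k * f k z := fun z hz => by
    simp only [hY₀, hf, hVF z, Finset.mul_sum]
    refine Finset.sum_congr rfl fun k _ => ?_
    rw [cpow_add_nat _ _ (ne_zero_of_mem_cutPlane hz)]
    ring
  have sum₁ : ∀ z ∈ cutPlane, Y₁ z = ∑ k, b k * g k z := fun z hz => by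
    simp only [hY₁, hX, hg, hg₀, hWG (1 - z), Finset.mul_sum]
    refine Finset.sum_congr rfl fun k _ => ?_
    rw [cpow_add_nat _ _ (ne_zero_of_mem_cutPlane (one_sub_mem_cutPlane hz))]
    ring
  have hind : ∀ c d : ℂ, (∀ z ∈ cutPlane, c * Y₀ z + d * Y₁ z = 0) → c = 0 ∧ d = 0 := by
    intro c d hcd
    -- A relation with `c ≠ 0` would make the solutions proportional; once `c = 0`, a non-zero `d`
    -- would make `W` vanish.
    have hc : c = 0 := by
      by_contra hc
      refine not_proportional hδ hα hβ hV hW hV0 hVh (c := -d / c) fun z hz => ?_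
      have := hcd z hz
      simp only [hY₀, hY₁, hX] at this
      field_simp
      linear_combination this
    refine ⟨hc, by_contra fun hd => hW0 (eq_zero_near_zero_of_forall_cutPlane hW fun z hz => ?_)⟩
    have := hcd (1 - z) (one_sub_mem_cutPlane hz)
    rw [hc, zero_mul, zero_add] at this
    have h1 := (mul_eq_zero.1 this).resolve_left hd
    simp only [hY₁, hX, sub_sub_cancel] at h1
    exact (mul_eq_zero.1 h1).resolve_left fun h0 =>
      ne_zero_of_mem_cutPlane hz ((Complex.cpow_eq_zero_iff _ _).1 h0).1
  refine ⟨f, g, fun k => (dpow _).mul ((hF k).mono cutPlane_subset_rightCut),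
    fun k => refl ((dpow _).mul ((hG k).mono cutPlane_subset_rightCut)),
    fun k z _ hz => by simp only [hf, hFh k z hz], fun k z _ hz => ?_, ?_⟩
  · simp only [hg, hg₀, hGh k _ hz]
    rw [show 1 - δ + (k : ℂ) = γ - α - β - 2 + k by linear_combination -hδ,
      show 2 - δ + (k : ℂ) = γ - α - β - 1 + k by linear_combination -hδ,
      show α - δ + 3 = γ - β by linear_combination -hδ,
      show β - δ + (k : ℂ) + 1 = γ - α - 2 + k by linear_combination -hδ]
    rw [ordinaryHypergeometric, ordinaryHypergeometric, ordinaryHypergeometricSeries_symm]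
  · intro U y hU hUc hUs hy
    obtain ⟨c, d, hcd⟩ := exists_linear_combination_of_solutions dY₀ (refl dX) hY₀h hY₁h hind hU hUc
      hUs hy
    refine ⟨fun k => c * a k, fun k => d * b k, fun z hz => ?_⟩
    rw [hcd z hz, sum₀ z (hUs hz).1]
    change _ + d * Y₁ z = _
    rw [sum₁ z (hUs hz).1, Finset.mul_sum, Finset.mul_sum, ← Finset.sum_add_distrib]
    exact Finset.sum_congr rfl fun k _ => by ring

end SixFunctions

end HeunApp

/-! ### Assembly -/

theorem mainTheorem7 (α β γ δ q t : ℂ) (ht0 : t ≠ 0) (ht1 : t ≠ 1)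
    (hδ : γ + δ + (-2) = α + β + 1) :
    -- apparency of `z = t` is the cubic condition on `q`
    (HeunApp.IsApparent α β γ δ 2 q t ↔ HeunApp.apparentCubic α β γ q t = 0) ∧
    (HeunApp.IsApparent α β γ δ 2 q t →
      -- `w^(β-γ) (w-1)^(β-δ) h(w)` solves the transformed equation,
      HeunApp.SolvesTransformed α β γ δ q t (HeunApp.hPoly α β γ q t) ∧
      -- and is non-zero outside an explicit degenerate case;
      (HeunApp.hPoly α β γ q t = 0 ↔
        (α = 0 ∧ q = 0) ∨
        (α = -1 ∧ q ^ 2 + ((β + 2) * t + γ - 2) * q + β * γ * t = 0)) ∧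
      -- in all cases there is a non-zero solution of this form;
      (∃ h₀ : Polynomial ℂ, h₀ ≠ 0 ∧ h₀.natDegree ≤ 2 ∧
        HeunApp.SolvesTransformed α β γ δ q t h₀) ∧
      -- the Pochhammer integrals are solutions of Heun's equation;
      (∀ p : ℂ, p = 0 ∨ p = 1 → ∀ (o z₀ u u' : ℂ) (τ : Path o (z₀ + u)) (τ' : Path o (p + u')),
        HeunApp.IsAdmissible p z₀ u u' τ τ' →
        ∀ (L₀ L₁ : ℝ → ℂ) (L : ℂ × ℝ → ℂ),
          HeunApp.IsBranchData
            (HeunApp.commutatorLoop (HeunApp.loopAround z₀ u τ) (HeunApp.loopAround p u' τ'))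
            (Metric.ball z₀ ‖u‖) L₀ L₁ L →
          HeunApp.IsHeunSolution α β γ δ (-2) q t (Metric.ball z₀ ‖u‖ \ {t})
            (HeunApp.contourIntegral β γ δ (HeunApp.hPoly α β γ q t)
              (HeunApp.commutatorLoop (HeunApp.loopAround z₀ u τ) (HeunApp.loopAround p u' τ'))
              L₀ L₁ L)) ∧
      (HeunApp.NotInt α → HeunApp.NotInt β → HeunApp.NotInt (β - γ) → HeunApp.NotInt (β - δ) →
        -- the Pochhammer integrals taken along the segment from `p` to `z` are non-zero;
        (∀ p : ℂ, p = 0 ∨ p = 1 → ∀ o z₀ u u' : ℂ,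
          o ∈ segment ℝ p z₀ → z₀ + u ∈ segment ℝ p z₀ → p + u' ∈ segment ℝ p z₀ →
          HeunApp.IsAdmissible p z₀ u u' (Path.segment o (z₀ + u)) (Path.segment o (p + u')) →
          ∀ (L₀ L₁ : ℝ → ℂ) (L : ℂ × ℝ → ℂ),
            HeunApp.IsBranchData
              (HeunApp.commutatorLoop (HeunApp.loopAround z₀ u (Path.segment o (z₀ + u)))
                (HeunApp.loopAround p u' (Path.segment o (p + u'))))
              (Metric.ball z₀ ‖u‖) L₀ L₁ L →
            ∃ z ∈ Metric.ball z₀ ‖u‖ \ {t},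
              HeunApp.contourIntegral β γ δ (HeunApp.hPoly α β γ q t)
                (HeunApp.commutatorLoop (HeunApp.loopAround z₀ u (Path.segment o (z₀ + u)))
                  (HeunApp.loopAround p u' (Path.segment o (p + u'))))
                L₀ L₁ L z ≠ 0) ∧
        -- every solution is a combination of six hypergeometric functions.
        (HeunApp.NotNonposInt (2 - γ) → HeunApp.NotNonposInt (γ - α - β - 1) →
          ∃ f g : Fin 3 → ℂ → ℂ,
            (∀ k, DifferentiableOn ℂ (f k) HeunApp.cutPlane) ∧
            (∀ k, DifferentiableOn ℂ (g k) HeunApp.cutPlane) ∧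
            (∀ k, ∀ z ∈ HeunApp.cutPlane, ‖z‖ < 1 →
              f k z = z ^ (1 - γ + (k : ℂ)) *
                ordinaryHypergeometric (α - γ + 3) (β - γ + (k : ℂ) + 1) (2 - γ + (k : ℂ)) z) ∧
            (∀ k, ∀ z ∈ HeunApp.cutPlane, ‖1 - z‖ < 1 →
              g k z = (1 - z) ^ (γ - α - β - 2 + (k : ℂ)) *
                ordinaryHypergeometric (γ - α - 2 + (k : ℂ)) (γ - β)
                  (γ - α - β - 1 + (k : ℂ)) (1 - z)) ∧
            ∀ (U : Set ℂ) (y : ℂ → ℂ), IsOpen U → IsPreconnected U →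
              U ⊆ HeunApp.cutPlane \ {t} → HeunApp.IsHeunSolution α β γ δ (-2) q t U y →
              ∃ a b : Fin 3 → ℂ, ∀ z ∈ U, y z = ∑ k, (a k * f k z + b k * g k z)))) := by
  refine ⟨⟨HeunApp.apparentCubic_eq_zero_of_isApparent ht0 ht1 hδ,
    HeunApp.isApparent_of_apparentCubic_eq_zero ht0 ht1 hδ⟩, fun happ => ?_⟩
  have hcubic := HeunApp.apparentCubic_eq_zero_of_isApparent ht0 ht1 hδ happ
  have hker := HeunApp.isKernelPoly_hPoly hδ hcubic
  obtain ⟨h₀, hne, hdeg, hh₀⟩ := HeunApp.exists_isKernelPoly hδ hcubic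
  refine ⟨hker.solvesTransformed hδ, HeunApp.hPoly_eq_zero_iff,
    ⟨h₀, hne, hdeg, hh₀.solvesTransformed hδ⟩, ?_, fun hα hβ hβγ hβδ => ⟨?_, ?_⟩⟩
  · intro p _ o z₀ u u' τ τ' hadm L₀ L₁ L hb
    exact HeunApp.isHeunSolution_contourIntegral hδ hker hadm hb
  · intro p hp o z₀ u u' ho hu hu' hadm L₀ L₁ L hb
    refine HeunApp.exists_contourIntegral_ne_zero (fun h0 => ?_) hβ hβγ hβδ hp ho hu hu' hadm hb
    rcases HeunApp.hPoly_eq_zero_iff.1 h0 with h1 | h1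
    · exact hα 0 (by simpa using h1.1)
    · exact hα (-1) (by simpa using h1.1)
  · exact HeunApp.exists_six_functions hδ hcubic hα hβ hβγ hβδ
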